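/- Let $(K,d)$ be a complete metric space (not necessarily separable) and let $\mathcal M=(K_{i(e)},w_e,p_e)_{e\in E}$ be a countable Markov system on $K$: $(K_j)_{j\in N}$, $1\in N\subset\mathbb N$, is a partition of $K$ into non-empty Borel sets, $E$ is at most countable, $i,t:E\to N$ with $i$ surjective, and, for every $e\in E$, $w_e:K_{i(e)}\to K_{t(e)}$ and $p_e:K_{i(e)}\to[0,1]$ are Borel measurable, $p_e$ is not identically zero, and $\sum_{i(e)=j}p_e=1$ on $K_j$ for every $j\in N$. Extend $p_e$ to $K$ by zero and $w_e$ to $K$ in an arbitrary Borel measurable way. Let $Uf:=\sum_{e}p_e\,f\circ w_e$, let $U^*\nu(f):=\int Uf\,d\nu$, and let $P(\mathcal M)$ be the set of Borel probability measures $\mu$ on $K$ with $U^*\mu=\mu$. Let $\bar E:=E\cup\{\infty\}$ be the one-point compactification of the discrete space $E$, with $i(\infty)=t(\infty)=1$, $w_\infty=\mathrm{id}$, $p_\infty=0$. Let $\bar\Sigma:=\bar E^{\mathbb Z}$ with its product (= Borel) $\sigma$-algebra, $S$ the left shift, $P_S(\bar\Sigma)$ the set of $S$-invariant probability measures, ${}_m[e_m,\dots,e_n]:=\{\sigma\in\bar\Sigma:\sigma_k=e_k,\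 m\le k\le n\}$, $\mathcal F$ the $\sigma$-algebra generated by all cylinder sets ${}_m[e_m,\dots,e_0]$, $m\le0$, and $\Sigma_G:=\{\sigma: \sigma_n\in E,\ i(\sigma_{n+1})=t(\sigma_n)\text{ for all }n\in\mathbb Z\}$. Fix $x_j\in K_j$ for all $j\in N$. Let $D$ be the set of all $\sigma\in\Sigma_G$ for which $\lim_{m\to-\infty}w_{\sigma_0}\circ\cdots\circ w_{\sigma_m}(x_{i(\sigma_m)})$ exists. Let $F(\sigma)$ be this limit if $\sigma\in D$ and $F(\sigma):=x_{t(\sigma_0)}$ otherwise, and put $F(\Lambda)(B):=\Lambda(F^{-1}(B))$ for measures $\Lambda$ on $\bar\Sigma$. Define the equilibrium states $$E(\mathcal M):=\{\Lambda\in P_S(\bar\Sigma):\Lambda(D)=1,\ E_\Lambda(1_{{}_1[e]}|\mathcal F)=p_e\circ F\ \Lambda\text{-a.e. for all }e\in E\}.$$ When all $p_e|_{K_{i(e)}}$ are uniformly continuous, let $\bar p_e$ be the continuous extension of $p_e|_{K_{i(e)}}$ to $\overline{K_{i(e)}}$, extended by zero to $K$, let $T_j:=\{\sigma\in\Sigma_G: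 t(\sigma_0)=j\}$, and define the asymptotic states $$\tilde E(\mathcal M):=\{\Lambda\in P_S(\bar\Sigma):\Lambda(D)=1,\ E_\Lambda(1_{{}_1[e]}|\mathcal F)=\bar p_e\circ F\,1_{T_{i(e)}}\ \Lambda\text{-a.e. for all }e\in E\}.$$ $\mathcal M$ is called non-degenerate if for every $\Lambda\in\tilde E(\mathcal M)$ there is $j\in N$ with $\Lambda(T_j\cap F^{-1}(K_j))>0$. For $\mu\in P(\mathcal M)$ let $\Phi(\mu)$ be the unique probability measure on $\bar\Sigma$ with $$\Phi(\mu)({}_m[e_m,\dots,e_n])=\int p_{e_m}(y)\,p_{e_{m+1}}(w_{e_m}y)\cdots p_{e_n}(w_{e_{n-1}}\circ\cdots\circ w_{e_m}y)\,d\mu(y)$$ for all $m\le 0$, $n\ge m$ and $e_m,\dots,e_n\in\bar E$. Suppose that - $\mathcal M$ is contractive: there is $0<a<1$ with $\sum_{i(e)=j}p_e(y)\,d(w_ey,w_ez)\le a\,d(y,z)$ for all $y,z\in K_j$, $j\in N$; - $\mathcal M$ is uniformly continuous: $w_e|_{K_{i(e)}}$ and $p_e|_{K_{i(e)}}$ are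 uniformly continuous for every $e\in E$; - $\mathcal M$ is non-degenerate; - $b:=\sup_{j\in N}\sup_{y\in K_j}\sum_{i(e)=j}p_e(y)\,d(w_e(x_j),x_{t(e)})<\infty$. Then the following holds. (i) Suppose $\mathcal M$ has a dominating Markov chain, i.e. $\sum_{i(e)=j}\sup_{K_j}p_e<\infty$ for every $j\in N$. Then $E(\mathcal M)$ is non-empty if and only if there is $y\in K$ such that the probability measures $\alpha_n^y$ on $N$ given by $\alpha^y_n(\{j\}):=\frac1n\sum_{k=1}^n (U^*)^k\delta_y(K_j)$, $n\ge1$, are uniformly tight, i.e. for every $\epsilon>0$ there is a finite $V\subset N$ with $\alpha_n^y(N\setminus V)<\epsilon$ for all $n\ge1$. (ii) $\Phi$ is well defined on $P(\mathcal M)$ and it is the inverse of $F:E(\mathcal M)\to P(\mathcal M)$: $F$ maps $E(\mathcal M)$ bijectively onto $P(\mathcal M)$, $\Phi$ maps $P(\mathcal M)$ into $E(\mathcal M)$, $\Phi(F(\Lambda))=\Lambda$ for all $\Lambda\in E(\mathcal M)$, and $F(\Phi(\mu))=\mu$ for all $\mu\in P(\mathcal M)$. Moreover, the map $F:E(\mathcal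 M)\to P(\mathcal M)$ does not depend on the choice of the points $x_j\in K_j$ as long as $b$ remains finite: for another choice $x'_j\in K_j$ with finite $b$, the set $E(\mathcal M)$ and the measures $F(\Lambda)$, $\Lambda\in E(\mathcal M)$, are the same. -/

import Mathlib

open MeasureTheory Filter Topology
open scoped ENNReal

noncomputable section

/-- A countable Markov system `(K_{i(e)}, w_e, p_e)_{e ∈ E}` on a metric space `K` with vertex sets
`K_j = cell j`, `j ∈ N ⊆ ℕ`, `1 ∈ N`.  The maps `w_e` are taken with an arbitrary Borel extension
from `K_{i(e)}` to `K` and the probability functions `p_e` with their extension by zero. -/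
structure MarkovSystem (K : Type*) [MetricSpace K] [MeasurableSpace K] [BorelSpace K]
    (N : Set ℕ) (E : Type*) [Countable E] where
  one_mem : 1 ∈ N
  cell : N → Set K
  cell_measurable : ∀ j, MeasurableSet (cell j)
  cell_nonempty : ∀ j, (cell j).Nonempty
  cell_disjoint : Pairwise (fun j k => Disjoint (cell j) (cell k))
  cell_cover : ⋃ j, cell j = Set.univ
  i : E → N
  t : E → N
  i_surjective : Function.Surjective i
  w : E → K → K
  w_measurable : ∀ e, Measurable (w e)
  w_mapsTo : ∀ e, Set.MapsTo (w e) (cell (i e)) (cell (t e))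
  p : E → K → ℝ
  p_measurable : ∀ e, Measurable (p e)
  p_mem : ∀ e y, p e y ∈ Set.Icc (0 : ℝ) 1
  p_eq_zero : ∀ e y, y ∉ cell (i e) → p e y = 0
  p_pos : ∀ e, ∃ y ∈ cell (i e), 0 < p e y
  p_sum : ∀ j, ∀ y ∈ cell j, HasSum (fun e : {e : E // i e = j} => p e y) 1

/-- The extended alphabet `E ∪ {∞}` with `∞ = none`.  Every subset is a Borel set of its one-point
compactification topology. -/
def Alphabet (E : Type*) : Type _ := Option E

instance (E : Type*) : MeasurableSpace (Alphabet E) := ⊤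

instance (E : Type*) : DiscreteMeasurableSpace (Alphabet E) := ⟨fun _ => trivial⟩

instance (E : Type*) [Countable E] : Countable (Alphabet E) :=
  inferInstanceAs (Countable (Option E))

/-- A letter `e ∈ E` as an element of the extended alphabet. -/
def letter {E : Type*} (e : E) : Alphabet E := some e

/-- The code space of two-sided sequences over the extended alphabet, with the product
`σ`-algebra (which is the Borel `σ`-algebra, the alphabet having a countable base). -/
abbrev CodeSpace (E : Type*) : Type _ := ℤ → Alphabet E

/-- The left shift `(S σ)_{n-1} = σ_n`. -/
def shift {E : Type*} (σ : CodeSpace E) : CodeSpace E := fun n => σ (n + 1)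

/-- The cylinder set of all `σ` with `σ_m = l_0, σ_{m+1} = l_1, …` along the finite word `l`. -/
def cyl {E : Type*} (m : ℤ) (l : List (Alphabet E)) : Set (CodeSpace E) :=
  {σ | ∀ k (hk : k < l.length), σ (m + k) = l[k]}

/-- The `σ`-algebra generated by the cylinder sets over the coordinates `-n, …, 0`. -/
@[reducible] def pastSigmaFrom (E : Type*) (n : ℕ) : MeasurableSpace (CodeSpace E) :=
  MeasurableSpace.generateFrom
    {A | ∃ l : List (Alphabet E), l.length = n + 1 ∧ A = cyl (-(n : ℤ)) l}

/-- The `σ`-algebra generated by all the cylinder sets over `-n, …, 0`, `n ≥ 0`. -/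
@[reducible] def pastSigma (E : Type*) : MeasurableSpace (CodeSpace E) := ⨆ n : ℕ, pastSigmaFrom E n

theorem measurableSet_cyl {E : Type*} (m : ℤ) (l : List (Alphabet E)) :
    MeasurableSet (cyl m l) := by
  have h : cyl m l = ⋂ k : Fin l.length,
      (fun σ : CodeSpace E => σ (m + (k : ℕ))) ⁻¹' {l[(k : ℕ)]} := by
    ext σ
    simp only [cyl, Set.mem_ofPred_eq, Set.mem_iInter, Set.mem_preimage, Set.mem_singleton_iff]
    exact ⟨fun h k => h k k.2, fun h k hk => h ⟨k, hk⟩⟩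
  rw [h]
  exact MeasurableSet.iInter fun k => measurable_pi_apply _ (MeasurableSet.of_discrete)

theorem pastSigma_le (E : Type*) :
    pastSigma E ≤ (inferInstance : MeasurableSpace (CodeSpace E)) := by
  refine iSup_le fun n => MeasurableSpace.generateFrom_le ?_
  rintro A ⟨l, -, rfl⟩
  exact measurableSet_cyl _ _

/-- The shift invariant Borel probability measures on the code space. -/
def shiftInvariant (E : Type*) : Set (Measure (CodeSpace E)) :=
  {Λ | IsProbabilityMeasure Λ ∧ Λ.map shift = Λ}

/-- The indicator function of the cylinder set `_1[e]`. -/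
def nextIs {E : Type*} (e : E) : CodeSpace E → ℝ :=
  Set.indicator {σ | σ 1 = letter e} (fun _ => 1)

namespace MarkovSystem

variable {K : Type*} [MetricSpace K] [MeasurableSpace K] [BorelSpace K]
  {N : Set ℕ} {E : Type*} [Countable E]

/-! ### The Markov operator and the invariant measures -/

/-- The Markov operator `U f = ∑_e p_e · f ∘ w_e`. -/
def markovOp (M : MarkovSystem K N E) (f : K → ℝ≥0∞) : K → ℝ≥0∞ :=
  fun y => ∑' e, ENNReal.ofReal (M.p e y) * f (M.w e y)

/-- The adjoint operator `U^*` on measures. -/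
def adj (M : MarkovSystem K N E) (ν : Measure K) : Measure K :=
  Measure.sum fun e => (ν.withDensity fun y => ENNReal.ofReal (M.p e y)).map (M.w e)

/-- The defining property `(U^* ν)(f) = ∫ U f dν` of the adjoint operator. -/
theorem lintegral_adj (M : MarkovSystem K N E) (ν : Measure K) {f : K → ℝ≥0∞}
    (hf : Measurable f) : ∫⁻ y, f y ∂(M.adj ν) = ∫⁻ y, M.markovOp f y ∂ν := by
  have hp : ∀ e, Measurable fun y => ENNReal.ofReal (M.p e y) :=
    fun e => (M.p_measurable e).ennreal_ofReal
  have hfw : ∀ e, Measurable fun y => f (M.w e y) := fun e => hf.comp (M.w_measurable e)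
  simp only [adj, markovOp]
  have hm : ∀ e, AEMeasurable (fun y => ENNReal.ofReal (M.p e y) * f (M.w e y)) ν :=
    fun e => ((hp e).mul (hfw e)).aemeasurable
  rw [lintegral_sum_measure, lintegral_tsum hm]
  congr 1
  ext e
  rw [lintegral_map hf (M.w_measurable e),
    lintegral_withDensity_eq_lintegral_mul _ (hp e) (hfw e)]
  rfl

/-- `P(M)`, the invariant Borel probability measures. -/
def invariantMeasures (M : MarkovSystem K N E) : Set (Measure K) :=
  {μ | IsProbabilityMeasure μ ∧ M.adj μ = μ}

/-! ### Standing conditions -/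

/-- Contraction on average on each vertex set, with some rate `0 < a < 1`. -/
def Contractive (M : MarkovSystem K N E) : Prop :=
  ∃ a : ℝ, 0 < a ∧ a < 1 ∧ ∀ j, ∀ y ∈ M.cell j, ∀ z ∈ M.cell j,
    ∑' e : {e : E // M.i e = j}, ENNReal.ofReal (M.p e y) * edist (M.w e y) (M.w e z)
      ≤ ENNReal.ofReal a * edist y z

/-- All `w_e` and `p_e` are uniformly continuous on `K_{i(e)}`. -/
def UnifContinuous (M : MarkovSystem K N E) : Prop :=
  ∀ e, UniformContinuousOn (M.w e) (M.cell (M.i e)) ∧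
    UniformContinuousOn (M.p e) (M.cell (M.i e))

/-- The constant `b`, for the base points `x_j ∈ K_j`. -/
def bConst (M : MarkovSystem K N E) (x : N → K) : ℝ≥0∞ :=
  ⨆ j : N, ⨆ y ∈ M.cell j, ∑' e : {e : E // M.i e = j},
    ENNReal.ofReal (M.p e y) * edist (M.w e (x j)) (x (M.t e))

/-- `M` has a dominating Markov chain: `∑_{i(e) = j} sup_{K_j} p_e < ∞` for all `j`. -/
def HasDominatingChain (M : MarkovSystem K N E) : Prop :=
  ∀ j : N, (∑' e : {e : E // M.i e = j}, (⨆ y ∈ M.cell j, ENNReal.ofReal (M.p e y))) < ∞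

/-- The measure `α_n^y` on `N` with `α_n^y({j}) = (1/n) ∑_{k=1}^n (U^*)^k δ_y (K_j)`. -/
def alpha (M : MarkovSystem K N E) (y : K) (n : ℕ) : Measure N :=
  Measure.sum fun j : N =>
    ((n : ℝ≥0∞)⁻¹ * ∑ k ∈ Finset.Icc 1 n, (M.adj^[k] (Measure.dirac y)) (M.cell j)) •
      Measure.dirac j

/-- There is a starting point `y ∈ K` for which `(α_n^y)_{n ≥ 1}` is uniformly tight. -/
def TightCondition (M : MarkovSystem K N E) : Prop :=
  ∃ y : K, ∀ ε : ℝ≥0∞, 0 < ε → ∃ V : Finset N, ∀ n : ℕ, 1 ≤ n →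
    M.alpha y n (V : Set N)ᶜ < ε

/-! ### The coding map -/

/-- `i`, `t`, `w` and `p` on the extended alphabet: `i(∞) = t(∞) = 1`, `w_∞ = id`, `p_∞ = 0`. -/
def iExt (M : MarkovSystem K N E) (a : Alphabet E) : N := Option.elim a ⟨1, M.one_mem⟩ M.i

/-- See `iExt`. -/
def tExt (M : MarkovSystem K N E) (a : Alphabet E) : N := Option.elim a ⟨1, M.one_mem⟩ M.t

/-- See `iExt`. -/
def wExt (M : MarkovSystem K N E) (a : Alphabet E) : K → K := Option.elim a id M.w

/-- See `iExt`. -/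
def pExt (M : MarkovSystem K N E) (a : Alphabet E) : K → ℝ := Option.elim a (fun _ => 0) M.p

/-- The path space `Σ_G`. -/
def pathSpace (M : MarkovSystem K N E) : Set (CodeSpace E) :=
  {σ | ∀ n : ℤ, (∃ e : E, σ n = letter e) ∧ M.iExt (σ (n + 1)) = M.tExt (σ n)}

/-- `back σ n = w_{σ_0} ∘ w_{σ_{-1}} ∘ ⋯ ∘ w_{σ_{-n}}`. -/
def back (M : MarkovSystem K N E) (σ : CodeSpace E) : ℕ → K → K
  | 0 => M.wExt (σ 0)
  | n + 1 => fun y => back M σ n (M.wExt (σ (-((n : ℤ) + 1))) y)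

/-- `w_{σ_0} ∘ ⋯ ∘ w_{σ_{-n}} (x_{i(σ_{-n})})`. -/
def approx (M : MarkovSystem K N E) (x : N → K) (σ : CodeSpace E) (n : ℕ) : K :=
  M.back σ n (x (M.iExt (σ (-(n : ℤ)))))

/-- The set `D` of all paths along which the approximations converge. -/
def codingDomain (M : MarkovSystem K N E) (x : N → K) : Set (CodeSpace E) :=
  {σ | σ ∈ M.pathSpace ∧ ∃ y, Tendsto (M.approx x σ) atTop (𝓝 y)}

open Classical in
/-- The coding map `F`: the limit on `D`, and `x_{t(σ_0)}` elsewhere. -/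
def coding (M : MarkovSystem K N E) (x : N → K) (σ : CodeSpace E) : K :=
  if h : σ ∈ M.codingDomain x then h.2.choose else x (M.tExt (σ 0))

/-- The coding map on measures, `F(Λ)(B) = Λ(F⁻¹(B))`. -/
def codingMeasure (M : MarkovSystem K N E) (x : N → K) (Λ : Measure (CodeSpace E)) : Measure K :=
  Λ.map (M.coding x)

/-! ### Equilibrium states, asymptotic states, non-degeneracy -/

/-- `E(M)`, the equilibrium states. -/
def equilibriumStates (M : MarkovSystem K N E) (x : N → K) : Set (Measure (CodeSpace E)) :=
  {Λ | Λ ∈ shiftInvariant E ∧ Λ (M.codingDomain x) = 1 ∧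
    ∀ e : E, condExp (pastSigma E) Λ (nextIs e) =ᵐ[Λ] fun σ => M.p e (M.coding x σ)}

/-- The set `T_j` of all paths `σ` with `t(σ_0) = j`. -/
def endsAt (M : MarkovSystem K N E) (j : N) : Set (CodeSpace E) :=
  {σ | σ ∈ M.pathSpace ∧ M.tExt (σ 0) = j}

open Classical in
/-- The continuous extension of `p_e` from `K_{i(e)}` to its closure, and zero elsewhere. -/
def pBar (M : MarkovSystem K N E) (e : E) (y : K) : ℝ :=
  if y ∈ closure (M.cell (M.i e)) then extendFrom (M.cell (M.i e)) (M.p e) y else 0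

/-- The asymptotic states. -/
def asymptoticStates (M : MarkovSystem K N E) (x : N → K) : Set (Measure (CodeSpace E)) :=
  {Λ | Λ ∈ shiftInvariant E ∧ Λ (M.codingDomain x) = 1 ∧
    ∀ e : E, condExp (pastSigma E) Λ (nextIs e) =ᵐ[Λ]
      (M.endsAt (M.i e)).indicator fun σ => M.pBar e (M.coding x σ)}

/-- Non-degeneracy: every asymptotic state charges some `T_j ∩ F⁻¹(K_j)`. -/
def NonDegenerate (M : MarkovSystem K N E) (x : N → K) : Prop :=
  ∀ Λ ∈ M.asymptoticStates x, ∃ j : N, 0 < Λ (M.endsAt j ∩ M.coding x ⁻¹' M.cell j)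

/-! ### The map `Φ` -/

/-- `P_y^m(_m[e_m, …, e_n]) = p_{e_m}(y) p_{e_{m+1}}(w_{e_m} y) ⋯` for the word
`l = [e_m, …, e_n]`. -/
def pathProb (M : MarkovSystem K N E) : List (Alphabet E) → K → ℝ≥0∞
  | [], _ => 1
  | a :: l, y => ENNReal.ofReal (M.pExt a y) * pathProb M l (M.wExt a y)

/-- `Λ` is a probability measure that extends `φ_m(μ) = ∫ P_y^m dμ(y)` for all `m ≤ 0`.
The `φ_m(μ)` live on the `σ`-algebra generated by the cylinder sets that start at `m`, and these
are a `∩`-stable generator together with the empty set. -/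
def IsLift (M : MarkovSystem K N E) (μ : Measure K) (Λ : Measure (CodeSpace E)) : Prop :=
  IsProbabilityMeasure Λ ∧ ∀ m : ℤ, m ≤ 0 → ∀ l : List (Alphabet E), l ≠ [] →
    Λ (cyl m l) = ∫⁻ y, M.pathProb l y ∂μ

open Classical in
/-- `Φ(μ)`, the measure on the code space that extends all `φ_m(μ)`, `m ≤ 0`. -/
def lift (M : MarkovSystem K N E) (μ : Measure K) : Measure (CodeSpace E) :=
  if h : ∃ Λ, M.IsLift μ Λ then h.choose else 0

end MarkovSystem

end

/-!
Iterating the contraction inequality shows that the expected distance between the images of two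
points of the same cell under a random word of length `n` decays geometrically; as `b` is finite,
the expected distance to the base points stays bounded. For the path measures of such chains the
expected distances between consecutive backward compositions are then summable, so that the limit
defining the coding map `F` exists almost surely.

An invariant `μ` lifts to a unique stationary path measure `Φ(μ)`: the integrated path probabilities
are consistent weights of words. The point that a `Φ(μ)`-random path has reached at present is
determined by its past, namely as the value of `F`, which gives both `F(Φ(μ)) = μ` and the
equilibrium property of `Φ(μ)`. Conversely the equilibrium property determines the probabilities of
all cylinders from `F`, so that `F(Λ)` is invariant with lift `Λ`.

For existence, tightness of the averaged cell distributions and the dominating chain give a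
subsequential limit of the averaged path measures on words. Its stationary extension is an
asymptotic state. By non-degeneracy the paths coded into their own cell have positive measure, and
conditioning on this almost invariant set leaves an equilibrium state.
-/

noncomputable section

open ProbabilityTheory
open scoped NNReal

/-! ### Words -/

section Words

variable {A : Type*}

/-- The sum of `f` over all words of length `n` over the alphabet `A`. -/
def wordSum (n : ℕ) (f : List A → ℝ≥0∞) : ℝ≥0∞ := ∑' l : {l : List A // l.length = n}, f l

lemma wordSum_zero (f : List A → ℝ≥0∞) : wordSum 0 f = f [] := by
  refine tsum_eq_single (⟨[], rfl⟩ : {l : List A // l.length = 0}) fun l hl => ?_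
  exact absurd (Subtype.ext (List.length_eq_zero_iff.1 l.2)) hl

lemma wordSum_succ (n : ℕ) (f : List A → ℝ≥0∞) :
    wordSum (n + 1) f = ∑' a, wordSum n fun l => f (a :: l) := by
  let cons : A × {l : List A // l.length = n} ≃ {l : List A // l.length = n + 1} :=
    { toFun := fun q => ⟨q.1 :: q.2, by simp [q.2.2]⟩
      invFun := fun l =>
        (l.1.head (List.ne_nil_of_length_eq_add_one l.2), ⟨l.1.tail, by simp [l.2]⟩)
      left_inv := fun q => by simp
      right_inv := fun l => by simp }
  simp only [wordSum]
  rw [← cons.tsum_eq, ← ENNReal.tsum_prod (f := fun a (l : {l : List A // l.length = n}) =>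
    f (a :: l))]
  rfl

lemma wordSum_mono {n : ℕ} {f g : List A → ℝ≥0∞} (h : ∀ l : List A, l.length = n → f l ≤ g l) :
    wordSum n f ≤ wordSum n g :=
  ENNReal.tsum_le_tsum fun l => h l l.2

lemma wordSum_congr {n : ℕ} {f g : List A → ℝ≥0∞} (h : ∀ l : List A, l.length = n → f l = g l) :
    wordSum n f = wordSum n g :=
  tsum_congr fun l => h l l.2

lemma wordSum_add (n : ℕ) (f g : List A → ℝ≥0∞) :
    wordSum n (fun l => f l + g l) = wordSum n f + wordSum n g :=
  ENNReal.tsum_add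

lemma wordSum_mul_left (n : ℕ) (c : ℝ≥0∞) (f : List A → ℝ≥0∞) :
    wordSum n (fun l => c * f l) = c * wordSum n f :=
  ENNReal.tsum_mul_left

lemma wordSum_append_le (n : ℕ) (l : List A) (f : List A → ℝ≥0∞) :
    wordSum n (fun u => f (u ++ l)) ≤ wordSum (n + l.length) f := by
  let append (u : {u : List A // u.length = n}) : {u : List A // u.length = n + l.length} :=
    ⟨u ++ l, by rw [List.length_append, u.2]⟩
  exact ENNReal.tsum_comp_le_tsum_of_injective (f := append)
    (fun u v h => Subtype.ext (List.append_cancel_right (congrArg Subtype.val h))) _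

variable [Countable A] {X : Type*} [MeasurableSpace X] {f : List A → X → ℝ≥0∞}

lemma lintegral_wordSum (μ : Measure X) (n : ℕ) (hf : ∀ l, Measurable (f l)) :
    ∫⁻ z, wordSum n (fun l => f l z) ∂μ = wordSum n fun l => ∫⁻ z, f l z ∂μ :=
  lintegral_tsum fun l => (hf l).aemeasurable

lemma measurable_wordSum (n : ℕ) (hf : ∀ l, Measurable (f l)) :
    Measurable fun z => wordSum n fun l => f l z :=
  Measurable.tsum fun l => hf l

end Words

lemma tsum_le_tsum_add_of_tendsto {ι α : Type*} {ω : Filter ι} [ω.NeBot]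
    {f g r : ι → α → ℝ≥0∞} {f' g' : α → ℝ≥0∞} {B : ℝ≥0∞}
    (hf : ∀ a, Tendsto (fun i => f i a) ω (𝓝 (f' a)))
    (hg : ∀ a, Tendsto (fun i => g i a) ω (𝓝 (g' a)))
    (hfg : ∀ i a, f i a ≤ g i a + r i a) (hr : ∀ i, ∑' a, r i a ≤ B) :
    ∑' a, f' a ≤ ∑' a, g' a + B := by
  rw [ENNReal.tsum_eq_iSup_sum]
  refine iSup_le fun s => ?_
  have hs : ∀ i, ∑ a ∈ s, f i a ≤ ∑ a ∈ s, g i a + B := fun i => calc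
    ∑ a ∈ s, f i a ≤ ∑ a ∈ s, (g i a + r i a) := Finset.sum_le_sum fun a _ => hfg i a
    _ = ∑ a ∈ s, g i a + ∑ a ∈ s, r i a := Finset.sum_add_distrib
    _ ≤ ∑ a ∈ s, g i a + B := by gcongr; exact (ENNReal.sum_le_tsum s).trans (hr i)
  calc ∑ a ∈ s, f' a ≤ ∑ a ∈ s, g' a + B :=
        le_of_tendsto_of_tendsto' (tendsto_finsetSum s fun a _ => hf a)
          ((tendsto_finsetSum s fun a _ => hg a).add tendsto_const_nhds) hs
    _ ≤ ∑' a, g' a + B := by gcongr; exact ENNReal.sum_le_tsum s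

/-! ### Measures on one-sided sequences from weights of words -/

section History

variable {A : Type*}

/-- The word `τ_{n-1} ⋯ τ_0`, latest letter first, so that a new letter is a `List.cons`. -/
def history (τ : ℕ → A) : ℕ → List A
  | 0 => []
  | n + 1 => τ n :: history τ n

lemma history_congr {τ τ' : ℕ → A} {n : ℕ} (h : ∀ k < n, τ k = τ' k) :
    history τ n = history τ' n := by
  induction n with
  | zero => rfl
  | succ n ih => rw [history, history, h n n.lt_succ_self, ih fun k hk => h k (by omega)]

/-- The law of the letter that follows the past `l` when words have the weights `r`; it is a point
mass where `r l` is `0` or `∞`. -/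
def nextLetterLaw (r : List A → ℝ≥0∞) (hr : ∀ l, ∑' a, r (a :: l) = r l) (a₀ : A) (l : List A) :
    PMF A :=
  open Classical in
  if h : r l ≠ 0 ∧ r l ≠ ∞ then
    PMF.normalize (fun a => r (a :: l)) ((hr l).trans_ne h.1) ((hr l).trans_ne h.2)
  else PMF.pure a₀

lemma nextLetterLaw_mul {r : List A → ℝ≥0∞} (hr : ∀ l, ∑' a, r (a :: l) = r l) (a₀ a : A)
    {l : List A} (hl : r l ≠ ∞) : nextLetterLaw r hr a₀ l a * r l = r (a :: l) := by
  rcases eq_or_ne (r l) 0 with h0 | h0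
  · have hle : r (a :: l) ≤ r l := (ENNReal.le_tsum a).trans (hr l).le
    rw [h0, mul_zero, eq_comm, ← nonpos_iff_eq_zero, ← h0]
    exact hle
  · rw [nextLetterLaw, dif_pos ⟨h0, hl⟩, PMF.normalize_apply, hr, mul_assoc,
      ENNReal.inv_mul_cancel h0 hl, mul_one]

/-- The word `u_n ⋯ u_1` of a finite sequence `u_0, …, u_n`.  The letter `u_0` is a dummy: it
lets the Ionescu-Tulcea construction start from the empty word. -/
def pastWord (n : ℕ) (u : Finset.Iic n → A) : List A :=
  history (fun k => if h : k + 1 ≤ n then u ⟨k + 1, Finset.mem_Iic.2 h⟩ else u ⟨0, by simp⟩) n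

lemma pastWord_frestrictLe (n : ℕ) (τ : ℕ → A) :
    pastWord n (Preorder.frestrictLe (π := fun _ => A) n τ) = history (fun k => τ (k + 1)) n :=
  history_congr fun k hk => by simp [Nat.succ_le_of_lt hk]

variable [MeasurableSpace A] [DiscreteMeasurableSpace A]

lemma measurableSet_history_eq (l : List A) :
    MeasurableSet {τ : ℕ → A | history τ l.length = l} := by
  induction l with
  | nil => simp [history]
  | cons a l ih =>
    have hset : {τ : ℕ → A | history τ (a :: l).length = a :: l} =
        (fun τ => τ l.length) ⁻¹' {a} ∩ {τ | history τ l.length = l} := by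
      ext τ
      simp [history]
    rw [hset]
    exact (measurable_pi_apply _ (.of_discrete (s := {a}))).inter ih

variable [Countable A]

/-- The Ionescu-Tulcea transition kernels that give words the weights `r`. -/
def wordKernel (r : List A → ℝ≥0∞) (hr : ∀ l, ∑' a, r (a :: l) = r l) (a₀ : A) (n : ℕ) :
    Kernel (Finset.Iic n → A) A where
  toFun u := (nextLetterLaw r hr a₀ (pastWord n u)).toMeasure
  measurable' := Measurable.of_discrete

instance (r : List A → ℝ≥0∞) (hr : ∀ l, ∑' a, r (a :: l) = r l) (a₀ : A) (n : ℕ) :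
    IsMarkovKernel (wordKernel r hr a₀ n) :=
  ⟨fun u => PMF.toMeasure.isProbabilityMeasure (nextLetterLaw r hr a₀ (pastWord n u))⟩

lemma trajMeasure_history {r : List A → ℝ≥0∞} (h0 : r [] = 1) (hr : ∀ l, ∑' a, r (a :: l) = r l)
    (a₀ : A) (l : List A) :
    Kernel.trajMeasure (X := fun _ => A) (Measure.dirac a₀) (wordKernel r hr a₀)
      {τ | history (fun k => τ (k + 1)) l.length = l} = r l := by
  set P := Kernel.trajMeasure (X := fun _ => A) (Measure.dirac a₀) (wordKernel r hr a₀) with hP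
  have : IsProbabilityMeasure P := by rw [hP]; infer_instance
  induction l with
  | nil => simp [history, h0]
  | cons a l ih =>
    have hrl : r l ≠ ∞ := ih ▸ measure_ne_top P _
    have hpast : MeasurableSet (pastWord l.length ⁻¹' {l} : Set (Finset.Iic l.length → A)) :=
      .of_discrete
    have hset : {τ : ℕ → A | history (fun k => τ (k + 1)) (a :: l).length = a :: l} =
        (fun τ => (Preorder.frestrictLe (π := fun _ => A) l.length τ, τ (l.length + 1))) ⁻¹'
          ((pastWord l.length ⁻¹' {l}) ×ˢ {a}) := by
      ext τ
      simp [history, pastWord_frestrictLe, and_comm]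
    have hlaw : ∀ u ∈ (pastWord l.length ⁻¹' {l} : Set (Finset.Iic l.length → A)),
        wordKernel r hr a₀ l.length u {a} = nextLetterLaw r hr a₀ l a := fun u hu => by
      have hul : pastWord l.length u = l := hu
      refine (PMF.toMeasure_apply_singleton _ a (.singleton a)).trans ?_
      rw [hul]
    have hpre : Preorder.frestrictLe l.length ⁻¹' (pastWord l.length ⁻¹' {l}) =
        {τ : ℕ → A | history (fun k => τ (k + 1)) l.length = l} := by
      ext τ
      simp [pastWord_frestrictLe]
    calc P {τ | history (fun k => τ (k + 1)) (a :: l).length = a :: l}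
        = (P.map (Preorder.frestrictLe l.length) ⊗ₘ wordKernel r hr a₀ l.length)
            ((pastWord l.length ⁻¹' {l}) ×ˢ {a}) := by
          rw [hP, Kernel.map_frestrictLe_trajMeasure_compProd_eq_map_trajMeasure,
            Measure.map_apply (by fun_prop) (hpast.prod (.singleton a)), ← hset]
      _ = ∫⁻ _ in pastWord l.length ⁻¹' {l}, nextLetterLaw r hr a₀ l a
            ∂P.map (Preorder.frestrictLe l.length) := by
          rw [Measure.compProd_apply_prod hpast (.singleton a)]
          exact setLIntegral_congr_fun hpast hlaw
      _ = nextLetterLaw r hr a₀ l a * r l := by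
          rw [setLIntegral_const, Measure.map_apply (by fun_prop) hpast, hpre, ih]
      _ = r (a :: l) := nextLetterLaw_mul hr a₀ a hrl

theorem exists_measure_history_eq {r : List A → ℝ≥0∞} (h0 : r [] = 1)
    (hr : ∀ l, ∑' a, r (a :: l) = r l) :
    ∃ P : Measure (ℕ → A), IsProbabilityMeasure P ∧ ∀ l, P {τ | history τ l.length = l} = r l := by
  have : Nonempty A := by
    by_contra hA
    have := not_nonempty_iff.1 hA
    simpa [h0] using hr []
  have hshift : Measurable fun (τ : ℕ → A) k => τ (k + 1) :=
    measurable_pi_lambda _ fun k => measurable_pi_apply (k + 1)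
  refine ⟨(Kernel.trajMeasure (X := fun _ => A) (Measure.dirac (Classical.arbitrary A))
      (wordKernel r hr (Classical.arbitrary A))).map fun τ k => τ (k + 1),
    Measure.isProbabilityMeasure_map hshift.aemeasurable, fun l => ?_⟩
  rw [Measure.map_apply hshift (measurableSet_history_eq l)]
  exact trajMeasure_history h0 hr _ l

end History

/-! ### Windows and cylinder sets -/

section Windows

variable {E : Type*}

/-- The word `σ_m σ_{m+1} ⋯` of length `n`. -/
def window (m : ℤ) : ℕ → CodeSpace E → List (Alphabet E)
  | 0, _ => []
  | n + 1, σ => σ m :: window (m + 1) n σ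

@[simp]
lemma length_window (m : ℤ) (n : ℕ) (σ : CodeSpace E) : (window m n σ).length = n := by
  induction n generalizing m with
  | zero => rfl
  | succ n ih => simp [window, ih]

lemma window_add (m : ℤ) (n k : ℕ) (σ : CodeSpace E) :
    window m (n + k) σ = window m n σ ++ window (m + n) k σ := by
  induction n generalizing m with
  | zero => simp [window]
  | succ n ih =>
    rw [show n + 1 + k = n + k + 1 by ring, window, window, ih, List.cons_append,
      show m + 1 + n = m + (n + 1 : ℕ) by push_cast; ring]

lemma window_succ_right (m : ℤ) (n : ℕ) (σ : CodeSpace E) :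
    window m (n + 1) σ = window m n σ ++ [σ (m + n)] := window_add m n 1 σ

lemma window_shift (m : ℤ) (n : ℕ) (σ : CodeSpace E) :
    window m n (shift σ) = window (m + 1) n σ := by
  induction n generalizing m with
  | zero => rfl
  | succ n ih => simp [window, ih, shift]

lemma mem_cyl_cons {m : ℤ} {a : Alphabet E} {l : List (Alphabet E)} {σ : CodeSpace E} :
    σ ∈ cyl m (a :: l) ↔ σ m = a ∧ σ ∈ cyl (m + 1) l := by
  have hsucc (k : ℕ) : m + (k + 1 : ℕ) = m + 1 + k := by push_cast; ring
  refine ⟨fun h => ⟨by simpa using! h 0 (by simp), fun k hk => ?_⟩, ?_⟩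
  · rw [← hsucc]
    exact h (k + 1) (by simpa using hk)
  · rintro ⟨h0, h⟩ (_ | k) hk
    · simpa using h0
    · rw [hsucc]
      exact h k (by simpa using hk)

lemma mem_cyl_iff {m : ℤ} {l : List (Alphabet E)} {σ : CodeSpace E} :
    σ ∈ cyl m l ↔ window m l.length σ = l := by
  induction l generalizing m with
  | nil => simp [cyl, window]
  | cons a l ih => rw [mem_cyl_cons, ih]; simp [window]

lemma cyl_nil (m : ℤ) : cyl m ([] : List (Alphabet E)) = Set.univ :=
  Set.eq_univ_of_forall fun _ => mem_cyl_iff.2 rfl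

lemma mem_cyl_window (m : ℤ) (n : ℕ) (σ : CodeSpace E) : σ ∈ cyl m (window m n σ) :=
  mem_cyl_iff.2 (by rw [length_window])

lemma mem_cyl_append {m : ℤ} {u v : List (Alphabet E)} {σ : CodeSpace E} :
    σ ∈ cyl m (u ++ v) ↔ σ ∈ cyl m u ∧ σ ∈ cyl (m + u.length) v := by
  simp only [mem_cyl_iff, List.length_append, window_add]
  exact ⟨fun h => List.append_inj h (by simp), fun ⟨hu, hv⟩ => by rw [hu, hv]⟩

lemma mem_cyl_singleton {m : ℤ} {a : Alphabet E} {σ : CodeSpace E} :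
    σ ∈ cyl m [a] ↔ σ m = a := by
  simp [mem_cyl_iff, window]

lemma shift_preimage_cyl (m : ℤ) (l : List (Alphabet E)) :
    shift ⁻¹' cyl m l = cyl (m + 1) l := by
  ext σ
  simp [mem_cyl_iff, window_shift]

lemma cyl_inter_cyl {m m' : ℤ} {l l' : List (Alphabet E)} (h : m ≤ m')
    (h' : m' + l'.length ≤ m + l.length) (hne : (cyl m l ∩ cyl m' l').Nonempty) :
    cyl m l ∩ cyl m' l' = cyl m l := by
  refine Set.inter_eq_left.2 fun σ hσ k hk => ?_
  obtain ⟨τ, hτ, hτ'⟩ := hne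
  obtain ⟨j, hj⟩ := Int.eq_ofNat_of_zero_le (sub_nonneg.2 h)
  have hjk : m' + k = m + ((j + k : ℕ) : ℤ) := by push_cast; omega
  have hlt : j + k < l.length := by omega
  rw [← hτ' k hk, hjk, hσ _ hlt, hτ _ hlt]

lemma isPiSystem_cyl {m : ℕ → ℤ} {k : ℕ → ℕ} (hm : Antitone m)
    (hk : Monotone fun n => m n + k n) :
    IsPiSystem {A : Set (CodeSpace E) | ∃ n l, l.length = k n ∧ A = cyl (m n) l} := by
  rintro A ⟨n, l, hl, rfl⟩ B ⟨n', l', hl', rfl⟩ hne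
  rcases le_total n n' with hn | hn
  · rw [Set.inter_comm] at hne ⊢
    rw [cyl_inter_cyl (hm hn) (by rw [hl, hl']; exact hk hn) hne]
    exact ⟨n', l', hl', rfl⟩
  · rw [cyl_inter_cyl (hm hn) (by rw [hl, hl']; exact hk hn) hne]
    exact ⟨n, l, hl, rfl⟩

lemma measurable_shift : Measurable (shift : CodeSpace E → CodeSpace E) :=
  measurable_pi_lambda _ fun n => measurable_pi_apply (n + 1)

variable [Countable E]

lemma measurable_comp_window {β : Type*} [MeasurableSpace β] {𝓜 : MeasurableSpace (CodeSpace E)}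
    {m : ℤ} {n : ℕ} (h : ∀ l : List (Alphabet E), l.length = n → MeasurableSet[𝓜] (cyl m l))
    (φ : List (Alphabet E) → β) : Measurable[𝓜] fun σ => φ (window m n σ) := by
  intro s _
  have hs : (fun σ : CodeSpace E => φ (window m n σ)) ⁻¹' s =
      ⋃ l : {l : List (Alphabet E) // l.length = n ∧ φ l ∈ s}, cyl m l.1 := by
    ext σ
    simp only [Set.mem_preimage, Set.mem_iUnion, mem_cyl_iff]
    refine ⟨fun hσ => ⟨⟨window m n σ, by simp, hσ⟩, by simp⟩, ?_⟩
    rintro ⟨⟨l, rfl, hl⟩, hσ⟩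
    simpa only [hσ] using hl
  rw [hs]
  exact MeasurableSet.iUnion fun l => h _ l.2.1

lemma measurable_eval_of_windows {𝓜 : MeasurableSpace (CodeSpace E)} {m : ℤ} {n : ℕ}
    (h : ∀ l : List (Alphabet E), l.length = n → MeasurableSet[𝓜] (cyl m l)) {k : ℕ} (hk : k < n) :
    Measurable[𝓜] fun σ : CodeSpace E => σ (m + k) := by
  have hget (σ : CodeSpace E) : ((window m n σ)[k]?).getD (none : Option E) = σ (m + k) := by
    rw [mem_cyl_window m n σ k (by simpa using hk), List.getElem?_eq_getElem (by simpa using hk)]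
    rfl
  simpa only [hget] using!
    measurable_comp_window (𝓜 := 𝓜) h fun l => (l[k]?).getD (none : Option E)

lemma lintegral_window (Λ : Measure (CodeSpace E)) (m : ℤ) (n : ℕ)
    (φ : List (Alphabet E) → ℝ≥0∞) :
    ∫⁻ σ, φ (window m n σ) ∂Λ = wordSum n fun l => φ l * Λ (cyl m l) := by
  have h (σ : CodeSpace E) : φ (window m n σ) =
      wordSum n fun l => (cyl m l).indicator (fun _ => φ l) σ := by
    rw [wordSum, tsum_eq_single ⟨window m n σ, by simp⟩]
    · exact (Set.indicator_of_mem (mem_cyl_window m n σ) fun _ => φ (window m n σ)).symm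
    · rintro ⟨l, rfl⟩ hl
      refine Set.indicator_of_notMem (fun hσ => hl ?_) _
      exact Subtype.ext (mem_cyl_iff.1 hσ).symm
  simp_rw [h]
  rw [lintegral_wordSum _ _ fun l => measurable_const.indicator (measurableSet_cyl m l)]
  exact wordSum_congr fun l _ => lintegral_indicator_const (measurableSet_cyl m l) (φ l)

lemma setLIntegral_window_cyl (Λ : Measure (CodeSpace E)) (m : ℤ) (n : ℕ) (u : List (Alphabet E))
    (φ : List (Alphabet E) → ℝ≥0∞) :
    ∫⁻ σ in cyl (m + n) u, φ (window m n σ) ∂Λ =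
      wordSum n fun l => φ l * Λ (cyl m (l ++ u)) := by
  rw [lintegral_window]
  refine wordSum_congr fun l hl => ?_
  rw [Measure.restrict_apply (measurableSet_cyl m l), ← hl]
  exact congrArg (φ l * Λ ·) (Set.ext fun σ => mem_cyl_append.symm)

lemma tsum_measure_inter_cyl_singleton (Λ : Measure (CodeSpace E)) (k : ℤ)
    {s : Set (CodeSpace E)} (hs : MeasurableSet s) :
    ∑' a, Λ (s ∩ cyl k [a]) = Λ s := by
  rw [← measure_iUnion _ fun a => hs.inter (measurableSet_cyl k _)]
  · congr 1
    ext σ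
    simp [mem_cyl_singleton]
  · refine fun a b hab => Set.disjoint_left.2 fun σ ha hb => hab ?_
    rw [← mem_cyl_singleton.1 ha.2, ← mem_cyl_singleton.1 hb.2]

lemma tsum_measure_cyl_append (Λ : Measure (CodeSpace E)) (m : ℤ) (l : List (Alphabet E)) :
    ∑' a, Λ (cyl m (l ++ [a])) = Λ (cyl m l) := by
  rw [← tsum_measure_inter_cyl_singleton Λ (m + l.length) (measurableSet_cyl m l)]
  exact tsum_congr fun a => congrArg Λ (Set.ext fun σ => mem_cyl_append)

lemma tsum_measure_cyl_cons (Λ : Measure (CodeSpace E)) (m : ℤ) (l : List (Alphabet E)) :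
    ∑' a, Λ (cyl m (a :: l)) = Λ (cyl (m + 1) l) := by
  rw [← tsum_measure_inter_cyl_singleton Λ m (measurableSet_cyl (m + 1) l)]
  refine tsum_congr fun a => congrArg Λ (Set.ext fun σ => ?_)
  rw [Set.mem_inter_iff, mem_cyl_singleton, mem_cyl_cons, and_comm]

lemma measure_univ_eq_tsum_cyl (Λ : Measure (CodeSpace E)) (m : ℤ) :
    Λ Set.univ = ∑' a, Λ (cyl m [a]) := by
  simpa using (tsum_measure_inter_cyl_singleton Λ m MeasurableSet.univ).symm

lemma codeSpace_measurableSpace_eq_generateFrom :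
    (inferInstance : MeasurableSpace (CodeSpace E)) = MeasurableSpace.generateFrom
      {A | ∃ (n : ℕ) (l : List (Alphabet E)), l.length = 2 * n + 1 ∧ A = cyl (-(n : ℤ)) l} := by
  refine le_antisymm (iSup_le fun j => measurable_iff_comap_le.1 ?_)
    (MeasurableSpace.generateFrom_le ?_)
  · have hj : j = -(j.natAbs : ℤ) + ((j + j.natAbs).toNat : ℕ) := by omega
    rw [hj]
    refine measurable_eval_of_windows (n := 2 * j.natAbs + 1) (fun l hl => ?_) (by omega)
    exact MeasurableSpace.measurableSet_generateFrom ⟨_, l, hl, rfl⟩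
  · rintro A ⟨n, l, -, rfl⟩
    exact measurableSet_cyl _ _

lemma measure_ext_of_cyl {Λ Λ' : Measure (CodeSpace E)} [IsFiniteMeasure Λ]
    (h : ∀ m : ℤ, m ≤ 0 → ∀ l : List (Alphabet E), l ≠ [] → Λ (cyl m l) = Λ' (cyl m l)) :
    Λ = Λ' := by
  refine ext_of_generate_finite _ codeSpace_measurableSpace_eq_generateFrom
    (isPiSystem_cyl (m := fun n => -(n : ℤ)) (k := fun n => 2 * n + 1)
      (fun _ _ h => by simpa using h) fun _ _ h => by push_cast; omega) ?_ ?_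
  · rintro A ⟨n, l, hl, rfl⟩
    exact h _ (by simp) _ (List.ne_nil_of_length_eq_add_one hl)
  · simp_rw [measure_univ_eq_tsum_cyl _ 0, h 0 le_rfl _ (List.cons_ne_nil _ _)]

end Windows

/-! ### Stationary measures on two-sided sequences from weights of words -/

section TwoSided

variable {E : Type*}

/-- The two-sided sequence `⋯ b_1 b_0 a_0 a_1 ⋯`, with `a_0` at time `0`, of the one-sided
sequence of pairs `(a_k, b_k)`. -/
def unfoldPairs (τ : ℕ → Alphabet E × Alphabet E) : CodeSpace E
  | Int.ofNat k => (τ k).1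
  | Int.negSucc k => (τ k).2

/-- The word `b_n ⋯ b_0 a_0 ⋯ a_n` of the word of pairs `(a_n, b_n) ⋯ (a_0, b_0)`. -/
def pairsWord : List (Alphabet E × Alphabet E) → List (Alphabet E)
  | [] => []
  | q :: l => q.2 :: (pairsWord l ++ [q.1])

lemma measurable_unfoldPairs : Measurable (unfoldPairs (E := E)) := by
  refine measurable_pi_lambda _ fun j => ?_
  rcases j with k | k
  · exact measurable_fst.comp (measurable_pi_apply k)
  · exact measurable_snd.comp (measurable_pi_apply k)

@[simp]
lemma length_pairsWord (l : List (Alphabet E × Alphabet E)) :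
    (pairsWord l).length = 2 * l.length := by
  induction l with
  | nil => rfl
  | cons q l ih => simp [pairsWord, ih]; ring

lemma pairsWord_injective : Function.Injective (pairsWord (E := E)) := by
  intro l
  induction l with
  | nil => rintro (_ | ⟨q, l'⟩) h <;> simp_all [pairsWord]
  | cons q l ih =>
    rintro (_ | ⟨q', l'⟩) h
    · simp [pairsWord] at h
    · obtain ⟨h2, h'⟩ := List.cons.inj h
      obtain ⟨hl, h1⟩ := List.append_inj' h' rfl
      rw [ih hl, Prod.ext (List.singleton_inj.1 h1) h2]

lemma exists_pairsWord_eq {n : ℕ} {l : List (Alphabet E)} (hl : l.length = 2 * n) :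
    ∃ l', l'.length = n ∧ pairsWord l' = l := by
  induction n generalizing l with
  | zero => exact ⟨[], rfl, (List.length_eq_zero_iff.1 hl).symm⟩
  | succ n ih =>
    obtain ⟨b, u, rfl⟩ := List.exists_cons_of_length_eq_add_one hl
    rcases List.eq_nil_or_concat u with rfl | ⟨u, a, rfl⟩
    · simp at hl; omega
    · obtain ⟨l', rfl, rfl⟩ := ih (l := u) (by simp at hl; omega)
      exact ⟨(a, b) :: l', rfl, by simp [pairsWord]⟩

lemma pairsWord_history (τ : ℕ → Alphabet E × Alphabet E) (n : ℕ) :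
    pairsWord (history τ n) = window (-(n : ℤ)) (2 * n) (unfoldPairs τ) := by
  induction n with
  | zero => rfl
  | succ n ih =>
    have hleft : -((n + 1 : ℕ) : ℤ) = Int.negSucc n := rfl
    have hmid : Int.negSucc n + 1 = -(n : ℤ) := by omega
    have hright : -(n : ℤ) + (2 * n : ℕ) = Int.ofNat n := by push_cast; simp; ring
    rw [history, pairsWord, ih, show 2 * (n + 1) = 2 * n + 1 + 1 by ring, window,
      window_succ_right, hleft, hmid, hright]
    rfl

lemma unfoldPairs_preimage_cyl (l : List (Alphabet E × Alphabet E)) :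
    unfoldPairs ⁻¹' cyl (-(l.length : ℤ)) (pairsWord l) = {τ | history τ l.length = l} := by
  ext τ
  rw [Set.mem_preimage, mem_cyl_iff, length_pairsWord, ← pairsWord_history,
    pairsWord_injective.eq_iff, Set.mem_ofPred_eq]

variable [Countable E] {q : List (Alphabet E) → ℝ≥0∞} {Λ : Measure (CodeSpace E)}

lemma measure_cyl_eq_of_length_add (hr : ∀ l, ∑' a, q (l ++ [a]) = q l) {m : ℤ} {n k : ℕ}
    (h : ∀ l, l.length = n + k → Λ (cyl m l) = q l) {l : List (Alphabet E)}
    (hl : l.length = n) : Λ (cyl m l) = q l := by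
  induction k generalizing l n with
  | zero => exact h l hl
  | succ k ih =>
    rw [← tsum_measure_cyl_append, ← hr]
    exact tsum_congr fun a => ih (n := n + 1) (fun l' hl' => h l' (by omega)) (by simp [hl])

lemma measure_cyl_eq_of_add_length (hl : ∀ l, ∑' a, q (a :: l) = q l) {m : ℤ} {n k : ℕ}
    (h : ∀ l, l.length = k + n → Λ (cyl m l) = q l) {l : List (Alphabet E)}
    (hn : l.length = n) : Λ (cyl (m + k) l) = q l := by
  induction k generalizing l n with
  | zero => simpa using h l (by omega)
  | succ k ih =>
    rw [Nat.cast_succ, ← add_assoc, ← tsum_measure_cyl_cons, ← hl]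
    exact tsum_congr fun a => ih (n := n + 1) (fun l' hl' => h l' (by omega)) (by simp [hn])

theorem exists_measure_cyl_eq (h0 : q [] = 1) (hr : ∀ l, ∑' a, q (l ++ [a]) = q l)
    (hl : ∀ l, ∑' a, q (a :: l) = q l) :
    ∃ Λ : Measure (CodeSpace E), IsProbabilityMeasure Λ ∧ ∀ m l, Λ (cyl m l) = q l := by
  have : DiscreteMeasurableSpace (Alphabet E × Alphabet E) := inferInstance
  have hpairs (l) : ∑' c, q (pairsWord (c :: l)) = q (pairsWord l) := by
    simp_rw [pairsWord]
    rw [ENNReal.tsum_prod (f := fun a b => q (b :: (pairsWord l ++ [a])))]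
    simp_rw [hl, hr]
  obtain ⟨P, hP, hPq⟩ := exists_measure_history_eq (r := fun l => q (pairsWord l)) h0 hpairs
  refine ⟨P.map unfoldPairs, Measure.isProbabilityMeasure_map measurable_unfoldPairs.aemeasurable,
    fun m l => ?_⟩
  have hcentred (n : ℕ) (l : List (Alphabet E)) (hln : l.length = 2 * n) :
      P.map unfoldPairs (cyl (-(n : ℤ)) l) = q l := by
    obtain ⟨l', rfl, rfl⟩ := exists_pairsWord_eq hln
    rw [Measure.map_apply measurable_unfoldPairs (measurableSet_cyl _ _),
      unfoldPairs_preimage_cyl, hPq]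
  obtain ⟨n, k, j, hm, hnkj⟩ : ∃ n k j : ℕ, m = -(n : ℤ) + k ∧ k + l.length + j = 2 * n := by
    let n := m.natAbs + l.length
    exact ⟨n, (m + n).toNat, (n - m - l.length).toNat, by omega, by omega⟩
  rw [hm]
  exact measure_cyl_eq_of_add_length hl (fun l' hl' => measure_cyl_eq_of_length_add hr
    (fun l'' hl'' => hcentred n l'' (by rw [hl'', hnkj])) hl') rfl

end TwoSided

/-! ### The past and the shift -/

section Past

variable {E : Type*}

lemma measurableSet_past_cyl_neg (n : ℕ) {l : List (Alphabet E)} (hl : l.length = n + 1) :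
    MeasurableSet[pastSigma E] (cyl (-(n : ℤ)) l) :=
  (le_iSup (fun n => pastSigmaFrom E n) n) _
    (MeasurableSpace.measurableSet_generateFrom ⟨l, hl, rfl⟩)

lemma pastSigma_eq_generateFrom : pastSigma E = MeasurableSpace.generateFrom
    {A | ∃ (n : ℕ) (l : List (Alphabet E)), l.length = n + 1 ∧ A = cyl (-(n : ℤ)) l} := by
  refine le_antisymm (iSup_le fun n => MeasurableSpace.generateFrom_mono ?_)
    (MeasurableSpace.generateFrom_le ?_)
  · rintro A ⟨l, hl, rfl⟩
    exact ⟨n, l, hl, rfl⟩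
  · rintro A ⟨n, l, hl, rfl⟩
    exact measurableSet_past_cyl_neg n hl

/-- The inverse of the left shift. -/
def unshift (σ : CodeSpace E) : CodeSpace E := fun n => σ (n - 1)

@[simp]
lemma unshift_shift (σ : CodeSpace E) : unshift (shift σ) = σ := by
  funext n; simp [unshift, shift]

@[simp]
lemma shift_unshift (σ : CodeSpace E) : shift (unshift σ) = σ := by
  funext n; simp [unshift, shift]

lemma unshift_preimage_cyl (m : ℤ) (l : List (Alphabet E)) :
    unshift ⁻¹' cyl m l = cyl (m - 1) l := by
  rw [← sub_add_cancel m 1, ← shift_preimage_cyl, add_sub_cancel_right, ← Set.preimage_comp]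
  exact Set.ext fun σ => by simp

lemma nextIs_eq (e : E) : nextIs e = (cyl 1 [letter e]).indicator fun _ => (1 : ℝ) := by
  rw [nextIs]
  congr 1
  ext σ
  simp [mem_cyl_singleton]

lemma integrable_nextIs (e : E) (Λ : Measure (CodeSpace E)) [IsFiniteMeasure Λ] :
    Integrable (nextIs e) Λ := by
  rw [nextIs_eq]
  exact (integrable_const 1).indicator (measurableSet_cyl _ _)

lemma setIntegral_nextIs (e : E) (Λ : Measure (CodeSpace E)) (A : Set (CodeSpace E)) :
    ∫ σ in A, nextIs e σ ∂Λ = Λ.real (A ∩ cyl 1 [letter e]) := by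
  rw [nextIs_eq, setIntegral_indicator (measurableSet_cyl _ _), setIntegral_const, smul_eq_mul,
    mul_one]

variable {Λ : Measure (CodeSpace E)} [IsFiniteMeasure Λ] {e : E} {g : CodeSpace E → ℝ}

lemma condExp_nextIs_ae_eq (hg0 : 0 ≤ᵐ[Λ] g)
    (hgm : AEStronglyMeasurable[pastSigma E] g Λ)
    (h : ∀ A, MeasurableSet[pastSigma E] A →
      Λ (A ∩ cyl 1 [letter e]) = ∫⁻ σ in A, ENNReal.ofReal (g σ) ∂Λ) :
    condExp (pastSigma E) Λ (nextIs e) =ᵐ[Λ] g := by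
  have hgi : Integrable g Λ := by
    refine ⟨hgm.mono (pastSigma_le E), (hasFiniteIntegral_iff_ofReal hg0).2 ?_⟩
    rw [← setLIntegral_univ, ← h _ .univ]
    exact measure_lt_top _ _
  refine (ae_eq_condExp_of_forall_setIntegral_eq (pastSigma_le E) (integrable_nextIs e Λ)
    (fun _ _ _ => hgi.integrableOn) (fun A hA _ => ?_) hgm).symm
  rw [setIntegral_nextIs, measureReal_def, h A hA,
    integral_eq_lintegral_of_nonneg_ae (ae_restrict_of_ae hg0) hgi.aestronglyMeasurable.restrict]

lemma measure_inter_cyl_of_condExp (h : condExp (pastSigma E) Λ (nextIs e) =ᵐ[Λ] g)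
    {A : Set (CodeSpace E)} (hA : MeasurableSet[pastSigma E] A) :
    Λ (A ∩ cyl 1 [letter e]) = ∫⁻ σ in A, ENNReal.ofReal (g σ) ∂Λ := by
  have hgi : Integrable g Λ := integrable_condExp.congr h
  have hg0 : 0 ≤ᵐ[Λ] g :=
    (condExp_nonneg (Eventually.of_forall (Set.indicator_nonneg fun _ _ => zero_le_one))).trans_eq h
  have hint : ∫ σ in A, g σ ∂Λ = Λ.real (A ∩ cyl 1 [letter e]) := by
    rw [← setIntegral_nextIs, ← setIntegral_condExp (pastSigma_le E) (integrable_nextIs e Λ) hA]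
    exact integral_congr_ae (ae_restrict_of_ae h.symm)
  rw [← ofReal_integral_eq_lintegral_ofReal hgi.integrableOn (ae_restrict_of_ae hg0), hint,
    ofReal_measureReal]

variable [Countable E]

lemma measurable_past_eval {k : ℤ} (hk : k ≤ 0) :
    Measurable[pastSigma E] fun σ : CodeSpace E => σ k := by
  have h1 : k = -(k.natAbs : ℤ) + ((0 : ℕ) : ℤ) := by omega
  rw [h1]
  exact measurable_eval_of_windows (n := k.natAbs + 1)
    (fun l hl => measurableSet_past_cyl_neg _ hl) (by omega)

lemma measurableSet_past_cyl {m : ℤ} {l : List (Alphabet E)} (h : m + l.length ≤ 1) :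
    MeasurableSet[pastSigma E] (cyl m l) := by
  induction l generalizing m with
  | nil =>
    rw [cyl_nil]
    exact @MeasurableSet.univ _ (pastSigma E)
  | cons a l ih =>
    have hcons : cyl m (a :: l) = (fun σ => σ m) ⁻¹' {a} ∩ cyl (m + 1) l :=
      Set.ext fun σ => mem_cyl_cons
    rw [List.length_cons] at h
    rw [hcons]
    exact (measurable_past_eval (by omega) MeasurableSet.of_discrete).inter (ih (by omega))

lemma measurable_past_unshift : Measurable[pastSigma E, pastSigma E] (unshift (E := E)) := by
  rw [pastSigma_eq_generateFrom]
  refine @measurable_generateFrom _ _ (_) _ _ ?_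
  rintro _ ⟨n, l, hl, rfl⟩
  rw [unshift_preimage_cyl, ← pastSigma_eq_generateFrom]
  exact measurableSet_past_cyl (by omega)

lemma measure_eq_of_past_cyl {ν ν' : Measure (CodeSpace E)} [IsFiniteMeasure ν]
    (h : ∀ (n : ℕ) (l : List (Alphabet E)), l.length = n + 1 →
      ν (cyl (-(n : ℤ)) l) = ν' (cyl (-(n : ℤ)) l))
    {A : Set (CodeSpace E)} (hA : MeasurableSet[pastSigma E] A) : ν A = ν' A := by
  have htrim : ν.trim (pastSigma_le E) = ν'.trim (pastSigma_le E) := by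
    refine @ext_of_generate_finite _ (pastSigma E) _ _ _ pastSigma_eq_generateFrom
      (isPiSystem_cyl (m := fun n => -(n : ℤ)) (k := fun n => n + 1)
        (fun _ _ h => by simpa using h) fun _ _ _ => by simp)
      (isFiniteMeasure_trim _) ?_ ?_
    · rintro B ⟨n, l, hl, rfl⟩
      rw [trim_measurableSet_eq _ (measurableSet_past_cyl_neg n hl),
        trim_measurableSet_eq _ (measurableSet_past_cyl_neg n hl), h n l hl]
    · rw [trim_measurableSet_eq _ (@MeasurableSet.univ _ (pastSigma E)),
        trim_measurableSet_eq _ (@MeasurableSet.univ _ (pastSigma E)),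
        measure_univ_eq_tsum_cyl ν 0, measure_univ_eq_tsum_cyl ν' 0]
      exact tsum_congr fun a => by simpa using h 0 [a] rfl
  rw [← trim_measurableSet_eq (pastSigma_le E) hA, htrim, trim_measurableSet_eq _ hA]

end Past

section Shift

variable {E : Type*} {Λ : Measure (CodeSpace E)}

lemma measurePreserving_shift (h : Λ ∈ shiftInvariant E) :
    MeasurePreserving (shift : CodeSpace E → CodeSpace E) Λ Λ :=
  ⟨measurable_shift, h.2⟩

lemma measure_cyl_eq_of_shiftInvariant (h : Λ ∈ shiftInvariant E) (m n : ℤ)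
    (l : List (Alphabet E)) : Λ (cyl m l) = Λ (cyl n l) := by
  have hsucc (k : ℤ) : Λ (cyl (k + 1) l) = Λ (cyl k l) := by
    rw [← shift_preimage_cyl, (measurePreserving_shift h).measure_preimage
      (measurableSet_cyl _ _).nullMeasurableSet]
  have hzero (k : ℤ) : Λ (cyl k l) = Λ (cyl 0 l) := by
    induction k using Int.induction_on with
    | zero => rfl
    | succ k ih => rw [hsucc, ih]
    | pred k ih => rw [← ih, ← hsucc, sub_add_cancel]
  rw [hzero, hzero n]

end Shift

lemma tsum_alphabet {E : Type*} {f : Alphabet E → ℝ≥0∞} (h : f (none : Option E) = 0) :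
    ∑' a, f a = ∑' e : E, f (letter e) := by
  refine tsum_eq_tsum_of_ne_zero_bij (fun e => letter e.1) ?_ ?_ fun _ => rfl
  · exact fun e e' h => Subtype.ext (Option.some_injective _ h)
  · rintro (_ | e) ha
    · exact absurd h ha
    · exact ⟨⟨e, ha⟩, rfl⟩

lemma one_add_mul_inv_one_sub (ρ : ℝ≥0∞) : 1 + ρ * (1 - ρ)⁻¹ = (1 - ρ)⁻¹ := by
  rw [← ENNReal.tsum_geometric, ← ENNReal.tsum_mul_left]
  conv_rhs => rw [tsum_eq_zero_add' ENNReal.summable]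
  simp [pow_succ, mul_comm]

namespace MarkovSystem

variable {K : Type*} [MetricSpace K] [MeasurableSpace K] [BorelSpace K]
  {N : Set ℕ} {E : Type*} [Countable E] (M : MarkovSystem K N E)

/-! ### Letters -/

/-- The probability `p_a(z)` of the letter `a` of the extended alphabet at `z`, in `ℝ≥0∞`. -/
def prob (a : Alphabet E) (z : K) : ℝ≥0∞ := ENNReal.ofReal (M.pExt a z)

@[simp]
lemma prob_letter (e : E) (z : K) : M.prob (letter e) z = ENNReal.ofReal (M.p e z) := rfl

@[simp]
lemma prob_none (z : K) : M.prob (none : Option E) z = 0 := ENNReal.ofReal_zero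

lemma measurable_prob (a : Alphabet E) : Measurable (M.prob a) := by
  rcases a with _ | e
  · exact measurable_const.ennreal_ofReal
  · exact (M.p_measurable e).ennreal_ofReal

lemma measurable_wExt (a : Alphabet E) : Measurable (M.wExt a) := by
  rcases a with _ | e
  · exact measurable_id
  · exact M.w_measurable e

lemma mem_cell_of_prob_ne_zero {a : Alphabet E} {z : K} (h : M.prob a z ≠ 0) :
    z ∈ M.cell (M.iExt a) := by
  rcases a with _ | e
  · exact absurd (M.prob_none z) h
  · by_contra hz
    exact h ((congrArg ENNReal.ofReal (M.p_eq_zero e z hz)).trans ENNReal.ofReal_zero)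

lemma wExt_mem {a : Alphabet E} {z : K} (h : z ∈ M.cell (M.iExt a)) :
    M.wExt a z ∈ M.cell (M.tExt a) := by
  rcases a with _ | e
  · exact h
  · exact M.w_mapsTo e h

lemma cell_unique {j k : N} {z : K} (hj : z ∈ M.cell j) (hk : z ∈ M.cell k) : j = k := by
  by_contra h
  exact Set.disjoint_left.1 (M.cell_disjoint h) hj hk

lemma exists_mem_cell (z : K) : ∃ j, z ∈ M.cell j :=
  Set.mem_iUnion.1 (M.cell_cover.symm ▸ Set.mem_univ z)

/-- The vertex `j` with `z ∈ K_j`. -/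
def vertex (z : K) : N := (M.exists_mem_cell z).choose

lemma mem_cell_vertex (z : K) : z ∈ M.cell (M.vertex z) := (M.exists_mem_cell z).choose_spec

lemma vertex_eq {j : N} {z : K} (h : z ∈ M.cell j) : M.vertex z = j :=
  M.cell_unique (M.mem_cell_vertex z) h

lemma measurable_vertex : Measurable M.vertex := by
  refine measurable_to_countable' fun j => ?_
  convert M.cell_measurable j using 1
  ext z
  exact ⟨fun h => h ▸ M.mem_cell_vertex z, fun h => M.vertex_eq h⟩

lemma tsum_prob_mul_eq {j : N} {z : K} (hz : z ∈ M.cell j) (g : Alphabet E → ℝ≥0∞) :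
    ∑' a, M.prob a z * g a =
      ∑' e : {e : E // M.i e = j}, ENNReal.ofReal (M.p e z) * g (letter e.1) := by
  rw [tsum_alphabet (by simp)]
  refine (tsum_subtype_eq_of_support_subset
    (f := fun e : E => ENNReal.ofReal (M.p e z) * g (letter e)) (s := {e | M.i e = j})
    fun e he => ?_).symm
  have hprob : M.prob (letter e) z ≠ 0 := fun h => he (by simp only [← prob_letter, h, zero_mul])
  exact M.cell_unique (M.mem_cell_of_prob_ne_zero hprob) hz

lemma tsum_prob (z : K) : ∑' a, M.prob a z = 1 := by
  have hsum := M.p_sum _ z (M.mem_cell_vertex z)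
  calc ∑' a, M.prob a z = ∑' e : {e : E // M.i e = M.vertex z}, ENNReal.ofReal (M.p e z) := by
        simpa using M.tsum_prob_mul_eq (M.mem_cell_vertex z) fun _ => 1
    _ = 1 := by
        rw [← ENNReal.ofReal_tsum_of_nonneg (fun e => (M.p_mem _ _).1) hsum.summable,
          hsum.tsum_eq, ENNReal.ofReal_one]

lemma prob_le_one (a : Alphabet E) (z : K) : M.prob a z ≤ 1 :=
  (ENNReal.le_tsum a).trans (M.tsum_prob z).le

/-! ### The Markov operator -/

lemma markovOp_eq (f : K → ℝ≥0∞) (z : K) :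
    M.markovOp f z = ∑' a, M.prob a z * f (M.wExt a z) := by
  rw [tsum_alphabet (by simp)]
  rfl

lemma measurable_markovOp {f : K → ℝ≥0∞} (hf : Measurable f) : Measurable (M.markovOp f) :=
  Measurable.tsum fun e => (M.p_measurable e).ennreal_ofReal.mul (hf.comp (M.w_measurable e))

lemma markovOp_mono {f g : K → ℝ≥0∞} (h : ∀ z, f z ≤ g z) (z : K) :
    M.markovOp f z ≤ M.markovOp g z :=
  ENNReal.tsum_le_tsum fun _ => mul_le_mul_right (h _) _

lemma markovOp_const (c : ℝ≥0∞) (z : K) : M.markovOp (fun _ => c) z = c := by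
  rw [markovOp_eq, ENNReal.tsum_mul_right, tsum_prob, one_mul]

lemma markovOp_mul_add (c d : ℝ≥0∞) (f : K → ℝ≥0∞) (z : K) :
    M.markovOp (fun y => c * f y + d) z = c * M.markovOp f z + d := by
  simp only [markovOp_eq, mul_add, ENNReal.tsum_add, ENNReal.tsum_mul_right, tsum_prob, one_mul]
  rw [← ENNReal.tsum_mul_left]
  simp only [mul_left_comm]

lemma lintegral_markovOp {μ : Measure K} (hμ : M.adj μ = μ) {f : K → ℝ≥0∞}
    (hf : Measurable f) : ∫⁻ z, M.markovOp f z ∂μ = ∫⁻ z, f z ∂μ := by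
  rw [← lintegral_adj M μ hf, hμ]

lemma isProbabilityMeasure_adj (ν : Measure K) [IsProbabilityMeasure ν] :
    IsProbabilityMeasure (M.adj ν) :=
  ⟨by simpa [markovOp_const] using M.lintegral_adj ν (f := fun _ => 1) measurable_const⟩

lemma isProbabilityMeasure_adj_iterate (ν : Measure K) [IsProbabilityMeasure ν] (k : ℕ) :
    IsProbabilityMeasure (M.adj^[k] ν) := by
  induction k with
  | zero => rwa [Function.iterate_zero_apply]
  | succ k ih => rw [Function.iterate_succ_apply']; exact M.isProbabilityMeasure_adj _

/-! ### Functions with a drift -/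

section Drift

variable {M} {V : K → ℝ≥0∞} {ρ b : ℝ≥0∞} (hV : Measurable V)
  (hdrift : ∀ z, M.markovOp V z ≤ ρ * V z + b)
include hV hdrift

lemma lintegral_min_le_of_drift {μ : Measure K} (hμ : M.adj μ = μ) (R : ℝ≥0∞) (n : ℕ) :
    ∫⁻ z, min (V z) R ∂μ ≤
      ∫⁻ z, min (ρ ^ n * V z + (∑ k ∈ Finset.range n, ρ ^ k) * b) R ∂μ := by
  induction n with
  | zero => simp
  | succ n ih =>
    refine ih.trans ?_
    rw [← M.lintegral_markovOp hμ (((hV.const_mul _).add_const _).min measurable_const)]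
    refine lintegral_mono fun z => le_min ?_ ?_
    · calc _ ≤ M.markovOp (fun z => ρ ^ n * V z + (∑ k ∈ Finset.range n, ρ ^ k) * b) z :=
            M.markovOp_mono (fun z => min_le_left _ _) z
        _ = ρ ^ n * M.markovOp V z + (∑ k ∈ Finset.range n, ρ ^ k) * b :=
            M.markovOp_mul_add _ _ V z
        _ ≤ ρ ^ n * (ρ * V z + b) + (∑ k ∈ Finset.range n, ρ ^ k) * b := by
            gcongr
            exact hdrift z
        _ = _ := by
            rw [Finset.sum_range_succ]
            ring
    · exact (M.markovOp_mono (fun z => min_le_right _ _) z).trans (M.markovOp_const _ z).le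

-- The integral of `V` is not known to be finite, so the drift is iterated on truncations of `V`.
lemma lintegral_le_of_drift {μ : Measure K} [IsProbabilityMeasure μ] (hμ : M.adj μ = μ)
    (hρ : ρ < 1) (hV' : ∀ z, V z ≠ ∞) : ∫⁻ z, V z ∂μ ≤ (1 - ρ)⁻¹ * b := by
  have htrunc (R : ℕ) : ∫⁻ z, min (V z) R ∂μ ≤ (1 - ρ)⁻¹ * b := by
    have hbound (n : ℕ) :
        ∫⁻ z, min (V z) R ∂μ ≤ ∫⁻ z, min (ρ ^ n * V z + (1 - ρ)⁻¹ * b) R ∂μ := by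
      refine (lintegral_min_le_of_drift hV hdrift hμ R n).trans ?_
      gcongr
      rw [← ENNReal.tsum_geometric]
      exact ENNReal.sum_le_tsum _
    have hlim : Tendsto (fun n : ℕ => ∫⁻ z, min (ρ ^ n * V z + (1 - ρ)⁻¹ * b) R ∂μ) atTop
        (𝓝 (∫⁻ _, min (0 * ∞ + (1 - ρ)⁻¹ * b) R ∂μ)) := by
      refine tendsto_lintegral_of_dominated_convergence (fun _ => (R : ℝ≥0∞))
        (fun n => ((hV.const_mul _).add_const _).min measurable_const)
        (fun n => Eventually.of_forall fun z => min_le_right _ _) (by simp)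
        (Eventually.of_forall fun z => (Tendsto.add ?_ tendsto_const_nhds).min tendsto_const_nhds)
      simpa using ENNReal.Tendsto.mul_const (ENNReal.tendsto_pow_atTop_nhds_zero_of_lt_one hρ)
        (Or.inr (hV' z))
    exact (ge_of_tendsto hlim (Eventually.of_forall hbound)).trans (by simp)
  have hsup (z : K) : V z = ⨆ R : ℕ, min (V z) R := by
    obtain ⟨R, hR⟩ := ENNReal.exists_nat_gt (hV' z)
    exact le_antisymm (le_iSup_of_le R (le_min le_rfl hR.le)) (iSup_le fun R => min_le_left _ _)
  rw [lintegral_congr hsup, lintegral_iSup (fun R => hV.min measurable_const)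
    fun R R' hR z => min_le_min le_rfl (by exact_mod_cast hR)]
  exact iSup_le htrunc

lemma lintegral_iterate_adj_le_of_drift (hρ : ρ ≤ 1) (y : K) (k : ℕ) :
    ∫⁻ z, V z ∂(M.adj^[k] (Measure.dirac y)) ≤ V y + (1 - ρ)⁻¹ * b := by
  induction k with
  | zero => simp [lintegral_dirac' _ hV]
  | succ k ih =>
    have := M.isProbabilityMeasure_adj_iterate (Measure.dirac y) k
    calc ∫⁻ z, V z ∂(M.adj^[k + 1] (Measure.dirac y))
        = ∫⁻ z, M.markovOp V z ∂(M.adj^[k] (Measure.dirac y)) := by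
          rw [Function.iterate_succ_apply', M.lintegral_adj _ hV]
      _ ≤ ∫⁻ z, (ρ * V z + b) ∂(M.adj^[k] (Measure.dirac y)) := lintegral_mono hdrift
      _ = ρ * ∫⁻ z, V z ∂(M.adj^[k] (Measure.dirac y)) + b := by
          rw [lintegral_add_right _ measurable_const, lintegral_const_mul _ hV, lintegral_const,
            measure_univ, mul_one]
      _ ≤ ρ * (V y + (1 - ρ)⁻¹ * b) + b := by gcongr
      _ = ρ * V y + (1 + ρ * (1 - ρ)⁻¹) * b := by ring
      _ ≤ V y + (1 - ρ)⁻¹ * b := by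
          rw [one_add_mul_inv_one_sub]
          exact add_le_add (mul_le_of_le_one_left' hρ) le_rfl

end Drift

/-! ### Maps and probabilities along words -/

/-- The composition `w_{e_n} ∘ ⋯ ∘ w_{e_0}` along the word `e_0 ⋯ e_n`. -/
def wordMap : List (Alphabet E) → K → K
  | [], z => z
  | a :: l, z => wordMap l (M.wExt a z)

lemma measurable_wordMap (l : List (Alphabet E)) : Measurable (M.wordMap l) := by
  induction l with
  | nil => exact measurable_id
  | cons a l ih => exact ih.comp (M.measurable_wExt a)

lemma wordMap_append (u v : List (Alphabet E)) (z : K) :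
    M.wordMap (u ++ v) z = M.wordMap v (M.wordMap u z) := by
  induction u generalizing z with
  | nil => rfl
  | cons _ _ ih => exact ih _

lemma pathProb_cons (a : Alphabet E) (l : List (Alphabet E)) (z : K) :
    M.pathProb (a :: l) z = M.prob a z * M.pathProb l (M.wExt a z) := rfl

lemma pathProb_singleton (a : Alphabet E) (z : K) : M.pathProb [a] z = M.prob a z := mul_one _

lemma measurable_pathProb (l : List (Alphabet E)) : Measurable (M.pathProb l) := by
  induction l with
  | nil => exact measurable_const
  | cons a l ih => exact (M.measurable_prob a).mul (ih.comp (M.measurable_wExt a))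

lemma pathProb_append (u v : List (Alphabet E)) (z : K) :
    M.pathProb (u ++ v) z = M.pathProb u z * M.pathProb v (M.wordMap u z) := by
  induction u generalizing z with
  | nil => simp [pathProb, wordMap]
  | cons a u ih => rw [List.cons_append, pathProb_cons, ih, pathProb_cons, mul_assoc]; rfl

lemma pathProb_le_one (l : List (Alphabet E)) (z : K) : M.pathProb l z ≤ 1 := by
  induction l generalizing z with
  | nil => exact le_rfl
  | cons a l ih => exact mul_le_one' (M.prob_le_one a z) (ih _)

lemma tsum_pathProb_append (l : List (Alphabet E)) (z : K) :
    ∑' a, M.pathProb (l ++ [a]) z = M.pathProb l z := by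
  simp_rw [pathProb_append, pathProb_singleton]
  rw [ENNReal.tsum_mul_left, tsum_prob, mul_one]

lemma wordSum_pathProb_mul_succ (n : ℕ) (φ : List (Alphabet E) → ℝ≥0∞) (z : K) :
    wordSum (n + 1) (fun l => M.pathProb l z * φ l) =
      ∑' a, M.prob a z * wordSum n fun l => M.pathProb l (M.wExt a z) * φ (a :: l) := by
  simp_rw [wordSum_succ, ← wordSum_mul_left, ← mul_assoc, pathProb_cons]

lemma wordSum_pathProb (n : ℕ) (z : K) : wordSum n (fun l => M.pathProb l z) = 1 := by
  induction n generalizing z with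
  | zero => rw [wordSum_zero, pathProb]
  | succ n ih => simpa [ih, tsum_prob] using M.wordSum_pathProb_mul_succ n (fun _ => 1) z

lemma lintegral_wordSum_pathProb {μ : Measure K} (hμ : M.adj μ = μ) {f : K → ℝ≥0∞}
    (hf : Measurable f) (n : ℕ) :
    ∫⁻ z, wordSum n (fun l => M.pathProb l z * f (M.wordMap l z)) ∂μ = ∫⁻ z, f z ∂μ := by
  induction n with
  | zero => simp [wordSum_zero, pathProb, wordMap]
  | succ n ih =>
    have hstep (z : K) : wordSum (n + 1) (fun l => M.pathProb l z * f (M.wordMap l z)) =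
        M.markovOp (fun y => wordSum n fun l => M.pathProb l y * f (M.wordMap l y)) z := by
      rw [M.wordSum_pathProb_mul_succ n fun l => f (M.wordMap l z), markovOp_eq]
      rfl
    simp_rw [hstep]
    rw [M.lintegral_markovOp hμ, ih]
    exact measurable_wordSum n fun l =>
      (M.measurable_pathProb l).mul (hf.comp (M.measurable_wordMap l))

/-! ### Contraction on average -/

/-- Contraction on average with rate `ρ`, as a sum over the extended alphabet. -/
def ContractsBy (ρ : ℝ≥0∞) : Prop :=
  ∀ j, ∀ y ∈ M.cell j, ∀ z ∈ M.cell j,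
    ∑' a, M.prob a y * edist (M.wExt a y) (M.wExt a z) ≤ ρ * edist y z

/-- The distance from `z` to the base point of its vertex set. -/
def baseDist (x : N → K) (z : K) : ℝ≥0∞ := edist z (x (M.vertex z))

lemma baseDist_ne_top (x : N → K) (z : K) : M.baseDist x z ≠ ∞ := edist_ne_top _ _

lemma baseDist_eq {x : N → K} {j : N} {z : K} (h : z ∈ M.cell j) :
    M.baseDist x z = edist z (x j) := by
  rw [baseDist, M.vertex_eq h]

lemma measurable_baseDist (x : N → K) : Measurable (M.baseDist x) := by
  have h : Measurable fun q : K × N => edist q.1 (x q.2) :=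
    measurable_from_prod_countable_left fun j =>
      (measurable_edist_left : Measurable fun z => edist z (x j))
  exact h.comp (measurable_id.prodMk M.measurable_vertex)

lemma tsum_prob_mul_edist_base_le (x : N → K) {j : N} {z : K} (hz : z ∈ M.cell j) :
    ∑' a, M.prob a z * edist (M.wExt a (x j)) (x (M.tExt a)) ≤ M.bConst x := by
  rw [M.tsum_prob_mul_eq hz fun a => edist (M.wExt a (x j)) (x (M.tExt a))]
  exact le_iSup_of_le j (le_iSup₂_of_le z hz le_rfl)

variable {M}

lemma Contractive.exists_contractsBy (h : M.Contractive) : ∃ ρ < 1, M.ContractsBy ρ := by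
  obtain ⟨a, -, ha, h⟩ := h
  refine ⟨ENNReal.ofReal a, by simpa using ha, fun j y hy z hz => ?_⟩
  rw [M.tsum_prob_mul_eq hy fun a => edist (M.wExt a y) (M.wExt a z)]
  exact h j y hy z hz

namespace ContractsBy

variable {ρ : ℝ≥0∞} (h : M.ContractsBy ρ)
include h

lemma wordSum_edist_le (n : ℕ) {j : N} {y z : K} (hy : y ∈ M.cell j) (hz : z ∈ M.cell j) :
    wordSum n (fun l => M.pathProb l y * edist (M.wordMap l y) (M.wordMap l z)) ≤
      ρ ^ n * edist y z := by
  induction n generalizing j y z with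
  | zero => simp [wordSum_zero, pathProb, wordMap]
  | succ n ih =>
    rw [M.wordSum_pathProb_mul_succ n fun l => edist (M.wordMap l y) (M.wordMap l z)]
    calc _ ≤ ∑' a, ρ ^ n * (M.prob a y * edist (M.wExt a y) (M.wExt a z)) := by
          refine ENNReal.tsum_le_tsum fun a => ?_
          by_cases ha : M.prob a y = 0
          · simp [ha]
          · obtain rfl := M.cell_unique (M.mem_cell_of_prob_ne_zero ha) hy
            rw [mul_left_comm]
            exact mul_le_mul_right (ih (M.wExt_mem hy) (M.wExt_mem hz)) _
      _ ≤ ρ ^ n * (ρ * edist y z) := by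
          rw [ENNReal.tsum_mul_left]
          exact mul_le_mul_right (h _ _ hy _ hz) _
      _ = ρ ^ (n + 1) * edist y z := by rw [pow_succ, mul_assoc]

-- A single term of the contraction inequality bounds `d(w_a y, w_a z)` by `(ρ / p_a(z)) d(y, z)`.
lemma continuousWithinAt_wExt (hρ : ρ ≠ ∞) {a : Alphabet E} {z : K} (ha : M.prob a z ≠ 0) :
    ContinuousWithinAt (M.wExt a) (M.cell (M.iExt a)) z := by
  have hz := M.mem_cell_of_prob_ne_zero ha
  have ha' : M.prob a z ≠ ∞ := ((M.prob_le_one a z).trans_lt ENNReal.one_lt_top).ne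
  have hbound : ∀ y ∈ M.cell (M.iExt a),
      edist (M.wExt a y) (M.wExt a z) ≤ (M.prob a z)⁻¹ * ρ * edist y z := fun y hy => by
    rw [mul_assoc, ← ENNReal.mul_le_iff_le_inv ha ha', edist_comm, edist_comm y]
    exact (ENNReal.le_tsum a).trans (h _ z hz y hy)
  refine tendsto_iff_edist_tendsto_0.2 (tendsto_of_tendsto_of_tendsto_of_le_of_le'
    tendsto_const_nhds ?_ (Eventually.of_forall fun _ => zero_le)
    (eventually_nhdsWithin_of_forall hbound))
  have hdist : Tendsto (fun y => edist y z) (𝓝[M.cell (M.iExt a)] z) (𝓝 0) :=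
    (tendsto_iff_edist_tendsto_0.1 tendsto_id).mono_left nhdsWithin_le_nhds
  simpa using ENNReal.Tendsto.const_mul hdist
    (Or.inr (ENNReal.mul_ne_top (ENNReal.inv_ne_top.2 ha) hρ))

variable {x : N → K} (hx : ∀ j, x j ∈ M.cell j)
include hx

lemma wordSum_edist_base_le (n : ℕ) (z : K) :
    wordSum n (fun l => M.pathProb l z * edist (M.wordMap l z) (M.wordMap l (x (M.vertex z)))) ≤
      ρ ^ n * M.baseDist x z :=
  h.wordSum_edist_le n (M.mem_cell_vertex z) (hx _)

lemma tsum_prob_mul_edist_le (z : K) :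
    ∑' a, M.prob a z * edist (M.wExt a z) (x (M.tExt a)) ≤ ρ * M.baseDist x z + M.bConst x := by
  calc _ ≤ ∑' a, (M.prob a z * edist (M.wExt a z) (M.wExt a (x (M.vertex z))) +
        M.prob a z * edist (M.wExt a (x (M.vertex z))) (x (M.tExt a))) := by
        refine ENNReal.tsum_le_tsum fun a => ?_
        rw [← mul_add]
        exact mul_le_mul_right (edist_triangle _ _ _) _
    _ ≤ _ := by
        rw [ENNReal.tsum_add]
        exact add_le_add (h _ _ (M.mem_cell_vertex z) _ (hx _))
          (M.tsum_prob_mul_edist_base_le x (M.mem_cell_vertex z))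

lemma markovOp_baseDist_le (z : K) :
    M.markovOp (M.baseDist x) z ≤ ρ * M.baseDist x z + M.bConst x := by
  refine le_trans (le_of_eq ?_) (h.tsum_prob_mul_edist_le hx z)
  rw [markovOp_eq]
  refine tsum_congr fun a => ?_
  by_cases ha : M.prob a z = 0
  · simp [ha]
  · rw [M.baseDist_eq (M.wExt_mem (M.mem_cell_of_prob_ne_zero ha))]

lemma lintegral_baseDist_le (hρ : ρ < 1) {μ : Measure K} [IsProbabilityMeasure μ]
    (hμ : M.adj μ = μ) : ∫⁻ z, M.baseDist x z ∂μ ≤ (1 - ρ)⁻¹ * M.bConst x :=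
  lintegral_le_of_drift (M.measurable_baseDist x) (h.markovOp_baseDist_le hx) hμ hρ
    (M.baseDist_ne_top x)

end ContractsBy

end MarkovSystem

/-! ### The coding map as a limit along words -/

namespace MarkovSystem

variable {K : Type*} [MetricSpace K] [MeasurableSpace K] [BorelSpace K]
  {N : Set ℕ} {E : Type*} [Countable E] (M : MarkovSystem K N E)

/-- The image under `w_{e_n} ∘ ⋯ ∘ w_{e_m}` of the base point of the vertex where the word
`[e_m, …, e_n]` starts; the value at the empty word is arbitrary. -/
def basePoint (x : N → K) : List (Alphabet E) → K
  | [] => x ⟨1, M.one_mem⟩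
  | a :: l => M.wordMap (a :: l) (x (M.iExt a))

lemma basePoint_append_singleton (x : N → K) {l : List (Alphabet E)} (hl : l ≠ [])
    (a : Alphabet E) : M.basePoint x (l ++ [a]) = M.wExt a (M.basePoint x l) := by
  obtain ⟨b, u, rfl⟩ := List.exists_cons_of_ne_nil hl
  exact M.wordMap_append (b :: u) [a] _

lemma back_eq_wordMap (σ : CodeSpace E) (n : ℕ) (y : K) :
    M.back σ n y = M.wordMap (window (-(n : ℤ)) (n + 1) σ) y := by
  induction n generalizing y with
  | zero => simp [back, window, wordMap]
  | succ n ih =>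
    have hstart : -((n + 1 : ℕ) : ℤ) = -((n : ℤ) + 1) := by push_cast; rfl
    change M.back σ n (M.wExt (σ (-((n : ℤ) + 1))) y) = _
    rw [ih, window.eq_def _ (n + 1 + 1), wordMap, hstart, neg_add, neg_add_cancel_right]

lemma approx_eq_basePoint (x : N → K) (σ : CodeSpace E) (n : ℕ) :
    M.approx x σ n = M.basePoint x (window (-(n : ℤ)) (n + 1) σ) := by
  rw [approx, back_eq_wordMap]
  rfl

lemma approx_shift (x : N → K) (σ : CodeSpace E) (n : ℕ) :
    M.approx x (shift σ) (n + 1) = M.wExt (σ 1) (M.approx x σ n) := by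
  have hne : window (-(n : ℤ)) (n + 1) σ ≠ [] := by simp [window]
  have hstart : -((n + 1 : ℕ) : ℤ) + 1 = -(n : ℤ) := by push_cast; ring
  have hend : -(n : ℤ) + (n + 1 : ℕ) = 1 := by push_cast; ring
  rw [approx_eq_basePoint, approx_eq_basePoint, ← M.basePoint_append_singleton x hne, window_shift,
    window_succ_right, hstart, hend]

lemma back_mem {σ : CodeSpace E} (hσ : σ ∈ M.pathSpace) (n : ℕ) {y : K}
    (hy : y ∈ M.cell (M.iExt (σ (-(n : ℤ))))) : M.back σ n y ∈ M.cell (M.tExt (σ 0)) := by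
  induction n generalizing y with
  | zero => exact M.wExt_mem (by simpa using hy)
  | succ n ih =>
    have hedge := (hσ (-((n : ℤ) + 1))).2
    rw [show -((n : ℤ) + 1) + 1 = -n by ring] at hedge
    exact ih (hedge ▸ M.wExt_mem (by simpa using hy))

lemma approx_mem {x : N → K} (hx : ∀ j, x j ∈ M.cell j) {σ : CodeSpace E}
    (hσ : σ ∈ M.pathSpace) (n : ℕ) : M.approx x σ n ∈ M.cell (M.tExt (σ 0)) :=
  M.back_mem hσ n (hx _)

-- There are only countably many words, which makes the range separable although `K` need not be.
lemma stronglyMeasurable_approx (x : N → K) (n : ℕ) :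
    StronglyMeasurable[pastSigma E] fun σ => M.approx x σ n := by
  simp_rw [approx_eq_basePoint]
  refine stronglyMeasurable_iff_measurable_separable.2
    ⟨measurable_comp_window (fun _ => measurableSet_past_cyl_neg n) _,
      ((Set.countable_range (M.basePoint x)).mono ?_).isSeparable⟩
  exact Set.range_comp_subset_range (window (-(n : ℤ)) (n + 1)) (M.basePoint x)

/-- The limit of the approximations of the coding map, with an arbitrary value off the set `D` of
convergence. It agrees with `coding` on `D` and is measurable with respect to the past. -/
def codeLim (x : N → K) (σ : CodeSpace E) : K :=
  haveI : Nonempty K := ⟨x ⟨1, M.one_mem⟩⟩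
  limUnder atTop (M.approx x σ)

lemma codeLim_eq {x : N → K} {σ : CodeSpace E} {y : K}
    (h : Tendsto (M.approx x σ) atTop (𝓝 y)) : M.codeLim x σ = y :=
  h.limUnder_eq

lemma tendsto_codeLim {x : N → K} {σ : CodeSpace E} (h : σ ∈ M.codingDomain x) :
    Tendsto (M.approx x σ) atTop (𝓝 (M.codeLim x σ)) := by
  obtain ⟨y, hy⟩ := h.2
  rwa [M.codeLim_eq hy]

lemma coding_eq_codeLim {x : N → K} {σ : CodeSpace E} (h : σ ∈ M.codingDomain x) :
    M.coding x σ = M.codeLim x σ := by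
  rw [coding, dif_pos h, M.codeLim_eq h.2.choose_spec]

lemma measurableSet_pathSpace : MeasurableSet M.pathSpace := by
  have hinter : M.pathSpace = ⋂ n : ℤ, (fun σ : CodeSpace E => (σ n, σ (n + 1))) ⁻¹'
      {q | (∃ e, q.1 = letter e) ∧ M.iExt q.2 = M.tExt q.1} := by
    ext σ
    simp only [pathSpace, Set.mem_iInter]
    rfl
  rw [hinter]
  exact MeasurableSet.iInter fun n =>
    ((measurable_pi_apply n).prodMk (measurable_pi_apply (n + 1))) MeasurableSet.of_discrete

-- On average contraction makes every `w_e` with `p_e(z) ≠ 0` continuous at `z`.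
lemma codeLim_shift {x : N → K} (hx : ∀ j, x j ∈ M.cell j) {ρ : ℝ≥0∞} (hM : M.ContractsBy ρ)
    (hρ : ρ ≠ ∞) {σ : CodeSpace E} (h : σ ∈ M.codingDomain x) (h' : shift σ ∈ M.codingDomain x)
    (hp : M.prob (σ 1) (M.codeLim x σ) ≠ 0) :
    M.codeLim x (shift σ) = M.wExt (σ 1) (M.codeLim x σ) := by
  have hmem (n : ℕ) : M.approx x σ n ∈ M.cell (M.iExt (σ 1)) := by
    rw [show M.iExt (σ 1) = M.tExt (σ 0) from (h.1 0).2]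
    exact M.approx_mem hx h.1 n
  have hlim : Tendsto (fun n => M.wExt (σ 1) (M.approx x σ n)) atTop
      (𝓝 (M.wExt (σ 1) (M.codeLim x σ))) :=
    (hM.continuousWithinAt_wExt hρ hp).tendsto.comp
      (tendsto_nhdsWithin_iff.2 ⟨M.tendsto_codeLim h, Eventually.of_forall hmem⟩)
  exact tendsto_nhds_unique ((M.tendsto_codeLim h').comp (tendsto_add_atTop_nat 1))
    (hlim.congr fun n => (M.approx_shift x σ n).symm)

lemma measure_cyl_none {Λ : Measure (CodeSpace E)} (h : ∀ᵐ σ ∂Λ, σ ∈ M.pathSpace) (n : ℤ) :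
    Λ (cyl n [(none : Option E)]) = 0 := by
  refine measure_mono_null (t := M.pathSpaceᶜ) (fun σ hσ hp => ?_) h
  obtain ⟨e, he⟩ := (hp n).1
  rw [mem_cyl_singleton.1 hσ] at he
  exact Option.some_ne_none e he.symm

section Complete

variable [CompleteSpace K]

lemma stronglyMeasurable_codeLim (x : N → K) :
    StronglyMeasurable[pastSigma E] (M.codeLim x) := by
  have : Nonempty K := ⟨x ⟨1, M.one_mem⟩⟩
  exact @StronglyMeasurable.limUnder _ _ _ (pastSigma E) _ _ _ _ _ _ _
    (M.stronglyMeasurable_approx x)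

lemma measurable_past_codeLim (x : N → K) : Measurable[pastSigma E] (M.codeLim x) :=
  (stronglyMeasurable_iff_measurable_separable.1 (M.stronglyMeasurable_codeLim x)).1

lemma measurable_codeLim (x : N → K) : Measurable (M.codeLim x) :=
  (M.measurable_past_codeLim x).mono (pastSigma_le E) le_rfl

lemma measurableSet_codingDomain (x : N → K) : MeasurableSet (M.codingDomain x) :=
  M.measurableSet_pathSpace.inter (StronglyMeasurable.measurableSet_exists_tendsto fun n =>
    (M.stronglyMeasurable_approx x n).mono (pastSigma_le E))

lemma ae_mem_codingDomain {x : N → K} {Λ : Measure (CodeSpace E)} [IsProbabilityMeasure Λ]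
    (h : Λ (M.codingDomain x) = 1) : ∀ᵐ σ ∂Λ, σ ∈ M.codingDomain x :=
  (mem_ae_iff_prob_eq_one (M.measurableSet_codingDomain x)).2 h

lemma codingMeasure_eq {x : N → K} {Λ : Measure (CodeSpace E)} [IsProbabilityMeasure Λ]
    (h : Λ (M.codingDomain x) = 1) : M.codingMeasure x Λ = Λ.map (M.codeLim x) :=
  Measure.map_congr ((M.ae_mem_codingDomain h).mono fun _ hσ => M.coding_eq_codeLim hσ)

/-- Given the past, the letter `a` comes next with probability `p_a` at the coded point: the
conditional expectations in the definition of `E(M)`, integrated over the events of the past and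
including the letter `∞`. -/
def StepLaw (x : N → K) (Λ : Measure (CodeSpace E)) : Prop :=
  ∀ a, ∀ A, MeasurableSet[pastSigma E] A →
    Λ (A ∩ cyl 1 [a]) = ∫⁻ σ in A, M.prob a (M.codeLim x σ) ∂Λ

lemma mem_equilibriumStates_iff {x : N → K} {Λ : Measure (CodeSpace E)} :
    Λ ∈ M.equilibriumStates x ↔
      Λ ∈ shiftInvariant E ∧ Λ (M.codingDomain x) = 1 ∧ M.StepLaw x Λ := by
  refine and_congr_right fun hΛ => and_congr_right fun hD => ?_
  have := hΛ.1
  have hD' := M.ae_mem_codingDomain hD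
  have hcoding (e : E) : (fun σ => M.p e (M.coding x σ)) =ᵐ[Λ] fun σ => M.p e (M.codeLim x σ) :=
    hD'.mono fun σ hσ => by simp only [M.coding_eq_codeLim hσ]
  constructor
  · rintro h (_ | e) A hA
    · simp only [prob_none, lintegral_zero]
      exact measure_mono_null Set.inter_subset_right
        (M.measure_cyl_none (hD'.mono fun σ hσ => hσ.1) 1)
    · exact measure_inter_cyl_of_condExp ((h e).trans (hcoding e)) hA
  · intro h e
    refine (condExp_nextIs_ae_eq (Eventually.of_forall fun σ => (M.p_mem _ _).1) ?_
      (h (letter e))).trans (hcoding e).symm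
    exact ((M.p_measurable e).comp (M.measurable_past_codeLim x)).aestronglyMeasurable

end Complete

end MarkovSystem

/-! ### Limits of path measures -/

lemma exists_ofReal_le_ofReal_add_mul_edist {X : Type*} [PseudoMetricSpace X] {s : Set X}
    {f : X → ℝ} (hf : UniformContinuousOn f s) (hf1 : ∀ y ∈ s, f y ≤ 1) {ε : ℝ≥0∞} (hε : 0 < ε) :
    ∃ c : ℝ≥0∞, c ≠ ∞ ∧ ∀ y ∈ s, ∀ z ∈ s,
      ENNReal.ofReal (f y) ≤ ENNReal.ofReal (f z) + (ε + c * edist y z) := by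
  obtain ⟨δ, hδ, hclose⟩ := EMetric.uniformContinuousOn_iff.1 hf ε hε
  refine ⟨δ⁻¹, ENNReal.inv_ne_top.2 hδ.ne', fun y hy z hz => ?_⟩
  rcases lt_or_ge (edist y z) δ with hd | hd
  · calc ENNReal.ofReal (f y) ≤ ENNReal.ofReal (f z + dist (f y) (f z)) :=
          ENNReal.ofReal_le_ofReal (by linarith [Real.dist_eq (f y) (f z), le_abs_self (f y - f z)])
      _ ≤ ENNReal.ofReal (f z) + edist (f y) (f z) := by
          rw [edist_dist]
          exact ENNReal.ofReal_add_le
      _ ≤ _ := add_le_add le_rfl ((hclose hy hz hd).le.trans le_self_add)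
  · have hfar : 1 ≤ δ⁻¹ * edist y z := by
      rw [mul_comm, ← div_eq_mul_inv,
        ENNReal.le_div_iff_mul_le (Or.inl hδ.ne') (Or.inr (edist_ne_top y z)), one_mul]
      exact hd
    exact (ENNReal.ofReal_le_one.2 (hf1 y hy)).trans (hfar.trans (le_add_self.trans le_add_self))

namespace MarkovSystem

variable {K : Type*} [MetricSpace K] [MeasurableSpace K] [BorelSpace K]
  {N : Set ℕ} {E : Type*} [Countable E] (M : MarkovSystem K N E)

lemma exists_wordMap_mem {l : List (Alphabet E)} {j : N} {y z : K} (hl : M.pathProb l y ≠ 0)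
    (hy : y ∈ M.cell j) (hz : z ∈ M.cell j) :
    ∃ k, M.wordMap l y ∈ M.cell k ∧ M.wordMap l z ∈ M.cell k := by
  induction l generalizing j y z with
  | nil => exact ⟨j, hy, hz⟩
  | cons a l ih =>
    obtain rfl := M.cell_unique (M.mem_cell_of_prob_ne_zero (left_ne_zero_of_mul hl)) hy
    exact ih (right_ne_zero_of_mul hl) (M.wExt_mem hy) (M.wExt_mem hz)

lemma basePoint_eq {l : List (Alphabet E)} (hl : l ≠ []) (x : N → K) {j : N} {y : K}
    (hP : M.pathProb l y ≠ 0) (hy : y ∈ M.cell j) : M.basePoint x l = M.wordMap l (x j) := by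
  obtain ⟨a, l, rfl⟩ := List.exists_cons_of_ne_nil hl
  obtain rfl := M.cell_unique (M.mem_cell_of_prob_ne_zero (left_ne_zero_of_mul hP)) hy
  rfl

lemma pathProb_append_singleton_le {a : Alphabet E} {ε c : ℝ≥0∞}
    (ha : ∀ j, ∀ y ∈ M.cell j, ∀ z ∈ M.cell j, M.prob a y ≤ M.prob a z + (ε + c * edist y z))
    {x : N → K} (hx : ∀ j, x j ∈ M.cell j) {l : List (Alphabet E)} (hl : l ≠ []) (z : K) :
    M.pathProb (l ++ [a]) z ≤ M.prob a (M.basePoint x l) * M.pathProb l z +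
      M.pathProb l z * (ε + c * edist (M.wordMap l z) (M.wordMap l (x (M.vertex z)))) := by
  rw [pathProb_append, pathProb_singleton, mul_comm (M.prob a _), ← mul_add]
  by_cases hP : M.pathProb l z = 0
  · simp [hP]
  · rw [M.basePoint_eq hl x hP (M.mem_cell_vertex z)]
    obtain ⟨k, hk, hk'⟩ := M.exists_wordMap_mem hP (M.mem_cell_vertex z) (hx _)
    exact mul_le_mul_right (ha k _ hk _ hk') _

variable {M}

section Contraction

variable {ρ : ℝ≥0∞} {x : N → K} (h : M.ContractsBy ρ) (hx : ∀ j, x j ∈ M.cell j)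
include h hx

lemma ContractsBy.wordSum_edist_basePoint_cons_le {n : ℕ} (hn : n ≠ 0) {a : Alphabet E} {z : K}
    (ha : M.prob a z ≠ 0) :
    wordSum n (fun l => M.pathProb l (M.wExt a z) *
        edist (M.basePoint x l) (M.basePoint x (a :: l))) ≤
      ρ ^ n * (edist (M.wExt a z) (x (M.tExt a)) +
        edist (M.wExt a z) (M.wExt a (x (M.vertex z)))) := by
  have hz := M.mem_cell_of_prob_ne_zero ha
  have hy := M.wExt_mem hz
  rw [M.vertex_eq hz, mul_add]
  refine le_trans ?_ (add_le_add (h.wordSum_edist_le n hy (hx _))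
    (h.wordSum_edist_le n hy (M.wExt_mem (hx (M.iExt a)))))
  rw [← wordSum_add]
  refine wordSum_mono fun l hl => ?_
  rw [← mul_add]
  by_cases hP : M.pathProb l (M.wExt a z) = 0
  · simp [hP]
  · rw [M.basePoint_eq (List.ne_nil_of_length_pos (by omega)) x hP hy]
    exact mul_le_mul_right (edist_triangle_left _ _ (M.wordMap l (M.wExt a z))) _

-- `basePoint x l.tail` and `basePoint x l` are two consecutive approximations of the coding map.
lemma ContractsBy.wordSum_edist_basePoint_tail_le (hρ : ρ ≤ 1) (n : ℕ) (z : K) :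
    wordSum (n + 2) (fun l => M.pathProb l z *
      edist (M.basePoint x l.tail) (M.basePoint x l)) ≤
      ρ ^ (n + 1) * (2 * M.baseDist x z + M.bConst x) := by
  rw [M.wordSum_pathProb_mul_succ (n + 1) fun l => edist (M.basePoint x l.tail) (M.basePoint x l)]
  calc _ ≤ ∑' a, ρ ^ (n + 1) * (M.prob a z * edist (M.wExt a z) (x (M.tExt a)) +
        M.prob a z * edist (M.wExt a z) (M.wExt a (x (M.vertex z)))) := by
        refine ENNReal.tsum_le_tsum fun a => ?_
        by_cases ha : M.prob a z = 0
        · simp [ha]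
        · rw [← mul_add, mul_left_comm]
          exact mul_le_mul_right (h.wordSum_edist_basePoint_cons_le hx n.succ_ne_zero ha) _
    _ ≤ ρ ^ (n + 1) * ((ρ * M.baseDist x z + M.bConst x) + ρ * M.baseDist x z) := by
        rw [ENNReal.tsum_mul_left, ENNReal.tsum_add]
        exact mul_le_mul_right (add_le_add (h.tsum_prob_mul_edist_le hx z)
          (h _ _ (M.mem_cell_vertex z) _ (hx _))) _
    _ ≤ ρ ^ (n + 1) * ((1 * M.baseDist x z + M.bConst x) + 1 * M.baseDist x z) := by gcongr
    _ = _ := by ring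

lemma ContractsBy.lintegral_wordSum_error_le {ν : Measure K} [IsProbabilityMeasure ν] {C : ℝ≥0∞}
    (hC : ∫⁻ z, M.baseDist x z ∂ν ≤ C) (ε c : ℝ≥0∞) (n : ℕ) :
    wordSum n (fun l => ∫⁻ z, M.pathProb l z *
      (ε + c * edist (M.wordMap l z) (M.wordMap l (x (M.vertex z)))) ∂ν) ≤
      ε + c * (ρ ^ n * C) := by
  have hV := M.measurable_baseDist x
  have hmeas (l : List (Alphabet E)) : Measurable fun z => M.pathProb l z *
      (ε + c * edist (M.wordMap l z) (M.wordMap l (x (M.vertex z)))) := by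
    have hedist : Measurable fun q : K × N => edist q.1 (M.wordMap l (x q.2)) :=
      measurable_from_prod_countable_left fun j =>
        (measurable_edist_left : Measurable fun z => edist z (M.wordMap l (x j)))
    exact (M.measurable_pathProb l).mul (((hedist.comp
      ((M.measurable_wordMap l).prodMk M.measurable_vertex)).const_mul _).const_add _)
  rw [← lintegral_wordSum _ _ hmeas]
  calc _ ≤ ∫⁻ z, ε + c * (ρ ^ n * M.baseDist x z) ∂ν := by
        refine lintegral_mono fun z => ?_
        simp only [mul_add, wordSum_add, mul_comm _ ε, mul_left_comm _ c, wordSum_mul_left,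
          wordSum_pathProb, mul_one]
        exact add_le_add le_rfl (mul_le_mul_right (h.wordSum_edist_base_le hx n z) _)
    _ = ε + c * (ρ ^ n * ∫⁻ z, M.baseDist x z ∂ν) := by
        rw [lintegral_add_left measurable_const, lintegral_const_mul _ (hV.const_mul _),
          lintegral_const_mul _ hV, lintegral_const, measure_univ, mul_one]
    _ ≤ _ := by gcongr

end Contraction

/-- `Λ` is the limit along `ω`, on all cylinder sets, of the path measures with the initial
distributions `μ i`. -/
structure IsPathLimit (M : MarkovSystem K N E) {ι : Type*} (ω : Filter ι) (μ : ι → Measure K)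
    (Λ : Measure (CodeSpace E)) : Prop where
  isProbabilityMeasure : IsProbabilityMeasure Λ
  isProbabilityMeasure_initial : ∀ i, IsProbabilityMeasure (μ i)
  tendsto : ∀ m l, Tendsto (fun i => ∫⁻ z, M.pathProb l z ∂μ i) ω (𝓝 (Λ (cyl m l)))

namespace IsPathLimit

variable {ι : Type*} {ω : Filter ι} [ω.NeBot] {μ : ι → Measure K} {Λ : Measure (CodeSpace E)}
  {ρ C : ℝ≥0∞} {x : N → K} (h : M.IsPathLimit ω μ Λ)
include h

lemma mem_shiftInvariant : Λ ∈ shiftInvariant E := by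
  have := h.isProbabilityMeasure
  refine ⟨this, ?_⟩
  have := Measure.isProbabilityMeasure_map (μ := Λ) measurable_shift.aemeasurable
  refine measure_ext_of_cyl fun m _ l _ => ?_
  rw [Measure.map_apply measurable_shift (measurableSet_cyl _ _), shift_preimage_cyl]
  exact tendsto_nhds_unique (h.tendsto _ _) (h.tendsto _ _)

lemma measure_cyl_eq_zero {l : List (Alphabet E)} (hl : ∀ z, M.pathProb l z = 0) (m : ℤ) :
    Λ (cyl m l) = 0 := by
  have hlim := h.tendsto m l
  simp only [hl, lintegral_zero] at hlim
  exact tendsto_nhds_unique hlim tendsto_const_nhds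

lemma ae_mem_pathSpace : ∀ᵐ σ ∂Λ, σ ∈ M.pathSpace := by
  refine ae_all_iff.2 fun n => Filter.Eventually.and ?_ ?_
  · have hnone : Λ (cyl n [(none : Option E)]) = 0 :=
      h.measure_cyl_eq_zero (fun z => (M.pathProb_singleton _ z).trans (M.prob_none z)) n
    filter_upwards [measure_eq_zero_iff_ae_notMem.1 hnone] with σ hσ
    rcases hn : σ n with _ | e
    · exact absurd (mem_cyl_singleton.2 hn) hσ
    · exact ⟨e, rfl⟩
  · have hjump (a b : Alphabet E) (hab : M.iExt b ≠ M.tExt a) : ∀ᵐ σ ∂Λ, σ ∉ cyl n [a, b] := by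
      refine measure_eq_zero_iff_ae_notMem.1 (h.measure_cyl_eq_zero (fun z => ?_) n)
      by_contra hz
      exact hab (M.cell_unique (M.mem_cell_of_prob_ne_zero
        (left_ne_zero_of_mul (right_ne_zero_of_mul hz)))
        (M.wExt_mem (M.mem_cell_of_prob_ne_zero (left_ne_zero_of_mul hz))))
    filter_upwards [ae_all_iff.2 fun a => ae_all_iff.2 fun b => ae_all_iff.2 (hjump a b)] with σ hσ
    by_contra hn
    exact hσ _ _ hn (by simp [mem_cyl_iff, window])

section Contraction

variable (hM : M.ContractsBy ρ) (hx : ∀ j, x j ∈ M.cell j)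
  (hC : ∀ i, ∫⁻ z, M.baseDist x z ∂μ i ≤ C)
include hM hx hC

lemma lintegral_edist_approx_le (hρ : ρ ≤ 1) (n : ℕ) :
    ∫⁻ σ, edist (M.approx x σ n) (M.approx x σ (n + 1)) ∂Λ ≤
      ρ ^ (n + 1) * (2 * C + M.bConst x) := by
  let d (l : List (Alphabet E)) : ℝ≥0∞ := edist (M.basePoint x l.tail) (M.basePoint x l)
  have hV := M.measurable_baseDist x
  have happrox (σ : CodeSpace E) : edist (M.approx x σ n) (M.approx x σ (n + 1)) =
      d (window (-((n + 1 : ℕ) : ℤ)) (n + 2) σ) := by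
    rw [approx_eq_basePoint, approx_eq_basePoint,
      show -(n : ℤ) = -((n + 1 : ℕ) : ℤ) + 1 by push_cast; ring]
    rfl
  have hinitial (i : ι) : wordSum (n + 2) (fun l => d l * ∫⁻ z, M.pathProb l z ∂μ i) ≤
      ρ ^ (n + 1) * (2 * C + M.bConst x) := by
    have := h.isProbabilityMeasure_initial i
    simp_rw [← lintegral_const_mul _ (M.measurable_pathProb _)]
    rw [← lintegral_wordSum _ _ fun l => (M.measurable_pathProb l).const_mul _]
    calc _ ≤ ∫⁻ z, ρ ^ (n + 1) * (2 * M.baseDist x z + M.bConst x) ∂μ i := by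
          refine lintegral_mono fun z => ?_
          simpa only [mul_comm] using hM.wordSum_edist_basePoint_tail_le hx hρ n z
      _ = ρ ^ (n + 1) * (2 * ∫⁻ z, M.baseDist x z ∂μ i + M.bConst x) := by
          rw [lintegral_const_mul _ ((hV.const_mul _).add_const _),
            lintegral_add_right _ measurable_const, lintegral_const_mul _ hV, lintegral_const,
            measure_univ, mul_one]
      _ ≤ _ := by gcongr; exact hC i
  simp_rw [happrox]
  rw [lintegral_window]
  have hle := tsum_le_tsum_add_of_tendsto (ω := ω) (g := 0) (g' := 0)
    (fun l : {l : List (Alphabet E) // l.length = n + 2} =>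
      ENNReal.Tendsto.const_mul (h.tendsto (-((n + 1 : ℕ) : ℤ)) l) (Or.inr (edist_ne_top _ _)))
    (fun _ => tendsto_const_nhds) (fun _ _ => le_add_self) hinitial
  simpa only [wordSum, d, Pi.zero_apply, tsum_zero, zero_add] using hle

lemma setLIntegral_window_le {a : Alphabet E} {ε c : ℝ≥0∞}
    (ha : ∀ j, ∀ y ∈ M.cell j, ∀ z ∈ M.cell j, M.prob a y ≤ M.prob a z + (ε + c * edist y z))
    {φ : List (Alphabet E) → ℝ≥0∞} (hφ : ∀ l, φ l ≤ 1) (n : ℕ) :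
    ∫⁻ σ in cyl 1 [a], φ (window (-(n : ℤ)) (n + 1) σ) ∂Λ ≤
      ∫⁻ σ, φ (window (-(n : ℤ)) (n + 1) σ) * M.prob a (M.approx x σ n) ∂Λ +
        (ε + c * (ρ ^ (n + 1) * C)) := by
  have hφp (l : List (Alphabet E)) : φ l * M.prob a (M.basePoint x l) ≤ 1 :=
    mul_le_one' (hφ l) (M.prob_le_one _ _)
  simp_rw [approx_eq_basePoint]
  rw [lintegral_window Λ _ _ fun l => φ l * M.prob a (M.basePoint x l),
    show (1 : ℤ) = -n + (n + 1 : ℕ) by push_cast; ring, setLIntegral_window_cyl]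
  refine tsum_le_tsum_add_of_tendsto
    (fun l => ENNReal.Tendsto.const_mul (h.tendsto _ _)
      (Or.inr ((hφ l).trans_lt ENNReal.one_lt_top).ne))
    (fun l => ENNReal.Tendsto.const_mul (h.tendsto _ _)
      (Or.inr ((hφp l).trans_lt ENNReal.one_lt_top).ne)) (fun i l => ?_)
    fun i => have := h.isProbabilityMeasure_initial i
      hM.lintegral_wordSum_error_le hx (hC i) ε c (n + 1)
  have hl : l.1 ≠ [] := List.ne_nil_of_length_eq_add_one l.2
  simp only [← lintegral_const_mul _ (M.measurable_pathProb _)]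
  rw [← lintegral_add_left ((M.measurable_pathProb _).const_mul _)]
  refine lintegral_mono fun z => ?_
  calc φ l * M.pathProb (l ++ [a]) z
      ≤ φ l * (M.prob a (M.basePoint x l) * M.pathProb l z + M.pathProb l z *
        (ε + c * edist (M.wordMap l z) (M.wordMap l (x (M.vertex z))))) :=
        mul_le_mul_right (M.pathProb_append_singleton_le ha hx hl z) _
    _ ≤ _ := by
        rw [mul_add, ← mul_assoc]
        exact add_le_add le_rfl (mul_le_of_le_one_left' (hφ l))

lemma measure_cyl_inter_le {a : Alphabet E} {ε c : ℝ≥0∞}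
    (ha : ∀ j, ∀ y ∈ M.cell j, ∀ z ∈ M.cell j, M.prob a y ≤ M.prob a z + (ε + c * edist y z))
    {n : ℕ} {l : List (Alphabet E)} (hl : l.length = n + 1) (k : ℕ) :
    Λ (cyl (-(n : ℤ)) l ∩ cyl 1 [a]) ≤
      ∫⁻ σ in cyl (-(n : ℤ)) l, M.prob a (M.approx x σ (k + n)) ∂Λ +
        (ε + c * (ρ ^ (k + n + 1) * C)) := by
  classical
  let φ (u : List (Alphabet E)) : ℝ≥0∞ := if u.drop k = l then 1 else 0
  have hφ (σ : CodeSpace E) : φ (window (-((k + n : ℕ) : ℤ)) (k + n + 1) σ) =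
      (cyl (-(n : ℤ)) l).indicator 1 σ := by
    rw [add_assoc, window_add, show -((k + n : ℕ) : ℤ) + k = -n by push_cast; ring]
    simp only [φ, List.drop_left' (length_window _ _ _), Set.indicator_apply, mem_cyl_iff, hl,
      Pi.one_apply]
  have hle := h.setLIntegral_window_le hM hx hC ha (φ := φ)
    (fun u => by simp only [φ]; split_ifs <;> simp) (k + n)
  have hmul (f : CodeSpace E → ℝ≥0∞) :
      (fun σ => (cyl (-(n : ℤ)) l).indicator 1 σ * f σ) = (cyl (-(n : ℤ)) l).indicator f := by
    ext σ
    by_cases hσ : σ ∈ cyl (-(n : ℤ)) l <;> simp [hσ]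
  simp_rw [hφ] at hle
  rwa [hmul, lintegral_indicator_one (measurableSet_cyl _ _),
    lintegral_indicator (measurableSet_cyl _ _), Measure.restrict_apply (measurableSet_cyl _ _)]
    at hle

end Contraction

end IsPathLimit

end MarkovSystem

/-! ### Asymptotic states -/

namespace MarkovSystem

variable {K : Type*} [MetricSpace K] [MeasurableSpace K] [BorelSpace K]
  {N : Set ℕ} {E : Type*} [Countable E] (M : MarkovSystem K N E)

/-- The function `p̄_e ∘ F · 1_{T_{i(e)}}` in the definition of the asymptotic states. -/
def asymptoticProb (x : N → K) (e : E) : CodeSpace E → ℝ :=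
  (M.endsAt (M.i e)).indicator fun σ => M.pBar e (M.coding x σ)

variable {M}

lemma exists_prob_le_add_mul_edist {e : E} (hu : UniformContinuousOn (M.p e) (M.cell (M.i e)))
    {ε : ℝ≥0∞} (hε : 0 < ε) :
    ∃ c : ℝ≥0∞, c ≠ ∞ ∧ ∀ j, ∀ y ∈ M.cell j, ∀ z ∈ M.cell j,
      M.prob (letter e) y ≤ M.prob (letter e) z + (ε + c * edist y z) := by
  obtain ⟨c, hc, hle⟩ :=
    exists_ofReal_le_ofReal_add_mul_edist hu (fun y _ => (M.p_mem e y).2) hε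
  refine ⟨c, hc, fun j y hy z hz => ?_⟩
  by_cases hp : M.prob (letter e) y = 0
  · exact hp ▸ zero_le
  · obtain rfl := M.cell_unique (M.mem_cell_of_prob_ne_zero hp) hy
    exact hle y hy z hz

section Limit

variable {x : N → K} (hx : ∀ j, x j ∈ M.cell j)
include hx

lemma tendsto_p_approx {e : E} (hu : UniformContinuousOn (M.p e) (M.cell (M.i e)))
    {σ : CodeSpace E} (hσ : σ ∈ M.codingDomain x) :
    Tendsto (fun n => M.p e (M.approx x σ n)) atTop (𝓝 (M.asymptoticProb x e σ)) := by
  have hmem := M.approx_mem hx hσ.1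
  by_cases hT : σ ∈ M.endsAt (M.i e)
  · rw [hT.2] at hmem
    have hwithin : Tendsto (M.approx x σ) atTop (𝓝[M.cell (M.i e)] (M.codeLim x σ)) :=
      tendsto_nhdsWithin_iff.2 ⟨M.tendsto_codeLim hσ, Eventually.of_forall hmem⟩
    have hclosure : M.codeLim x σ ∈ closure (M.cell (M.i e)) :=
      mem_closure_of_tendsto (M.tendsto_codeLim hσ) (Eventually.of_forall hmem)
    have : (𝓝[M.cell (M.i e)] (M.codeLim x σ)).NeBot :=
      mem_closure_iff_nhdsWithin_neBot.1 hclosure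
    have hcauchy : Cauchy (𝓝[M.cell (M.i e)] (M.codeLim x σ)) :=
      cauchy_nhds.mono nhdsWithin_le_nhds
    rw [asymptoticProb, Set.indicator_of_mem hT, M.coding_eq_codeLim hσ, pBar, if_pos hclosure]
    exact (tendsto_extendFrom (cauchy_map_iff_exists_tendsto.1
      (hcauchy.map_of_le hu inf_le_right))).comp hwithin
  · rw [asymptoticProb, Set.indicator_of_notMem hT]
    refine tendsto_const_nhds.congr fun n => (M.p_eq_zero e _ fun h => hT ⟨hσ.1, ?_⟩).symm
    exact M.cell_unique (hmem n) h

lemma tsum_asymptoticProb_le_one (hu : ∀ e, UniformContinuousOn (M.p e) (M.cell (M.i e)))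
    {σ : CodeSpace E} (hσ : σ ∈ M.codingDomain x) :
    ∑' e, ENNReal.ofReal (M.asymptoticProb x e σ) ≤ 1 := by
  rw [ENNReal.tsum_eq_iSup_sum]
  refine iSup_le fun s => le_of_tendsto' (tendsto_finsetSum s fun e _ =>
    ENNReal.tendsto_ofReal (tendsto_p_approx hx (hu e) hσ)) fun n => ?_
  calc ∑ e ∈ s, M.prob (letter e) (M.approx x σ n)
      ≤ ∑' e, M.prob (letter e) (M.approx x σ n) := ENNReal.sum_le_tsum s
    _ = 1 := by
      rw [← tsum_alphabet (f := fun a => M.prob a (M.approx x σ n)) (M.prob_none _), M.tsum_prob]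

lemma aestronglyMeasurable_asymptoticProb {e : E}
    (hu : UniformContinuousOn (M.p e) (M.cell (M.i e))) {Λ : Measure (CodeSpace E)}
    (hD : ∀ᵐ σ ∂Λ, σ ∈ M.codingDomain x) :
    AEStronglyMeasurable[pastSigma E] (M.asymptoticProb x e) Λ := by
  have hmeas (n : ℕ) : StronglyMeasurable[pastSigma E] fun σ => M.p e (M.approx x σ n) :=
    ((M.p_measurable e).comp
      (M.stronglyMeasurable_approx x n).measurable).stronglyMeasurable
  exact ⟨_, @StronglyMeasurable.limUnder _ _ _ (pastSigma E) _ _ _ _ _ _ _ hmeas,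
    hD.mono fun σ hσ => (tendsto_p_approx hx hu hσ).limUnder_eq.symm⟩

end Limit

namespace IsPathLimit

variable {ι : Type*} {ω : Filter ι} [ω.NeBot] {μ : ι → Measure K} {Λ : Measure (CodeSpace E)}
  {ρ C : ℝ≥0∞} {x : N → K} (h : M.IsPathLimit ω μ Λ)
  (hM : M.ContractsBy ρ) (hρ : ρ < 1) (hx : ∀ j, x j ∈ M.cell j)
  (hC : ∀ i, ∫⁻ z, M.baseDist x z ∂μ i ≤ C) (hC' : C ≠ ∞)
include h hM hρ hx hC hC'

lemma measure_codingDomain [CompleteSpace K] (hb : M.bConst x < ∞) : Λ (M.codingDomain x) = 1 := by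
  have := h.isProbabilityMeasure
  rw [← mem_ae_iff_prob_eq_one (M.measurableSet_codingDomain x)]
  have hmeas (n : ℕ) : Measurable fun σ => edist (M.approx x σ n) (M.approx x σ (n + 1)) :=
    (((M.stronglyMeasurable_approx x n).mono (pastSigma_le E)).edist
      ((M.stronglyMeasurable_approx x (n + 1)).mono (pastSigma_le E))).measurable
  have hfin : ∫⁻ σ, ∑' n, edist (M.approx x σ n) (M.approx x σ (n + 1)) ∂Λ ≠ ∞ := by
    rw [lintegral_tsum fun n => (hmeas n).aemeasurable]
    refine ne_top_of_le_ne_top ?_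
      (ENNReal.tsum_le_tsum fun n => h.lintegral_edist_approx_le hM hx hC hρ.le n)
    rw [ENNReal.tsum_mul_right, ENNReal.tsum_geometric_add_one]
    have hinv : (1 - ρ)⁻¹ ≠ ∞ := ENNReal.inv_ne_top.2 (tsub_pos_of_lt hρ).ne'
    finiteness
  filter_upwards [h.ae_mem_pathSpace, ae_lt_top (Measurable.tsum hmeas) hfin] with σ hσ hσ'
  exact ⟨hσ, cauchySeq_tendsto_of_complete
    (cauchySeq_of_edist_le_of_tsum_ne_top _ (fun n => le_rfl) hσ'.ne)⟩

lemma measure_cyl_inter_le_asymptoticProb {e : E}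
    (hu : UniformContinuousOn (M.p e) (M.cell (M.i e))) (hD : ∀ᵐ σ ∂Λ, σ ∈ M.codingDomain x)
    {n : ℕ} {l : List (Alphabet E)} (hl : l.length = n + 1) :
    Λ (cyl (-(n : ℤ)) l ∩ cyl 1 [letter e]) ≤
      ∫⁻ σ in cyl (-(n : ℤ)) l, ENNReal.ofReal (M.asymptoticProb x e σ) ∂Λ := by
  have := h.isProbabilityMeasure
  have hlim : Tendsto (fun k => ∫⁻ σ in cyl (-(n : ℤ)) l,
      M.prob (letter e) (M.approx x σ (k + n)) ∂Λ) atTop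
      (𝓝 (∫⁻ σ in cyl (-(n : ℤ)) l, ENNReal.ofReal (M.asymptoticProb x e σ) ∂Λ)) := by
    refine tendsto_lintegral_of_dominated_convergence (fun _ => 1) (fun k =>
      (M.measurable_prob _).comp
        ((M.stronglyMeasurable_approx x _).mono (pastSigma_le E)).measurable)
      (fun k => Eventually.of_forall fun σ => M.prob_le_one _ _) (by simp) ?_
    filter_upwards [ae_restrict_of_ae hD] with σ hσ
    exact ENNReal.tendsto_ofReal
      ((tendsto_p_approx hx hu hσ).comp (tendsto_add_atTop_nat n))
  refine ENNReal.le_of_forall_pos_le_add fun ε hε _ => ?_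
  obtain ⟨c, hc, hmod⟩ := exists_prob_le_add_mul_edist hu (ENNReal.coe_pos.2 hε)
  have herr : Tendsto (fun k => (ε : ℝ≥0∞) + c * (ρ ^ (k + n + 1) * C)) atTop (𝓝 ε) := by
    have hpow : Tendsto (fun k => ρ ^ (k + n + 1)) atTop (𝓝 0) :=
      (ENNReal.tendsto_pow_atTop_nhds_zero_of_lt_one hρ).comp (tendsto_add_atTop_nat (n + 1))
    simpa using (ENNReal.Tendsto.const_mul (a := c)
      (ENNReal.Tendsto.mul_const (b := C) hpow (Or.inr hC')) (Or.inr hc)).const_add (ε : ℝ≥0∞)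
  exact ge_of_tendsto' (hlim.add herr) fun k => h.measure_cyl_inter_le hM hx hC hmod hl k

-- The inequalities for the single letters are equalities since both sides have, summed over all
-- letters, the total mass of the cylinder set.
lemma measure_cyl_inter_eq_asymptoticProb
    (hu : ∀ e, UniformContinuousOn (M.p e) (M.cell (M.i e)))
    (hD : ∀ᵐ σ ∂Λ, σ ∈ M.codingDomain x) {n : ℕ} {l : List (Alphabet E)}
    (hl : l.length = n + 1) (e : E) :
    Λ (cyl (-(n : ℤ)) l ∩ cyl 1 [letter e]) =
      ∫⁻ σ in cyl (-(n : ℤ)) l, ENNReal.ofReal (M.asymptoticProb x e σ) ∂Λ := by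
  have := h.isProbabilityMeasure
  have hle (e : E) := h.measure_cyl_inter_le_asymptoticProb hM hρ hx hC hC' (hu e) hD hl
  have hsum : ∑' e, Λ (cyl (-(n : ℤ)) l ∩ cyl 1 [letter e]) = Λ (cyl (-(n : ℤ)) l) := by
    rw [← tsum_measure_inter_cyl_singleton Λ 1 (measurableSet_cyl (-(n : ℤ)) l), tsum_alphabet]
    exact measure_mono_null Set.inter_subset_right
      (M.measure_cyl_none (hD.mono fun σ hσ => hσ.1) 1)
  by_contra hne
  refine (ENNReal.tsum_lt_tsum (hsum ▸ measure_ne_top _ _) hle ((hle e).lt_of_ne hne)).not_ge ?_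
  calc _ = ∫⁻ σ in cyl (-(n : ℤ)) l, ∑' e, ENNReal.ofReal (M.asymptoticProb x e σ) ∂Λ :=
        (lintegral_tsum fun e => ((aestronglyMeasurable_asymptoticProb hx (hu e) hD).mono
          (pastSigma_le E)).aemeasurable.ennreal_ofReal.restrict).symm
    _ ≤ ∫⁻ _ in cyl (-(n : ℤ)) l, 1 ∂Λ :=
        lintegral_mono_ae (ae_restrict_of_ae (hD.mono fun σ => tsum_asymptoticProb_le_one hx hu))
    _ = _ := by rw [hsum, setLIntegral_one]

lemma mem_asymptoticStates [CompleteSpace K] (hb : M.bConst x < ∞)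
    (hu : ∀ e, UniformContinuousOn (M.p e) (M.cell (M.i e))) : Λ ∈ M.asymptoticStates x := by
  have := h.isProbabilityMeasure
  have hdom := h.measure_codingDomain hM hρ hx hC hC' hb
  have hD := M.ae_mem_codingDomain hdom
  refine ⟨h.mem_shiftInvariant, hdom, fun e => condExp_nextIs_ae_eq
    (hD.mono fun σ hσ => ge_of_tendsto' (tendsto_p_approx hx (hu e) hσ) fun n => (M.p_mem _ _).1)
    (aestronglyMeasurable_asymptoticProb hx (hu e) hD) fun A hA => ?_⟩
  have hA' := pastSigma_le E A hA
  rw [← Measure.restrict_apply hA', ← withDensity_apply _ hA']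
  refine measure_eq_of_past_cyl (fun n l hl => ?_) hA
  rw [Measure.restrict_apply (measurableSet_cyl _ _), withDensity_apply _ (measurableSet_cyl _ _)]
  exact h.measure_cyl_inter_eq_asymptoticProb hM hρ hx hC hC' hu hD hl e

end IsPathLimit

end MarkovSystem

/-! ### From equilibrium states to invariant measures -/

namespace MarkovSystem

variable {K : Type*} [MetricSpace K] [MeasurableSpace K] [BorelSpace K] [CompleteSpace K]
  {N : Set ℕ} {E : Type*} [Countable E] {M : MarkovSystem K N E} {x : N → K}
  {Λ : Measure (CodeSpace E)}

lemma StepLaw.setLIntegral (h : M.StepLaw x Λ) (a : Alphabet E)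
    {g : CodeSpace E → ℝ≥0∞} (hg : Measurable[pastSigma E] g) :
    ∫⁻ σ in cyl 1 [a], g σ ∂Λ = ∫⁻ σ, g σ * M.prob a (M.codeLim x σ) ∂Λ := by
  have htrim : (Λ.restrict (cyl 1 [a])).trim (pastSigma_le E) =
      (Λ.withDensity fun σ => M.prob a (M.codeLim x σ)).trim (pastSigma_le E) := by
    refine @Measure.ext _ (pastSigma E) _ _ fun A hA => ?_
    rw [trim_measurableSet_eq _ hA, trim_measurableSet_eq _ hA,
      Measure.restrict_apply (pastSigma_le E _ hA), withDensity_apply _ (pastSigma_le E _ hA),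
      h a A hA]
  have hp : Measurable fun σ => M.prob a (M.codeLim x σ) :=
    (M.measurable_prob a).comp (M.measurable_codeLim x)
  rw [← lintegral_trim (pastSigma_le E) hg, htrim, lintegral_trim (pastSigma_le E) hg,
    lintegral_withDensity_eq_lintegral_mul _ hp (hg.mono (pastSigma_le E) le_rfl)]
  simp only [Pi.mul_apply, mul_comm]

lemma StepLaw.ae_prob_ne_zero (h : M.StepLaw x Λ) :
    ∀ᵐ σ ∂Λ, M.prob (σ 1) (M.codeLim x σ) ≠ 0 := by
  have hletter (a : Alphabet E) :
      ∀ᵐ σ ∂Λ, σ ∉ (fun σ => M.prob a (M.codeLim x σ)) ⁻¹' {0} ∩ cyl 1 [a] := by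
    have hpast : MeasurableSet[pastSigma E] ((fun σ => M.prob a (M.codeLim x σ)) ⁻¹' {0}) :=
      (M.measurable_prob a).comp (M.measurable_past_codeLim x) (measurableSet_singleton 0)
    rw [← measure_eq_zero_iff_ae_notMem, h a _ hpast]
    exact (setLIntegral_congr_fun (pastSigma_le E _ hpast) fun σ hσ => hσ).trans lintegral_zero
  filter_upwards [ae_all_iff.2 hletter] with σ hσ hp
  exact hσ (σ 1) ⟨hp, mem_cyl_singleton.2 rfl⟩

section Shift

variable [IsProbabilityMeasure Λ] (h : M.StepLaw x Λ) (hx : ∀ j, x j ∈ M.cell j) {ρ : ℝ≥0∞}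
  (hM : M.ContractsBy ρ) (hρ : ρ ≠ ∞) (hS : Λ ∈ shiftInvariant E)
  (hD : Λ (M.codingDomain x) = 1)
include h hx hM hρ hS hD

lemma StepLaw.ae_codeLim_shift :
    ∀ᵐ σ ∂Λ, M.codeLim x (shift σ) = M.wExt (σ 1) (M.codeLim x σ) := by
  have hD' := M.ae_mem_codingDomain hD
  filter_upwards [hD', (measurePreserving_shift hS).quasiMeasurePreserving.ae hD',
    h.ae_prob_ne_zero] with σ hσ hσ' hp
  exact M.codeLim_shift hx hM hρ hσ hσ' hp

lemma StepLaw.setLIntegral_mul_codeLim_shift (a : Alphabet E) {g : CodeSpace E → ℝ≥0∞}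
    (hg : Measurable[pastSigma E] g) {f : K → ℝ≥0∞} (hf : Measurable f) :
    ∫⁻ σ in cyl 1 [a], g σ * f (M.codeLim x (shift σ)) ∂Λ =
      ∫⁻ σ, g σ * (M.prob a (M.codeLim x σ) * f (M.wExt a (M.codeLim x σ))) ∂Λ := by
  have hgf : Measurable[pastSigma E] fun σ => g σ * f (M.wExt a (M.codeLim x σ)) :=
    hg.mul ((hf.comp (M.measurable_wExt a)).comp (M.measurable_past_codeLim x))
  calc _ = ∫⁻ σ in cyl 1 [a], g σ * f (M.wExt a (M.codeLim x σ)) ∂Λ := by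
        refine lintegral_congr_ae ?_
        filter_upwards [ae_restrict_of_ae (h.ae_codeLim_shift hx hM hρ hS hD),
          ae_restrict_mem (measurableSet_cyl 1 [a])] with σ hshift hσ
        rw [hshift, mem_cyl_singleton.1 hσ]
    _ = _ := by
        rw [h.setLIntegral a hgf]
        exact lintegral_congr fun σ => by ring

lemma StepLaw.adj_map_codeLim : M.adj (Λ.map (M.codeLim x)) = Λ.map (M.codeLim x) := by
  have hm := M.measurable_codeLim x
  refine Measure.ext fun B hB => ?_
  have hind : Measurable (B.indicator (1 : K → ℝ≥0∞)) := measurable_one.indicator hB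
  have hshift : MeasurableSet (shift ⁻¹' (M.codeLim x ⁻¹' B)) := measurable_shift (hm hB)
  have hletter (a : Alphabet E) : ∫⁻ σ, M.prob a (M.codeLim x σ) *
      B.indicator 1 (M.wExt a (M.codeLim x σ)) ∂Λ =
      Λ (shift ⁻¹' (M.codeLim x ⁻¹' B) ∩ cyl 1 [a]) := by
    have hstep := h.setLIntegral_mul_codeLim_shift hx hM hρ hS hD a (g := 1) measurable_const hind
    simp only [Pi.one_apply, one_mul] at hstep
    rw [← hstep, ← Measure.restrict_apply hshift, ← lintegral_indicator_one hshift]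
    rfl
  calc M.adj (Λ.map (M.codeLim x)) B
      = ∫⁻ σ, ∑' a, M.prob a (M.codeLim x σ) *
          B.indicator 1 (M.wExt a (M.codeLim x σ)) ∂Λ := by
        rw [← lintegral_indicator_one hB, M.lintegral_adj _ hind,
          lintegral_map (M.measurable_markovOp hind) hm]
        simp_rw [markovOp_eq]
    _ = ∑' a, Λ (shift ⁻¹' (M.codeLim x ⁻¹' B) ∩ cyl 1 [a]) := by
        simp_rw [← hletter]
        exact lintegral_tsum fun a => (((M.measurable_prob a).comp hm).mul
          (hind.comp ((M.measurable_wExt a).comp hm))).aemeasurable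
    _ = Λ.map (M.codeLim x) B := by
        rw [tsum_measure_inter_cyl_singleton Λ 1 hshift,
          (measurePreserving_shift hS).measure_preimage (hm hB).nullMeasurableSet,
          Measure.map_apply hm hB]

-- By shift invariance the first letter of the word is moved into the past, where the induction
-- hypothesis applies to the remaining letters.
lemma StepLaw.setLIntegral_cyl (l : List (Alphabet E)) {g : CodeSpace E → ℝ≥0∞}
    (hg : Measurable[pastSigma E] g) :
    ∫⁻ σ in cyl 1 l, g σ ∂Λ = ∫⁻ σ, g σ * M.pathProb l (M.codeLim x σ) ∂Λ := by
  induction l generalizing g with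
  | nil => simp [cyl_nil, pathProb]
  | cons a l ih =>
    have hshift := measurePreserving_shift hS
    let f : CodeSpace E → ℝ≥0∞ := (cyl 0 [a]).indicator (g ∘ unshift)
    have hf : Measurable[pastSigma E] f :=
      (hg.comp measurable_past_unshift).indicator (measurableSet_past_cyl (by simp))
    have hf' : Measurable f := hf.mono (pastSigma_le E) le_rfl
    have hfshift : f ∘ shift = (cyl 1 [a]).indicator g := by
      ext σ
      have hmem : shift σ ∈ cyl 0 [a] ↔ σ ∈ cyl 1 [a] := by
        rw [← Set.mem_preimage, shift_preimage_cyl, zero_add]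
      by_cases hσ : σ ∈ cyl 1 [a] <;> simp [f, hmem, hσ]
    calc ∫⁻ σ in cyl 1 (a :: l), g σ ∂Λ
        = ∫⁻ σ, (cyl 1 l).indicator f (shift σ) ∂Λ := by
          rw [← lintegral_indicator (measurableSet_cyl _ _)]
          have hcons : cyl 1 (a :: l) = shift ⁻¹' cyl 1 l ∩ cyl 1 [a] := by
            ext σ
            rw [shift_preimage_cyl, Set.mem_inter_iff, mem_cyl_cons, mem_cyl_singleton, and_comm]
          rw [hcons, ← Set.indicator_indicator, ← hfshift]
          rfl
      _ = ∫⁻ σ, f (shift σ) * M.pathProb l (M.codeLim x (shift σ)) ∂Λ := by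
          rw [hshift.lintegral_comp (hf'.indicator (measurableSet_cyl _ _)),
            lintegral_indicator (measurableSet_cyl _ _), ih hf]
          exact (hshift.lintegral_comp
            (hf'.mul ((M.measurable_pathProb l).comp (M.measurable_codeLim x)))).symm
      _ = ∫⁻ σ in cyl 1 [a], g σ * M.pathProb l (M.codeLim x (shift σ)) ∂Λ := by
          rw [← lintegral_indicator (measurableSet_cyl _ _)]
          refine lintegral_congr fun σ => ?_
          rw [Set.indicator_mul_left, ← hfshift]
          rfl
      _ = _ := h.setLIntegral_mul_codeLim_shift hx hM hρ hS hD a hg (M.measurable_pathProb l)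

end Shift

section EquilibriumState

variable (hx : ∀ j, x j ∈ M.cell j) {ρ : ℝ≥0∞} (hM : M.ContractsBy ρ) (hρ : ρ ≠ ∞)
  (hΛ : Λ ∈ M.equilibriumStates x)
include hx hM hρ hΛ

lemma codingMeasure_mem_invariantMeasures : M.codingMeasure x Λ ∈ M.invariantMeasures := by
  obtain ⟨hS, hD, hstep⟩ := M.mem_equilibriumStates_iff.1 hΛ
  have := hS.1
  rw [M.codingMeasure_eq hD]
  exact ⟨Measure.isProbabilityMeasure_map (M.measurable_codeLim x).aemeasurable,
    hstep.adj_map_codeLim hx hM hρ hS hD⟩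

lemma isLift_codingMeasure : M.IsLift (M.codingMeasure x Λ) Λ := by
  obtain ⟨hS, hD, hstep⟩ := M.mem_equilibriumStates_iff.1 hΛ
  have := hS.1
  refine ⟨this, fun m _ l _ => ?_⟩
  have hcyl := hstep.setLIntegral_cyl hx hM hρ hS hD l (g := 1) measurable_const
  simp only [Pi.one_apply, one_mul, setLIntegral_one] at hcyl
  rw [M.codingMeasure_eq hD, lintegral_map (M.measurable_pathProb l) (M.measurable_codeLim x),
    ← hcyl, measure_cyl_eq_of_shiftInvariant hS m 1]

end EquilibriumState

end MarkovSystem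

/-! ### From invariant measures to equilibrium states -/

lemma coe_le_coe_add_mul_edist {X : Type*} [PseudoEMetricSpace X] {f : X → ℝ≥0} {c : ℝ≥0}
    (hf : LipschitzWith c f) (y z : X) : (f y : ℝ≥0∞) ≤ f z + c * edist y z := by
  have hzero (r : ℝ≥0) : edist r 0 = r := by simp [edist_nndist, NNReal.nndist_zero_eq_val']
  calc (f y : ℝ≥0∞) = edist (f y) 0 := (hzero _).symm
    _ ≤ edist (f y) (f z) + edist (f z) 0 := edist_triangle _ _ _
    _ ≤ f z + c * edist y z := by rw [hzero, add_comm]; gcongr; exact hf y z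

lemma measure_eq_of_lintegral_lipschitz_le {X : Type*} [PseudoEMetricSpace X] [MeasurableSpace X]
    [BorelSpace X] {μ ν : Measure X} [IsFiniteMeasure μ] [IsFiniteMeasure ν]
    (h : ∀ (f : X → ℝ≥0) (c : ℝ≥0), LipschitzWith c f → (∀ z, f z ≤ 1) →
      ∫⁻ z, f z ∂μ ≤ ∫⁻ z, f z ∂ν)
    (huniv : μ Set.univ = ν Set.univ) : μ = ν := by
  have hclosed (F : Set X) (hF : IsClosed F) : μ F ≤ ν F := by
    have hpos (n : ℕ) : (0 : ℝ) < 1 / (n + 1) := Nat.one_div_pos_of_nat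
    have hlim : Tendsto (fun n : ℕ => (1 : ℝ) / (n + 1)) atTop (𝓝 0) :=
      tendsto_one_div_add_atTop_nhds_zero_nat
    exact le_of_tendsto_of_tendsto'
      (tendsto_lintegral_thickenedIndicator_of_isClosed μ hF hpos hlim)
      (tendsto_lintegral_thickenedIndicator_of_isClosed ν hF hpos hlim) fun n =>
        h _ _ (lipschitzWith_thickenedIndicator (hpos n) F) (thickenedIndicator_le_one (hpos n) F)
  refine Measure.eq_of_le_of_measure_univ_eq (Measure.le_iff.2 fun B hB => ?_) huniv
  rw [hB.measure_eq_iSup_isClosed_of_ne_top (measure_ne_top μ B)]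
  exact iSup₂_le fun F hFB => iSup_le fun hF => (hclosed F hF).trans (measure_mono hFB)

namespace MarkovSystem

variable {K : Type*} [MetricSpace K] [MeasurableSpace K] [BorelSpace K]
  {N : Set ℕ} {E : Type*} [Countable E] {M : MarkovSystem K N E}

lemma IsLift.eq {μ : Measure K} {Λ Λ' : Measure (CodeSpace E)} (h : M.IsLift μ Λ)
    (h' : M.IsLift μ Λ') : Λ = Λ' := by
  have := h.1
  exact measure_ext_of_cyl fun m hm l hl => by rw [h.2 m hm l hl, h'.2 m hm l hl]

section Invariant

variable {μ : Measure K} (hμ : μ ∈ M.invariantMeasures)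
include hμ

lemma exists_measure_cyl_eq_lintegral_pathProb : ∃ Λ : Measure (CodeSpace E),
    IsProbabilityMeasure Λ ∧ ∀ m l, Λ (cyl m l) = ∫⁻ z, M.pathProb l z ∂μ := by
  have := hμ.1
  refine exists_measure_cyl_eq ?_ (fun l => ?_) fun l => ?_
  · simp [pathProb]
  · rw [← lintegral_tsum fun a => (M.measurable_pathProb _).aemeasurable]
    simp_rw [tsum_pathProb_append]
  · rw [← lintegral_tsum fun a => (M.measurable_pathProb _).aemeasurable,
      ← M.lintegral_markovOp hμ.2 (M.measurable_pathProb l)]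
    simp_rw [markovOp_eq, pathProb_cons]

lemma existsUnique_isLift : ∃! Λ, M.IsLift μ Λ := by
  obtain ⟨Λ, hΛ, hcyl⟩ := exists_measure_cyl_eq_lintegral_pathProb hμ
  have h : M.IsLift μ Λ := ⟨hΛ, fun m _ l _ => hcyl m l⟩
  exact ⟨Λ, h, fun Λ' h' => h'.eq h⟩

end Invariant

namespace IsLift

variable {μ : Measure K} {Λ : Measure (CodeSpace E)} (h : M.IsLift μ Λ)
include h

lemma lift_eq : M.lift μ = Λ := by
  have hex : ∃ Λ, M.IsLift μ Λ := ⟨Λ, h⟩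
  rw [lift, dif_pos hex]
  exact hex.choose_spec.eq h

variable (hμ : μ ∈ M.invariantMeasures)
include hμ

lemma measure_cyl (m : ℤ) (l : List (Alphabet E)) : Λ (cyl m l) = ∫⁻ z, M.pathProb l z ∂μ := by
  obtain ⟨Λ', hΛ', hcyl⟩ := exists_measure_cyl_eq_lintegral_pathProb hμ
  rw [h.eq ⟨hΛ', fun m _ l _ => hcyl m l⟩, hcyl]

lemma isPathLimit : M.IsPathLimit (⊤ : Filter Unit) (fun _ => μ) Λ :=
  ⟨h.1, fun _ => hμ.1, fun m l => h.measure_cyl hμ m l ▸ tendsto_const_nhds⟩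

end IsLift

lemma pathProb_mul_basePoint_le (M : MarkovSystem K N E) (x : N → K) {f : K → ℝ≥0} {c : ℝ≥0}
    (hf : LipschitzWith c f) {l : List (Alphabet E)} (hl : l ≠ []) (z : K) :
    M.pathProb l z * f (M.basePoint x l) ≤ M.pathProb l z * f (M.wordMap l z) +
      M.pathProb l z * (c * edist (M.wordMap l z) (M.wordMap l (x (M.vertex z)))) := by
  by_cases hP : M.pathProb l z = 0
  · simp [hP]
  · rw [M.basePoint_eq hl x hP (M.mem_cell_vertex z), ← mul_add, edist_comm]
    exact mul_le_mul_right (coe_le_coe_add_mul_edist hf _ _) _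

lemma measurable_pathProb_mul_comp_wordMap (M : MarkovSystem K N E) (l : List (Alphabet E))
    {f : K → ℝ≥0∞} (hf : Measurable f) : Measurable fun z => M.pathProb l z * f (M.wordMap l z) :=
  (M.measurable_pathProb l).mul (hf.comp (M.measurable_wordMap l))

lemma lintegral_map_wordMap_withDensity_pathProb (M : MarkovSystem K N E) (μ : Measure K)
    (l : List (Alphabet E)) {f : K → ℝ≥0∞} (hf : Measurable f) :
    ∫⁻ z, f z ∂(μ.withDensity (M.pathProb l)).map (M.wordMap l) =
      ∫⁻ z, M.pathProb l z * f (M.wordMap l z) ∂μ := by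
  rw [lintegral_map hf (M.measurable_wordMap l)]
  exact lintegral_withDensity_eq_lintegral_mul μ (M.measurable_pathProb l)
    (hf.comp (M.measurable_wordMap l))

lemma lintegral_wordSum_pathProb_append (M : MarkovSystem K N E) {μ : Measure K}
    (hμ : M.adj μ = μ) (l : List (Alphabet E)) {f : K → ℝ≥0∞} (hf : Measurable f) (n : ℕ) :
    wordSum n (fun u => ∫⁻ z, M.pathProb (u ++ l) z * f (M.wordMap (u ++ l) z) ∂μ) =
      ∫⁻ z, M.pathProb l z * f (M.wordMap l z) ∂μ := by
  rw [← lintegral_wordSum _ _ fun u => M.measurable_pathProb_mul_comp_wordMap (u ++ l) hf,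
    ← M.lintegral_wordSum_pathProb hμ (M.measurable_pathProb_mul_comp_wordMap l hf) n]
  simp_rw [pathProb_append, wordMap_append, mul_assoc]

namespace IsLift

variable {μ : Measure K} {Λ : Measure (CodeSpace E)} {ρ : ℝ≥0∞} {x : N → K}
  (h : M.IsLift μ Λ) (hμ : μ ∈ M.invariantMeasures)
include h hμ

lemma setLIntegral_approx_eq (x : N → K) (g : K → ℝ≥0∞) (l : List (Alphabet E)) (k : ℕ) :
    ∫⁻ σ in cyl (1 - (l.length : ℤ)) l, g (M.approx x σ (k + l.length)) ∂Λ =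
      wordSum (k + 1) fun u =>
        ∫⁻ z, M.pathProb (u ++ l) z * g (M.basePoint x (u ++ l)) ∂μ := by
  have hstart : (1 - l.length : ℤ) = -((k + l.length : ℕ) : ℤ) + (k + 1 : ℕ) := by
    push_cast; ring
  calc _ = ∫⁻ σ in cyl (-((k + l.length : ℕ) : ℤ) + (k + 1 : ℕ)) l,
        g (M.basePoint x (window (-((k + l.length : ℕ) : ℤ)) (k + 1) σ ++ l)) ∂Λ := by
        rw [hstart]
        refine setLIntegral_congr_fun (measurableSet_cyl _ _) fun σ hσ => ?_
        simp only [approx_eq_basePoint]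
        rw [add_right_comm k, window_add, mem_cyl_iff.1 hσ]
    _ = _ := by
        rw [setLIntegral_window_cyl Λ _ _ _ fun u => g (M.basePoint x (u ++ l))]
        refine wordSum_congr fun u _ => ?_
        rw [lintegral_mul_const _ (M.measurable_pathProb _), h.measure_cyl hμ, mul_comm]

section Contraction

variable (hM : M.ContractsBy ρ) (hx : ∀ j, x j ∈ M.cell j)
include hM hx

lemma setLIntegral_approx_le {C : ℝ≥0∞} (hC : ∫⁻ z, M.baseDist x z ∂μ ≤ C) {f : K → ℝ≥0}
    {c : ℝ≥0} (hf : LipschitzWith c f) (l : List (Alphabet E)) (k : ℕ) :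
    ∫⁻ σ in cyl (1 - (l.length : ℤ)) l, f (M.approx x σ (k + l.length)) ∂Λ ≤
      ∫⁻ z, M.pathProb l z * f (M.wordMap l z) ∂μ + c * (ρ ^ (k + 1 + l.length) * C) := by
  have := hμ.1
  have hfm : Measurable fun z => (f z : ℝ≥0∞) := hf.continuous.measurable.coe_nnreal_ennreal
  let error (w : List (Alphabet E)) (z : K) : ℝ≥0∞ :=
    M.pathProb w z * (c * edist (M.wordMap w z) (M.wordMap w (x (M.vertex z))))
  have herror := hM.lintegral_wordSum_error_le hx hC 0 c (k + 1 + l.length)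
  simp only [zero_add] at herror
  calc _ = wordSum (k + 1) fun u =>
        ∫⁻ z, M.pathProb (u ++ l) z * f (M.basePoint x (u ++ l)) ∂μ :=
        h.setLIntegral_approx_eq hμ x (fun z => f z) l k
    _ ≤ wordSum (k + 1) fun u => ∫⁻ z, M.pathProb (u ++ l) z * f (M.wordMap (u ++ l) z) ∂μ +
        ∫⁻ z, error (u ++ l) z ∂μ := by
        refine wordSum_mono fun u hu => ?_
        rw [← lintegral_add_left (M.measurable_pathProb_mul_comp_wordMap _ hfm)]
        exact lintegral_mono fun z => M.pathProb_mul_basePoint_le x hf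
          (List.append_ne_nil_of_left_ne_nil (List.ne_nil_of_length_eq_add_one hu) l) z
    _ ≤ _ := by
        rw [wordSum_add, M.lintegral_wordSum_pathProb_append hμ.2 l hfm]
        exact add_le_add le_rfl
          ((wordSum_append_le (k + 1) l fun w => ∫⁻ z, error w z ∂μ).trans herror)

variable [CompleteSpace K] (hρ : ρ < 1) (hb : M.bConst x < ∞)
include hρ hb

lemma measure_codingDomain : Λ (M.codingDomain x) = 1 := by
  have := hμ.1
  exact (h.isPathLimit hμ).measure_codingDomain hM hρ hx
    (fun _ => hM.lintegral_baseDist_le hx hρ hμ.2)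
    (ENNReal.mul_ne_top (ENNReal.inv_ne_top.2 (tsub_pos_of_lt hρ).ne') hb.ne) hb

lemma setLIntegral_codeLim_le {f : K → ℝ≥0} {c : ℝ≥0} (hf : LipschitzWith c f)
    (hf1 : ∀ z, f z ≤ 1) (l : List (Alphabet E)) :
    ∫⁻ σ in cyl (1 - (l.length : ℤ)) l, f (M.codeLim x σ) ∂Λ ≤
      ∫⁻ z, M.pathProb l z * f (M.wordMap l z) ∂μ := by
  have := h.1
  have := hμ.1
  have hC := hM.lintegral_baseDist_le hx hρ hμ.2
  have hC' : (1 - ρ)⁻¹ * M.bConst x ≠ ∞ :=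
    ENNReal.mul_ne_top (ENNReal.inv_ne_top.2 (tsub_pos_of_lt hρ).ne') hb.ne
  have hshift (r : ℕ) : Tendsto (fun k : ℕ => k + r) atTop atTop := tendsto_add_atTop_nat r
  have hlim : Tendsto (fun k => ∫⁻ σ in cyl (1 - (l.length : ℤ)) l,
      f (M.approx x σ (k + l.length)) ∂Λ) atTop
      (𝓝 (∫⁻ σ in cyl (1 - (l.length : ℤ)) l, f (M.codeLim x σ) ∂Λ)) := by
    refine tendsto_lintegral_of_dominated_convergence (fun _ => 1) (fun k =>
      hf.continuous.measurable.coe_nnreal_ennreal.comp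
        ((M.stronglyMeasurable_approx x _).mono (pastSigma_le E)).measurable)
      (fun k => Eventually.of_forall fun σ => ENNReal.coe_le_one_iff.2 (hf1 _)) (by simp) ?_
    filter_upwards [ae_restrict_of_ae
      (M.ae_mem_codingDomain (h.measure_codingDomain hμ hM hx hρ hb))] with σ hσ
    exact ENNReal.tendsto_coe.2 ((hf.continuous.tendsto _).comp
      ((M.tendsto_codeLim hσ).comp (hshift l.length)))
  have herror : Tendsto (fun k => c * (ρ ^ (k + 1 + l.length) * ((1 - ρ)⁻¹ * M.bConst x))) atTop
      (𝓝 0) := by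
    have hpow := (ENNReal.tendsto_pow_atTop_nhds_zero_of_lt_one hρ).comp (hshift (1 + l.length))
    simpa [Function.comp_def, add_assoc] using ENNReal.Tendsto.const_mul (a := (c : ℝ≥0∞))
      (ENNReal.Tendsto.mul_const hpow (Or.inr hC')) (Or.inr ENNReal.coe_ne_top)
  simpa only [add_zero] using le_of_tendsto_of_tendsto' hlim (tendsto_const_nhds.add herror)
    fun k => h.setLIntegral_approx_le hμ hM hx hC hf l k

-- Both sides have the same mass, so it is enough to compare them in one direction.
lemma map_codeLim_restrict_cyl (l : List (Alphabet E)) :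
    (Λ.restrict (cyl (1 - (l.length : ℤ)) l)).map (M.codeLim x) =
      (μ.withDensity (M.pathProb l)).map (M.wordMap l) := by
  have := h.1
  have := hμ.1
  have : IsFiniteMeasure (μ.withDensity (M.pathProb l)) :=
    isFiniteMeasure_withDensity (h.measure_cyl hμ 0 l ▸ measure_ne_top Λ _)
  refine measure_eq_of_lintegral_lipschitz_le (fun f c hf hf1 => ?_) ?_
  · have hfm : Measurable fun z => (f z : ℝ≥0∞) := hf.continuous.measurable.coe_nnreal_ennreal
    rw [lintegral_map hfm (M.measurable_codeLim x),
      M.lintegral_map_wordMap_withDensity_pathProb μ l hfm]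
    exact h.setLIntegral_codeLim_le hμ hM hx hρ hb hf hf1 l
  · rw [Measure.map_apply (M.measurable_codeLim x) .univ,
      Measure.map_apply (M.measurable_wordMap l) .univ, Set.preimage_univ, Set.preimage_univ,
      Measure.restrict_apply_univ, withDensity_apply _ .univ, setLIntegral_univ,
      h.measure_cyl hμ]

lemma stepLaw : M.StepLaw x Λ := by
  intro a A hA
  have := h.1
  have hcyl (n : ℕ) (l : List (Alphabet E)) (hl : l.length = n + 1) :
      Λ.restrict (cyl 1 [a]) (cyl (-(n : ℤ)) l) =
        Λ.withDensity (fun σ => M.prob a (M.codeLim x σ)) (cyl (-(n : ℤ)) l) := by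
    have hn : -(n : ℤ) = 1 - l.length := by rw [hl]; push_cast; ring
    rw [Measure.restrict_apply (measurableSet_cyl _ _), withDensity_apply _ (measurableSet_cyl _ _)]
    calc Λ (cyl (-(n : ℤ)) l ∩ cyl 1 [a]) = Λ (cyl (-(n : ℤ)) (l ++ [a])) := by
          congr 1
          ext σ
          rw [mem_cyl_append, hn, sub_add_cancel]
          rfl
      _ = ∫⁻ z, M.pathProb l z * M.prob a (M.wordMap l z) ∂μ := by
          simp_rw [h.measure_cyl hμ, pathProb_append, pathProb_singleton]
      _ = ∫⁻ z, M.prob a z ∂(μ.withDensity (M.pathProb l)).map (M.wordMap l) :=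
          (M.lintegral_map_wordMap_withDensity_pathProb μ l (M.measurable_prob a)).symm
      _ = ∫⁻ σ in cyl (-(n : ℤ)) l, M.prob a (M.codeLim x σ) ∂Λ := by
          rw [← h.map_codeLim_restrict_cyl hμ hM hx hρ hb l,
            lintegral_map (M.measurable_prob a) (M.measurable_codeLim x), hn]
  rw [← withDensity_apply _ (pastSigma_le E _ hA), ← measure_eq_of_past_cyl hcyl hA,
    Measure.restrict_apply (pastSigma_le E _ hA)]

lemma codingMeasure_eq : M.codingMeasure x Λ = μ := by
  have := h.1
  have hmap := h.map_codeLim_restrict_cyl hμ hM hx hρ hb []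
  have hone : M.pathProb [] = 1 := rfl
  rw [cyl_nil, Measure.restrict_univ, hone, withDensity_one] at hmap
  rw [M.codingMeasure_eq (h.measure_codingDomain hμ hM hx hρ hb)]
  exact hmap.trans Measure.map_id

lemma mem_equilibriumStates : Λ ∈ M.equilibriumStates x :=
  M.mem_equilibriumStates_iff.2 ⟨(h.isPathLimit hμ).mem_shiftInvariant,
    h.measure_codingDomain hμ hM hx hρ hb, h.stepLaw hμ hM hx hρ hb⟩

end Contraction

end IsLift

lemma ContractsBy.bijOn_codingMeasure_and_invOn_lift [CompleteSpace K] {ρ : ℝ≥0∞} {x : N → K}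
    (hM : M.ContractsBy ρ) (hρ : ρ < 1) (hx : ∀ j, x j ∈ M.cell j) (hb : M.bConst x < ∞) :
    Set.BijOn (M.codingMeasure x) (M.equilibriumStates x) M.invariantMeasures ∧
      Set.MapsTo M.lift M.invariantMeasures (M.equilibriumStates x) ∧
      Set.InvOn M.lift (M.codingMeasure x) (M.equilibriumStates x) M.invariantMeasures := by
  have hcoding : Set.MapsTo (M.codingMeasure x) (M.equilibriumStates x) M.invariantMeasures :=
    fun Λ => codingMeasure_mem_invariantMeasures hx hM hρ.ne_top
  have hlift : Set.MapsTo M.lift M.invariantMeasures (M.equilibriumStates x) := fun μ hμ => by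
    obtain ⟨Λ, hΛ, -⟩ := existsUnique_isLift hμ
    exact hΛ.lift_eq ▸ hΛ.mem_equilibriumStates hμ hM hx hρ hb
  have hinv : Set.InvOn M.lift (M.codingMeasure x) (M.equilibriumStates x) M.invariantMeasures := by
    refine ⟨fun Λ hΛ => (isLift_codingMeasure hx hM hρ.ne_top hΛ).lift_eq, fun μ hμ => ?_⟩
    obtain ⟨Λ, hΛ, -⟩ := existsUnique_isLift hμ
    exact hΛ.lift_eq ▸ hΛ.codingMeasure_eq hμ hM hx hρ hb
  exact ⟨hinv.bijOn hcoding hlift, hlift, hinv⟩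

end MarkovSystem

/-! ### The maximal inequality and tightness -/

lemma exists_finset_measure_compl_lt {ι : Type*} [Countable ι] [MeasurableSpace ι]
    [MeasurableSingletonClass ι] (ν : Measure ι) [IsFiniteMeasure ν] {ε : ℝ≥0∞} (hε : 0 < ε) :
    ∃ V : Finset ι, ν (V : Set ι)ᶜ < ε := by
  have htsum (s : Set ι) : ∑' j : s, ν {(j : ι)} = ν s :=
    tsum_measure_preimage_singleton (f := id) s.to_countable fun j _ => measurableSet_singleton j
  have hfin : ∑' j, ν {j} ≠ ∞ := by
    rw [← tsum_univ fun j => ν {j}, htsum]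
    exact measure_ne_top ν _
  obtain ⟨V, hV⟩ := ((ENNReal.tendsto_tsum_compl_atTop_zero hfin).eventually_lt_const hε).exists
  exact ⟨V, htsum (V : Set ι)ᶜ ▸ hV⟩

namespace MarkovSystem

variable {K : Type*} [MetricSpace K] [MeasurableSpace K] [BorelSpace K]
  {N : Set ℕ} {E : Type*} [Countable E] (M : MarkovSystem K N E)
  {h : K → ℝ≥0∞} {c : ℝ≥0∞} {μ : Measure K}

/-- The functions `G_0 = 0`, `G_{n+1} = (h + U G_n - c)⁺` of the maximal inequality; `G_n`
dominates the centred sums `∑_{k<n} U^k h - n c`. -/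
def excess (h : K → ℝ≥0∞) (c : ℝ≥0∞) : ℕ → K → ℝ≥0∞
  | 0, _ => 0
  | n + 1, z => (h z + M.markovOp (excess h c n) z) - c

lemma measurable_excess (hh : Measurable h) (n : ℕ) : Measurable (M.excess h c n) := by
  induction n with
  | zero => exact measurable_const
  | succ n ih => exact (hh.add (M.measurable_markovOp ih)).sub_const c

lemma excess_le_succ (n : ℕ) (z : K) : M.excess h c n z ≤ M.excess h c (n + 1) z := by
  induction n generalizing z with
  | zero => exact zero_le
  | succ n ih => exact tsub_le_tsub_right (add_le_add le_rfl (M.markovOp_mono ih z)) c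

lemma lintegral_excess_le (hμ : M.adj μ = μ) (hh : Measurable h) (n : ℕ) :
    ∫⁻ z, M.excess h c n z ∂μ ≤ n * ∫⁻ z, h z ∂μ := by
  induction n with
  | zero => simp [excess]
  | succ n ih =>
    calc ∫⁻ z, M.excess h c (n + 1) z ∂μ
        ≤ ∫⁻ z, h z + M.markovOp (M.excess h c n) z ∂μ := lintegral_mono fun _ => tsub_le_self
      _ = ∫⁻ z, h z ∂μ + ∫⁻ z, M.excess h c n z ∂μ := by
        rw [lintegral_add_left hh, M.lintegral_markovOp hμ (M.measurable_excess hh n)]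
      _ ≤ ∫⁻ z, h z ∂μ + n * ∫⁻ z, h z ∂μ := add_le_add le_rfl ih
      _ = (n + 1 : ℕ) * ∫⁻ z, h z ∂μ := by push_cast; ring

lemma indicator_add_excess_le (n : ℕ) (z : K) :
    {z | M.excess h c n z ≠ 0}.indicator (fun _ => c) z + M.excess h c n z ≤
      h z + M.markovOp (M.excess h c n) z := by
  by_cases hz : M.excess h c n z = 0
  · simp [hz]
  · obtain _ | n := n
    · exact absurd rfl hz
    rw [Set.indicator_of_mem (Set.mem_ofPred_eq ▸ hz)]
    calc c + M.excess h c (n + 1) z = h z + M.markovOp (M.excess h c n) z :=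
          add_tsub_cancel_of_le (tsub_pos_iff_lt.1 (pos_iff_ne_zero.2 hz)).le
      _ ≤ h z + M.markovOp (M.excess h c (n + 1)) z :=
          add_le_add le_rfl (M.markovOp_mono (M.excess_le_succ n) z)

lemma mul_measure_excess_ne_zero_le (hμ : M.adj μ = μ) (hh : Measurable h) (n : ℕ) :
    c * μ {z | M.excess h c n z ≠ 0} ≤ ∫⁻ z, h z ∂μ := by
  by_cases htop : ∫⁻ z, h z ∂μ = ∞
  · exact htop ▸ le_top
  have hm := M.measurable_excess (c := c) hh n
  have hA : MeasurableSet {z | M.excess h c n z ≠ 0} := hm (measurableSet_singleton 0).compl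
  have hfin : ∫⁻ z, M.excess h c n z ∂μ ≠ ∞ :=
    ne_top_of_le_ne_top (ENNReal.mul_ne_top (ENNReal.natCast_ne_top n) htop)
      (M.lintegral_excess_le hμ hh n)
  refine (ENNReal.add_le_add_iff_right hfin).1 ?_
  calc c * μ {z | M.excess h c n z ≠ 0} + ∫⁻ z, M.excess h c n z ∂μ
      = ∫⁻ z, {z | M.excess h c n z ≠ 0}.indicator (fun _ => c) z + M.excess h c n z ∂μ := by
        rw [lintegral_add_right _ hm, lintegral_indicator_const hA]
    _ ≤ ∫⁻ z, h z + M.markovOp (M.excess h c n) z ∂μ :=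
        lintegral_mono (M.indicator_add_excess_le n)
    _ = ∫⁻ z, h z ∂μ + ∫⁻ z, M.excess h c n z ∂μ := by
        rw [lintegral_add_left hh, M.lintegral_markovOp hμ hm]

lemma mul_measure_exists_excess_ne_zero_le (hμ : M.adj μ = μ) (hh : Measurable h) :
    c * μ {z | ∃ n, M.excess h c n z ≠ 0} ≤ ∫⁻ z, h z ∂μ := by
  have hmono : Monotone fun n => {z | M.excess h c n z ≠ 0} :=
    monotone_nat_of_le_succ fun n z hz =>
      (lt_of_lt_of_le (pos_iff_ne_zero.2 hz) (M.excess_le_succ n z)).ne'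
  rw [Set.ofPred_exists, hmono.measure_iUnion, ENNReal.mul_iSup]
  exact iSup_le fun n => M.mul_measure_excess_ne_zero_le hμ hh n

lemma exists_forall_excess_eq_zero [IsProbabilityMeasure μ] (hμ : M.adj μ = μ)
    {h : ℕ → K → ℝ≥0∞} {c δ : ℕ → ℝ≥0∞} (hh : ∀ r, Measurable (h r)) (hc0 : ∀ r, c r ≠ 0)
    (hc : ∀ r, c r ≠ ∞) (hδ : ∑' r, δ r < 1) (hle : ∀ r, ∫⁻ z, h r z ∂μ ≤ c r * δ r) :
    ∃ y, ∀ r n, M.excess (h r) (c r) n y = 0 := by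
  have hbad (r : ℕ) : μ {z | ∃ n, M.excess (h r) (c r) n z ≠ 0} ≤ δ r :=
    (ENNReal.mul_le_mul_iff_right (hc0 r) (hc r)).1
      ((M.mul_measure_exists_excess_ne_zero_le hμ (hh r)).trans (hle r))
  by_contra! hcon
  have huniv : ⋃ r, {z | ∃ n, M.excess (h r) (c r) n z ≠ 0} = Set.univ :=
    Set.eq_univ_of_forall fun y => Set.mem_iUnion.2 (hcon y)
  have hone := (measure_iUnion_le _).trans (ENNReal.tsum_le_tsum hbad)
  rw [huniv, measure_univ] at hone
  exact hone.not_gt hδ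

lemma sum_lintegral_iterate_adj_le (hh : Measurable h) (n : ℕ) (ν : Measure K)
    [IsProbabilityMeasure ν] :
    ∑ k ∈ Finset.range n, ∫⁻ z, h z ∂(M.adj^[k + 1] ν) ≤
      n * c + ∫⁻ z, M.excess (M.markovOp h) c n z ∂ν := by
  have hUh := M.measurable_markovOp hh
  induction n generalizing ν with
  | zero => simp
  | succ n ih =>
    have := M.isProbabilityMeasure_adj ν
    have hm := M.measurable_excess (c := c) hUh n
    rw [Finset.sum_range_succ']
    simp_rw [Function.iterate_succ_apply _ (_ + 1)]
    calc _ ≤ (n * c + ∫⁻ z, M.excess (M.markovOp h) c n z ∂(M.adj ν)) + ∫⁻ z, h z ∂(M.adj ν) :=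
          add_le_add (ih (M.adj ν)) le_rfl
      _ = n * c + ∫⁻ z, M.markovOp h z + M.markovOp (M.excess (M.markovOp h) c n) z ∂ν := by
          rw [M.lintegral_adj ν hm, M.lintegral_adj ν hh, lintegral_add_left hUh]
          ring
      _ ≤ n * c + ∫⁻ z, c + M.excess (M.markovOp h) c (n + 1) z ∂ν :=
          add_le_add le_rfl (lintegral_mono fun z => le_add_tsub)
      _ = (n + 1 : ℕ) * c + ∫⁻ z, M.excess (M.markovOp h) c (n + 1) z ∂ν := by
          rw [lintegral_add_left measurable_const, lintegral_const, measure_univ]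
          push_cast
          ring

lemma map_vertex_eq_sum (ν : Measure K) :
    ν.map M.vertex = Measure.sum fun j => ν (M.cell j) • Measure.dirac j := by
  have hcell (j : N) : M.vertex ⁻¹' {j} = M.cell j :=
    Set.ext fun z => ⟨fun h => h ▸ M.mem_cell_vertex z, fun h => M.vertex_eq h⟩
  simp_rw [← hcell, ← Measure.map_apply M.measurable_vertex (measurableSet_singleton _)]
  exact (Measure.sum_smul_dirac _).symm

lemma alpha_apply (y : K) (n : ℕ) (S : Set N) :
    M.alpha y n S = (n : ℝ≥0∞)⁻¹ * ∑ k ∈ Finset.range n,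
      (M.adj^[k + 1] (Measure.dirac y)) (M.vertex ⁻¹' S) := by
  have hS : MeasurableSet S := .of_discrete
  simp_rw [← Measure.map_apply M.measurable_vertex hS, map_vertex_eq_sum, alpha,
    Measure.sum_apply _ hS, Measure.smul_apply, smul_eq_mul]
  rw [← Summable.tsum_finsetSum fun _ _ => ENNReal.summable, ← ENNReal.tsum_mul_left]
  refine tsum_congr fun j => ?_
  rw [mul_assoc, Finset.sum_mul, Finset.range_eq_Ico,
    Finset.sum_Ico_add' (fun k => (M.adj^[k] (Measure.dirac y)) (M.cell j) * Measure.dirac j S)]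
  rfl

lemma alpha_le_of_excess_eq_zero {S : Set N} {y : K} {n : ℕ}
    (hG : M.excess (M.markovOp ((M.vertex ⁻¹' S).indicator 1)) c n y = 0) :
    M.alpha y n S ≤ c := by
  have hS : MeasurableSet (M.vertex ⁻¹' S) := M.measurable_vertex .of_discrete
  have hm : Measurable ((M.vertex ⁻¹' S).indicator (1 : K → ℝ≥0∞)) := measurable_one.indicator hS
  have hsum := M.sum_lintegral_iterate_adj_le (c := c) hm n (Measure.dirac y)
  rw [lintegral_dirac' _ (M.measurable_excess (M.measurable_markovOp hm) n), hG, add_zero] at hsum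
  simp only [lintegral_indicator_one hS] at hsum
  rw [alpha_apply, mul_comm, ← div_eq_mul_inv]
  exact ENNReal.div_le_of_le_mul (mul_comm (n : ℝ≥0∞) c ▸ hsum)

-- By the maximal inequality, the set of starting points with a large tail average is small.
lemma tightCondition_of_mem_invariantMeasures (hμ : μ ∈ M.invariantMeasures) :
    M.TightCondition := by
  obtain ⟨hprob, hμ⟩ := hμ
  obtain ⟨δ, hδ, hδs⟩ := ENNReal.exists_pos_sum_of_countable' one_ne_zero ℕ
  let c (r : ℕ) : ℝ≥0∞ := ((r : ℝ≥0∞) + 1)⁻¹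
  have hc0 (r : ℕ) : c r ≠ 0 := by simp [c]
  have hc (r : ℕ) : c r ≠ ∞ := by simp [c]
  choose V hV using fun r => exists_finset_measure_compl_lt (μ.map M.vertex)
    (ENNReal.mul_pos (hc0 r) (hδ r).ne')
  have hS (r : ℕ) : MeasurableSet (M.vertex ⁻¹' (V r : Set N)ᶜ) :=
    M.measurable_vertex .of_discrete
  have hm (r : ℕ) : Measurable ((M.vertex ⁻¹' (V r : Set N)ᶜ).indicator (1 : K → ℝ≥0∞)) :=
    measurable_one.indicator (hS r)
  obtain ⟨y, hy⟩ := M.exists_forall_excess_eq_zero hμ (δ := δ)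
    (fun r => M.measurable_markovOp (hm r)) hc0 hc hδs fun r => by
      rw [M.lintegral_markovOp hμ (hm r), lintegral_indicator_one (hS r),
        ← Measure.map_apply M.measurable_vertex .of_discrete]
      exact (hV r).le
  refine ⟨y, fun ε hε => ?_⟩
  obtain ⟨r, hr⟩ := ENNReal.exists_inv_nat_lt hε.ne'
  refine ⟨V r, fun n _ => ?_⟩
  calc M.alpha y n (V r : Set N)ᶜ ≤ c r := M.alpha_le_of_excess_eq_zero (hy r n)
    _ ≤ (r : ℝ≥0∞)⁻¹ := ENNReal.inv_le_inv.2 le_self_add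
    _ < ε := hr

end MarkovSystem

/-! ### Limits of averaged distributions -/

lemma tsum_eq_of_tendsto_of_tail {ι α : Type*} {ω : Filter ι} [ω.NeBot] {f : ι → α → ℝ≥0∞}
    {f' : α → ℝ≥0∞} {F' : ℝ≥0∞} (hf : ∀ a, Tendsto (fun i => f i a) ω (𝓝 (f' a)))
    (hF : Tendsto (fun i => ∑' a, f i a) ω (𝓝 F'))
    (htail : ∀ ε : ℝ≥0∞, 0 < ε → ∃ (Q : Finset α) (r : ι → ℝ≥0∞), Tendsto r ω (𝓝 ε) ∧
      ∀ i, ∑' a : ((Q : Set α)ᶜ : Set α), f i a ≤ r i) : ∑' a, f' a = F' := by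
  refine le_antisymm ?_ (ENNReal.le_of_forall_pos_le_add fun ε hε _ => ?_)
  · rw [ENNReal.tsum_eq_iSup_sum]
    exact iSup_le fun s => le_of_tendsto_of_tendsto (tendsto_finsetSum s fun a _ => hf a) hF
      (Eventually.of_forall fun i => ENNReal.sum_le_tsum s)
  · obtain ⟨Q, r, hr, hQ⟩ := htail ε (ENNReal.coe_pos.2 hε)
    have hle (i : ι) : ∑' a, f i a ≤ ∑ a ∈ Q, f i a + r i :=
      (ENNReal.sum_add_tsum_compl Q (f i)).symm.trans_le (add_le_add le_rfl (hQ i))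
    exact (le_of_tendsto_of_tendsto hF ((tendsto_finsetSum Q fun a _ => hf a).add hr)
      (Eventually.of_forall hle)).trans (add_le_add (ENNReal.sum_le_tsum Q) le_rfl)

lemma inv_mul_sum_range_le {n : ℕ} {u : ℕ → ℝ≥0∞} {C : ℝ≥0∞} (hu : ∀ k, u k ≤ C) :
    (n : ℝ≥0∞)⁻¹ * ∑ k ∈ Finset.range n, u k ≤ C := by
  rw [mul_comm, ← div_eq_mul_inv]
  refine ENNReal.div_le_of_le_mul' ?_
  simpa using Finset.sum_le_card_nsmul (Finset.range n) u C fun k _ => hu k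

namespace MarkovSystem

variable {K : Type*} [MetricSpace K] [MeasurableSpace K] [BorelSpace K]
  {N : Set ℕ} {E : Type*} [Countable E] (M : MarkovSystem K N E)

/-- A measure that is invariant up to the error `r`, uniformly over all test functions
`0 ≤ f ≤ 1`. -/
def AlmostInvariant (r : ℝ≥0∞) (μ : Measure K) : Prop :=
  ∀ f : K → ℝ≥0∞, Measurable f → (∀ z, f z ≤ 1) →
    ∫⁻ z, M.markovOp f z ∂μ ≤ ∫⁻ z, f z ∂μ + r ∧ ∫⁻ z, f z ∂μ ≤ ∫⁻ z, M.markovOp f z ∂μ + r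

/-- The average of the distributions at the times `1, …, n + 1` of the chain started at `y`. -/
def average (y : K) (n : ℕ) : Measure K :=
  ((n + 1 : ℕ) : ℝ≥0∞)⁻¹ • ∑ k ∈ Finset.range (n + 1), M.adj^[k + 1] (Measure.dirac y)

lemma lintegral_average (y : K) (n : ℕ) (f : K → ℝ≥0∞) :
    ∫⁻ z, f z ∂(M.average y n) = ((n + 1 : ℕ) : ℝ≥0∞)⁻¹ *
      ∑ k ∈ Finset.range (n + 1), ∫⁻ z, f z ∂(M.adj^[k + 1] (Measure.dirac y)) := by
  rw [average, lintegral_smul_measure, lintegral_finsetSum_measure, smul_eq_mul]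

lemma average_vertex_preimage (y : K) (n : ℕ) (S : Set N) :
    M.average y n (M.vertex ⁻¹' S) = M.alpha y (n + 1) S := by
  rw [alpha_apply, average, Measure.smul_apply, smul_eq_mul, Measure.finsetSum_apply]

lemma isProbabilityMeasure_average (y : K) (n : ℕ) : IsProbabilityMeasure (M.average y n) := by
  have (k : ℕ) := M.isProbabilityMeasure_adj_iterate (Measure.dirac y) k
  refine ⟨?_⟩
  rw [← lintegral_one, lintegral_average]
  simp only [lintegral_one, measure_univ, Finset.sum_const, Finset.card_range, nsmul_eq_mul,
    mul_one]
  exact ENNReal.inv_mul_cancel (by simp) (by simp)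

lemma almostInvariant_cesaro {ν : ℕ → Measure K} (hν : ∀ k, IsProbabilityMeasure (ν k))
    (hsucc : ∀ k, ν (k + 1) = M.adj (ν k)) (n : ℕ) :
    M.AlmostInvariant (n : ℝ≥0∞)⁻¹ ((n : ℝ≥0∞)⁻¹ • ∑ k ∈ Finset.range n, ν k) := by
  intro f hf hf1
  have hle (k : ℕ) : ∫⁻ z, f z ∂ν k ≤ 1 :=
    (lintegral_mono hf1).trans_eq (by rw [lintegral_one, measure_univ])
  have hU (k : ℕ) : ∫⁻ z, M.markovOp f z ∂ν k = ∫⁻ z, f z ∂ν (k + 1) := by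
    rw [← M.lintegral_adj _ hf, hsucc]
  have htele : ∑ k ∈ Finset.range n, ∫⁻ z, f z ∂ν (k + 1) + ∫⁻ z, f z ∂ν 0 =
      ∑ k ∈ Finset.range n, ∫⁻ z, f z ∂ν k + ∫⁻ z, f z ∂ν n := by
    rw [← Finset.sum_range_succ' fun k => ∫⁻ z, f z ∂ν k, ← Finset.sum_range_succ]
  simp only [lintegral_smul_measure, lintegral_finsetSum_measure, smul_eq_mul, hU]
  constructor
  · rw [← mul_add_one]
    exact mul_le_mul_right (le_self_add.trans (htele.trans_le (add_le_add le_rfl (hle n)))) _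
  · rw [← mul_add_one]
    exact mul_le_mul_right (le_self_add.trans (htele.symm.trans_le (add_le_add le_rfl (hle 0)))) _

lemma almostInvariant_average (y : K) (n : ℕ) :
    M.AlmostInvariant ((n + 1 : ℕ) : ℝ≥0∞)⁻¹ (M.average y n) :=
  M.almostInvariant_cesaro (fun k => M.isProbabilityMeasure_adj_iterate (Measure.dirac y) (k + 1))
    (fun k => Function.iterate_succ_apply' M.adj (k + 1) _) (n + 1)

lemma AlmostInvariant.lintegral_pathProb_mul_le {M : MarkovSystem K N E} {r : ℝ≥0∞}
    {μ : Measure K} (h : M.AlmostInvariant r μ) {f : K → ℝ≥0∞} (hf : Measurable f)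
    (hf1 : ∀ z, f z ≤ 1) (l : List (Alphabet E)) :
    ∫⁻ z, M.pathProb l z * f (M.wordMap l z) ∂μ ≤ ∫⁻ z, f z ∂μ + l.length * r := by
  induction l with
  | nil => simp [pathProb, wordMap]
  | cons a l ih =>
    have hm : Measurable fun z => M.pathProb l z * f (M.wordMap l z) :=
      M.measurable_pathProb_mul_comp_wordMap l hf
    have hle (z : K) : M.pathProb (a :: l) z * f (M.wordMap (a :: l) z) ≤
        M.markovOp (fun z => M.pathProb l z * f (M.wordMap l z)) z := by
      rw [markovOp_eq, pathProb_cons, mul_assoc]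
      exact ENNReal.le_tsum (f := fun a => M.prob a z *
        (M.pathProb l (M.wExt a z) * f (M.wordMap l (M.wExt a z)))) a
    calc _ ≤ ∫⁻ z, M.markovOp (fun z => M.pathProb l z * f (M.wordMap l z)) z ∂μ :=
          lintegral_mono hle
      _ ≤ ∫⁻ z, M.pathProb l z * f (M.wordMap l z) ∂μ + r :=
          (h _ hm fun z => mul_le_one' (M.pathProb_le_one l z) (hf1 _)).1
      _ ≤ ∫⁻ z, f z ∂μ + l.length * r + r := add_le_add ih le_rfl
      _ = ∫⁻ z, f z ∂μ + (a :: l).length * r := by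
        rw [List.length_cons]
        push_cast
        ring

/-- The probability that the next letter is outside of `Q`. -/
def tailProb (Q : Finset (Alphabet E)) (z : K) : ℝ≥0∞ :=
  ∑' a : ((Q : Set (Alphabet E))ᶜ : Set (Alphabet E)), M.prob a z

lemma measurable_tailProb (Q : Finset (Alphabet E)) : Measurable (M.tailProb Q) :=
  Measurable.tsum fun a => M.measurable_prob a

lemma tailProb_le_one (Q : Finset (Alphabet E)) (z : K) : M.tailProb Q z ≤ 1 :=
  (ENNReal.tsum_comp_le_tsum_of_injective Subtype.val_injective fun a => M.prob a z).trans_eq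
    (M.tsum_prob z)

variable {M}

section Limit

variable {ι : Type*} {ω : Filter ι} [ω.NeBot] {μ : ι → Measure K} {r : ι → ℝ≥0∞}
  {q : List (Alphabet E) → ℝ≥0∞}
  (hq : ∀ l, Tendsto (fun i => ∫⁻ z, M.pathProb l z ∂μ i) ω (𝓝 (q l)))
  (hr : Tendsto r ω (𝓝 0)) (hμ : ∀ i, M.AlmostInvariant (r i) (μ i))
  (htail : ∀ ε : ℝ≥0∞, 0 < ε → ∃ Q : Finset (Alphabet E), ∀ i, ∫⁻ z, M.tailProb Q z ∂μ i ≤ ε)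
include hq hr hμ htail

lemma tsum_append_singleton_of_almostInvariant (l : List (Alphabet E)) :
    ∑' a, q (l ++ [a]) = q l := by
  have hPm := M.measurable_pathProb
  refine tsum_eq_of_tendsto_of_tail (fun a => hq _) ((hq l).congr fun i => ?_) fun ε hε => ?_
  · rw [← lintegral_tsum fun a => (hPm _).aemeasurable]
    simp_rw [tsum_pathProb_append]
  obtain ⟨Q, hQ⟩ := htail ε hε
  refine ⟨Q, fun i => ε + l.length * r i, ?_, fun i => ?_⟩
  · simpa using (ENNReal.Tendsto.const_mul (a := (l.length : ℝ≥0∞)) hr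
      (Or.inr (by simp))).const_add ε
  calc ∑' a : ((Q : Set (Alphabet E))ᶜ : Set _), ∫⁻ z, M.pathProb (l ++ [a.1]) z ∂μ i
      = ∫⁻ z, M.pathProb l z * M.tailProb Q (M.wordMap l z) ∂μ i := by
        rw [← lintegral_tsum fun a => (hPm _).aemeasurable]
        simp_rw [pathProb_append, pathProb_singleton, ENNReal.tsum_mul_left]
        rfl
    _ ≤ ∫⁻ z, M.tailProb Q z ∂μ i + l.length * r i :=
        (hμ i).lintegral_pathProb_mul_le (M.measurable_tailProb Q) (M.tailProb_le_one Q) l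
    _ ≤ ε + l.length * r i := add_le_add (hQ i) le_rfl

lemma tsum_cons_of_almostInvariant (l : List (Alphabet E)) : ∑' a, q (a :: l) = q l := by
  have hPm := M.measurable_pathProb
  have hsum (i : ι) : ∑' a, ∫⁻ z, M.pathProb (a :: l) z ∂μ i =
      ∫⁻ z, M.markovOp (M.pathProb l) z ∂μ i := by
    rw [← lintegral_tsum fun a => (hPm _).aemeasurable]
    simp_rw [pathProb_cons, markovOp_eq]
  have hinv (i : ι) := hμ i _ (hPm l) (M.pathProb_le_one l)
  have hlim : Tendsto (fun i => ∫⁻ z, M.markovOp (M.pathProb l) z ∂μ i) ω (𝓝 (q l)) := by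
    have hupper := (hq l).add hr
    have hlower := ENNReal.Tendsto.sub (hq l) hr (Or.inr ENNReal.zero_ne_top)
    rw [add_zero] at hupper
    rw [tsub_zero] at hlower
    exact tendsto_of_tendsto_of_tendsto_of_le_of_le hlower hupper
      (fun i => tsub_le_iff_right.2 (hinv i).2) fun i => (hinv i).1
  refine tsum_eq_of_tendsto_of_tail (fun a => hq _) (hlim.congr fun i => (hsum i).symm)
    fun ε hε => ?_
  obtain ⟨Q, hQ⟩ := htail ε hε
  refine ⟨Q, fun _ => ε, tendsto_const_nhds, fun i => (hQ i).trans' ?_⟩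
  rw [← lintegral_tsum fun a => (hPm _).aemeasurable]
  exact lintegral_mono fun z => ENNReal.tsum_le_tsum fun a =>
    mul_le_of_le_one_right' (M.pathProb_le_one l _)

end Limit

lemma exists_isPathLimit {ι : Type*} (ω : Ultrafilter ι) {μ : ι → Measure K} {r : ι → ℝ≥0∞}
    (hprob : ∀ i, IsProbabilityMeasure (μ i)) (hr : Tendsto r ω (𝓝 0))
    (hμ : ∀ i, M.AlmostInvariant (r i) (μ i))
    (htail : ∀ ε : ℝ≥0∞, 0 < ε → ∃ Q : Finset (Alphabet E), ∀ i, ∫⁻ z, M.tailProb Q z ∂μ i ≤ ε) :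
    ∃ Λ, M.IsPathLimit ω μ Λ := by
  have hlim (l : List (Alphabet E)) :
      ∃ q, Tendsto (fun i => ∫⁻ z, M.pathProb l z ∂μ i) ω (𝓝 q) :=
    ⟨_, (ω.map fun i => ∫⁻ z, M.pathProb l z ∂μ i).le_nhds_lim⟩
  choose q hq using hlim
  have hnil : q [] = 1 :=
    tendsto_nhds_unique (hq []) (tendsto_const_nhds.congr fun i => by simp [pathProb])
  obtain ⟨Λ, hΛ, hcyl⟩ := exists_measure_cyl_eq hnil
    (tsum_append_singleton_of_almostInvariant hq hr hμ htail)
    (tsum_cons_of_almostInvariant hq hr hμ htail)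
  exact ⟨Λ, hΛ, hprob, fun m l => hcyl m l ▸ hq l⟩

lemma HasDominatingChain.exists_finset_tailProb_le (hdom : M.HasDominatingChain) (V : Finset N)
    {ε : ℝ≥0∞} (hε : 0 < ε) :
    ∃ Q : Finset (Alphabet E), ∀ z, M.vertex z ∈ V → M.tailProb Q z ≤ ε := by
  classical
  have hfin (j : N) : ∃ s : Finset {e : E // M.i e = j},
      ∑' e : {e // e ∉ s}, (⨆ y ∈ M.cell j, ENNReal.ofReal (M.p e.1.1 y)) < ε :=
    ((ENNReal.tendsto_tsum_compl_atTop_zero (hdom j).ne).eventually_lt_const hε).exists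
  choose s hs using hfin
  set Q := V.biUnion fun j => (s j).image fun e => letter e.1
  refine ⟨Q, fun z hz => ?_⟩
  set j := M.vertex z
  have hzj : z ∈ M.cell j := M.mem_cell_vertex z
  have hmem {e : {e : E // M.i e = j}} (he : e ∈ s j) : letter e.1 ∈ Q :=
    Finset.mem_biUnion.2 ⟨j, hz, Finset.mem_image_of_mem _ he⟩
  calc M.tailProb Q z
      = ∑' a, M.prob a z * (Q : Set (Alphabet E))ᶜ.indicator 1 a := by
        rw [tailProb, tsum_subtype _ fun a => M.prob a z]
        simp [Set.indicator_apply]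
    _ = ∑' e : {e : E // M.i e = j},
          ENNReal.ofReal (M.p e z) * (Q : Set (Alphabet E))ᶜ.indicator 1 (letter e.1) :=
        M.tsum_prob_mul_eq hzj _
    _ ≤ ∑' e, {e | e ∉ s j}.indicator
          (fun e : {e : E // M.i e = j} => ⨆ y ∈ M.cell j, ENNReal.ofReal (M.p e.1 y)) e := by
        refine ENNReal.tsum_le_tsum fun e => ?_
        by_cases he : e ∈ s j
        · simp [hmem he]
        · have hind : (Q : Set (Alphabet E))ᶜ.indicator 1 (letter e.1) ≤ (1 : ℝ≥0∞) :=
            Set.indicator_apply_le' (fun _ => le_rfl) fun _ => zero_le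
          rw [Set.indicator_of_mem (s := {e | e ∉ s j}) he]
          exact (mul_le_of_le_one_right' hind).trans (le_iSup₂_of_le z hzj le_rfl)
    _ = ∑' e : {e // e ∉ s j}, (⨆ y ∈ M.cell j, ENNReal.ofReal (M.p e.1.1 y)) :=
        (tsum_subtype _ _).symm
    _ ≤ ε := (hs j).le

lemma HasDominatingChain.exists_finset_lintegral_tailProb_average_le
    (hdom : M.HasDominatingChain) {y : K}
    (hy : ∀ ε : ℝ≥0∞, 0 < ε → ∃ V : Finset N, ∀ n : ℕ, 1 ≤ n → M.alpha y n (V : Set N)ᶜ < ε)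
    {ε : ℝ≥0∞} (hε : 0 < ε) :
    ∃ Q : Finset (Alphabet E), ∀ n, ∫⁻ z, M.tailProb Q z ∂(M.average y n) ≤ ε := by
  have hε2 : 0 < ε / 2 := ENNReal.half_pos hε.ne'
  obtain ⟨V, hV⟩ := hy _ hε2
  obtain ⟨Q, hQ⟩ := hdom.exists_finset_tailProb_le V hε2
  refine ⟨Q, fun n => ?_⟩
  have := M.isProbabilityMeasure_average y n
  have hS : MeasurableSet (M.vertex ⁻¹' (V : Set N)ᶜ) := M.measurable_vertex .of_discrete
  have hle (z : K) : M.tailProb Q z ≤ ε / 2 + (M.vertex ⁻¹' (V : Set N)ᶜ).indicator 1 z := by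
    by_cases hz : M.vertex z ∈ V
    · exact (hQ z hz).trans le_self_add
    · rw [Set.indicator_of_mem (by simpa using hz)]
      exact (M.tailProb_le_one Q z).trans le_add_self
  calc _ ≤ ∫⁻ z, ε / 2 + (M.vertex ⁻¹' (V : Set N)ᶜ).indicator 1 z ∂(M.average y n) :=
        lintegral_mono hle
    _ = ε / 2 + M.alpha y (n + 1) (V : Set N)ᶜ := by
        rw [lintegral_add_left measurable_const, lintegral_indicator_one hS,
          average_vertex_preimage, lintegral_const, measure_univ, mul_one]
    _ ≤ ε / 2 + ε / 2 := add_le_add le_rfl (hV (n + 1) (by lia)).le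
    _ = ε := ENNReal.add_halves ε

lemma HasDominatingChain.exists_isPathLimit_average (hdom : M.HasDominatingChain) {y : K}
    (hy : ∀ ε : ℝ≥0∞, 0 < ε → ∃ V : Finset N, ∀ n : ℕ, 1 ≤ n → M.alpha y n (V : Set N)ᶜ < ε) :
    ∃ Λ, M.IsPathLimit (hyperfilter ℕ : Filter ℕ) (M.average y) Λ :=
  exists_isPathLimit _ (M.isProbabilityMeasure_average y)
    ((ENNReal.tendsto_inv_nat_nhds_zero.comp (tendsto_add_atTop_nat 1)).mono_left
      Nat.hyperfilter_le_atTop)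
    (M.almostInvariant_average y)
    fun _ hε => hdom.exists_finset_lintegral_tailProb_average_le hy hε

end MarkovSystem

/-! ### Conditioning an asymptotic state -/

lemma map_cond_of_ae_eq_preimage {α : Type*} [MeasurableSpace α] {μ : Measure α} {f : α → α}
    (hf : MeasurePreserving f μ μ) {s : Set α} (hs : MeasurableSet s) (h : s =ᵐ[μ] f ⁻¹' s) :
    μ[|s].map f = μ[|s] := by
  have hres : (μ.restrict s).map f = μ.restrict s := by
    conv_lhs => rw [Measure.restrict_congr_set h]
    exact (hf.restrict_preimage hs).map_eq
  rw [ProbabilityTheory.cond, Measure.map_smul, hres]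

namespace MarkovSystem

variable {K : Type*} [MetricSpace K] [MeasurableSpace K] [BorelSpace K]
  {N : Set ℕ} {E : Type*} [Countable E] (M : MarkovSystem K N E)

/-- The set of the paths `σ` that are coded into the vertex set `K_{t(σ_0)}`, and not merely into
its closure. Conditioned on it, asymptotic states become equilibrium states. -/
def properlyCoded (x : N → K) : Set (CodeSpace E) :=
  {σ | M.codeLim x σ ∈ M.cell (M.tExt (σ 0))}

lemma measurableSet_past_properlyCoded [CompleteSpace K] (x : N → K) :
    MeasurableSet[pastSigma E] (M.properlyCoded x) := by
  have heq : M.properlyCoded x = ⋃ j, M.codeLim x ⁻¹' M.cell j ∩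
      (fun σ : CodeSpace E => σ 0) ⁻¹' (M.tExt ⁻¹' {j}) := by
    ext σ
    simp only [properlyCoded, Set.mem_ofPred_eq, Set.mem_iUnion, Set.mem_inter_iff,
      Set.mem_preimage, Set.mem_singleton_iff]
    exact ⟨fun h => ⟨_, h, rfl⟩, fun ⟨_, h, hj⟩ => hj ▸ h⟩
  rw [heq]
  exact MeasurableSet.iUnion fun j => (M.measurable_past_codeLim x (M.cell_measurable j)).inter
    (measurable_past_eval le_rfl .of_discrete)

variable {M} {x : N → K} {Λ : Measure (CodeSpace E)}

lemma asymptoticProb_eq {e : E} (hp : ContinuousOn (M.p e) (M.cell (M.i e))) {σ : CodeSpace E}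
    (hσ : σ ∈ M.codingDomain x) (hm : σ ∈ M.properlyCoded x) :
    M.asymptoticProb x e σ = M.p e (M.codeLim x σ) := by
  by_cases hT : σ ∈ M.endsAt (M.i e)
  · have hcell : M.codeLim x σ ∈ M.cell (M.i e) := hT.2 ▸ hm
    rw [asymptoticProb, Set.indicator_of_mem hT, M.coding_eq_codeLim hσ, pBar,
      if_pos (subset_closure hcell)]
    exact extendFrom_eq (subset_closure hcell) (hp _ hcell)
  · rw [asymptoticProb, Set.indicator_of_notMem hT]
    exact (M.p_eq_zero e _ fun h => hT ⟨hσ.1, M.cell_unique hm h⟩).symm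

lemma measure_properlyCoded_ne_zero (hD : ∀ᵐ σ ∂Λ, σ ∈ M.codingDomain x) {j : N}
    (hj : 0 < Λ (M.endsAt j ∩ M.coding x ⁻¹' M.cell j)) : Λ (M.properlyCoded x) ≠ 0 := by
  refine (hj.trans_le (measure_mono_ae ?_)).ne'
  filter_upwards [hD] with σ hσ hσj
  have hcell : M.coding x σ ∈ M.cell j := hσj.2
  rwa [M.coding_eq_codeLim hσ, ← hσj.1.2] at hcell

variable [CompleteSpace K]

lemma stepLaw_cond_properlyCoded (hp : ∀ e, ContinuousOn (M.p e) (M.cell (M.i e)))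
    (hΛ : Λ ∈ M.asymptoticStates x) :
    M.StepLaw x Λ[|M.properlyCoded x] := by
  obtain ⟨hS, hD, hA⟩ := hΛ
  have := hS.1
  have hD' := M.ae_mem_codingDomain hD
  have hG := M.measurableSet_past_properlyCoded x
  have hGm := pastSigma_le E _ hG
  have hcond : ∀ᵐ σ ∂Λ[|M.properlyCoded x], σ ∈ M.codingDomain x :=
    cond_absolutelyContinuous.ae_le hD'
  rintro (_ | e) A hAm
  · simp only [prob_none, lintegral_zero]
    exact measure_mono_null Set.inter_subset_right
      (M.measure_cyl_none (hcond.mono fun σ hσ => hσ.1) 1)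
  · have hAm' := pastSigma_le E _ hAm
    have hstep := measure_inter_cyl_of_condExp (hA e) (hG.inter hAm)
    change Λ[|M.properlyCoded x] (A ∩ cyl 1 [letter e]) = _
    rw [cond_apply hGm, ← Set.inter_assoc, hstep, ProbabilityTheory.cond, Measure.restrict_smul,
      lintegral_smul_measure, smul_eq_mul, Measure.restrict_restrict hAm', Set.inter_comm A]
    congr 1
    refine lintegral_congr_ae ?_
    filter_upwards [ae_restrict_of_ae hD', ae_restrict_mem (hGm.inter hAm')] with σ hσ hσG
    exact congrArg ENNReal.ofReal (asymptoticProb_eq (hp e) hσ hσG.1)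

lemma properlyCoded_ae_eq_preimage_shift (hp : ∀ e, ContinuousOn (M.p e) (M.cell (M.i e)))
    (hx : ∀ j, x j ∈ M.cell j) {ρ : ℝ≥0∞} (hM : M.ContractsBy ρ) (hρ : ρ ≠ ∞)
    (hΛ : Λ ∈ M.asymptoticStates x) :
    M.properlyCoded x =ᵐ[Λ] shift ⁻¹' M.properlyCoded x := by
  have hstep := (stepLaw_cond_properlyCoded hp hΛ).ae_prob_ne_zero
  obtain ⟨hS, hD, -⟩ := hΛ
  have := hS.1
  have hD' := M.ae_mem_codingDomain hD
  have hGm := pastSigma_le E _ (M.measurableSet_past_properlyCoded x)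
  have hshift := measurePreserving_shift hS
  have hp0 : ∀ᵐ σ ∂Λ, σ ∈ M.properlyCoded x → M.prob (σ 1) (M.codeLim x σ) ≠ 0 := by
    rw [← ae_restrict_iff' hGm]
    exact (Measure.absolutelyContinuous_smul
      (ENNReal.inv_ne_zero.2 (measure_ne_top Λ (M.properlyCoded x)))).ae_le hstep
  refine ae_eq_of_ae_subset_of_measure_ge ?_ (hshift.measure_preimage hGm.nullMeasurableSet).le
    hGm.nullMeasurableSet (measure_ne_top _ _)
  filter_upwards [hD', hshift.quasiMeasurePreserving.ae hD', hp0] with σ hσ hσ' hprob hσG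
  have hvertex : M.iExt (σ 1) = M.tExt (σ 0) := by simpa using (hσ.1 0).2
  change M.codeLim x (shift σ) ∈ M.cell (M.tExt (σ (0 + 1)))
  rw [M.codeLim_shift hx hM hρ hσ hσ' (hprob hσG), zero_add]
  exact M.wExt_mem (hvertex ▸ hσG)

lemma cond_properlyCoded_mem_equilibriumStates
    (hp : ∀ e, ContinuousOn (M.p e) (M.cell (M.i e))) (hx : ∀ j, x j ∈ M.cell j) {ρ : ℝ≥0∞}
    (hM : M.ContractsBy ρ) (hρ : ρ ≠ ∞) (hΛ : Λ ∈ M.asymptoticStates x)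
    (hG : Λ (M.properlyCoded x) ≠ 0) :
    Λ[|M.properlyCoded x] ∈ M.equilibriumStates x := by
  have := hΛ.1.1
  have hprob := cond_isProbabilityMeasure hG
  refine M.mem_equilibriumStates_iff.2 ⟨⟨hprob, ?_⟩, ?_, stepLaw_cond_properlyCoded hp hΛ⟩
  · exact map_cond_of_ae_eq_preimage (measurePreserving_shift hΛ.1)
      (pastSigma_le E _ (M.measurableSet_past_properlyCoded x))
      (properlyCoded_ae_eq_preimage_shift hp hx hM hρ hΛ)
  · rw [← mem_ae_iff_prob_eq_one (M.measurableSet_codingDomain x)]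
    exact cond_absolutelyContinuous.ae_le (M.ae_mem_codingDomain hΛ.2.1)

lemma ContractsBy.equilibriumStates_nonempty {ρ : ℝ≥0∞} (hM : M.ContractsBy ρ) (hρ : ρ < 1)
    (hx : ∀ j, x j ∈ M.cell j) (hb : M.bConst x < ∞) (hdom : M.HasDominatingChain)
    (hu : ∀ e, UniformContinuousOn (M.p e) (M.cell (M.i e))) (hnd : M.NonDegenerate x)
    (htight : M.TightCondition) : (M.equilibriumStates x).Nonempty := by
  obtain ⟨y, hy⟩ := htight
  obtain ⟨Λ, hlim⟩ := hdom.exists_isPathLimit_average hy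
  have hC (n : ℕ) : ∫⁻ z, M.baseDist x z ∂(M.average y n) ≤
      M.baseDist x y + (1 - ρ)⁻¹ * M.bConst x := by
    rw [lintegral_average]
    exact inv_mul_sum_range_le fun k => M.lintegral_iterate_adj_le_of_drift
      (M.measurable_baseDist x) (hM.markovOp_baseDist_le hx) hρ.le y (k + 1)
  have hC' : M.baseDist x y + (1 - ρ)⁻¹ * M.bConst x ≠ ∞ := by
    have hinv : (1 - ρ)⁻¹ ≠ ∞ := ENNReal.inv_ne_top.2 (tsub_pos_of_lt hρ).ne'
    have hy := M.baseDist_ne_top x y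
    finiteness
  have := hlim.isProbabilityMeasure
  have hΛ := hlim.mem_asymptoticStates hM hρ hx hC hC' hb hu
  obtain ⟨j, hj⟩ := hnd Λ hΛ
  have hG := measure_properlyCoded_ne_zero (M.ae_mem_codingDomain hΛ.2.1) hj
  exact ⟨_, cond_properlyCoded_mem_equilibriumStates (fun e => (hu e).continuousOn) hx hM
    hρ.ne_top hΛ hG⟩

section BasePoints

variable {ρ : ℝ≥0∞} (hM : M.ContractsBy ρ) (hρ : ρ < 1) (hx : ∀ j, x j ∈ M.cell j) {x' : N → K}
  (hx' : ∀ j, x' j ∈ M.cell j) (hb' : M.bConst x' < ∞)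
include hM hρ hx hx' hb'

lemma ContractsBy.equilibriumStates_subset : M.equilibriumStates x ⊆ M.equilibriumStates x' :=
  fun _ hΛ => (isLift_codingMeasure hx hM hρ.ne_top hΛ).mem_equilibriumStates
    (codingMeasure_mem_invariantMeasures hx hM hρ.ne_top hΛ) hM hx' hρ hb'

lemma ContractsBy.eqOn_codingMeasure :
    (M.equilibriumStates x).EqOn (M.codingMeasure x') (M.codingMeasure x) :=
  fun _ hΛ => (isLift_codingMeasure hx hM hρ.ne_top hΛ).codingMeasure_eq
    (codingMeasure_mem_invariantMeasures hx hM hρ.ne_top hΛ) hM hx' hρ hb'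

end BasePoints

end MarkovSystem

end

theorem corollary1_general {K : Type*} [MetricSpace K] [CompleteSpace K] [MeasurableSpace K]
    [BorelSpace K] {N : Set ℕ} {E : Type*} [Countable E] (M : MarkovSystem K N E)
    (x : N → K) (hx : ∀ j, x j ∈ M.cell j) (hcontr : M.Contractive) (hb : M.bConst x < ⊤) :
    ((M.equilibriumStates x).Nonempty → M.TightCondition) ∧
    (M.HasDominatingChain → (∀ e, UniformContinuousOn (M.p e) (M.cell (M.i e))) →
      M.NonDegenerate x → M.TightCondition → (M.equilibriumStates x).Nonempty) ∧
    ((∀ μ ∈ M.invariantMeasures, ∃! Λ, M.IsLift μ Λ) ∧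
      Set.BijOn (M.codingMeasure x) (M.equilibriumStates x) M.invariantMeasures ∧
      Set.MapsTo M.lift M.invariantMeasures (M.equilibriumStates x) ∧
      Set.InvOn M.lift (M.codingMeasure x) (M.equilibriumStates x) M.invariantMeasures) ∧
    (∀ x' : N → K, (∀ j, x' j ∈ M.cell j) → M.bConst x' < ⊤ →
      M.equilibriumStates x' = M.equilibriumStates x ∧
      ∀ Λ ∈ M.equilibriumStates x, M.codingMeasure x' Λ = M.codingMeasure x Λ) := by
  obtain ⟨ρ, hρ, hM⟩ := hcontr.exists_contractsBy
  refine ⟨fun ⟨Λ, hΛ⟩ => ?_, fun hdom hu hnd htight => ?_, ⟨fun μ hμ => ?_, ?_⟩,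
    fun x' hx' hb' => ⟨?_, ?_⟩⟩
  · exact MarkovSystem.tightCondition_of_mem_invariantMeasures M
      (MarkovSystem.codingMeasure_mem_invariantMeasures hx hM hρ.ne_top hΛ)
  · exact hM.equilibriumStates_nonempty hρ hx hb hdom hu hnd htight
  · exact MarkovSystem.existsUnique_isLift hμ
  · exact hM.bijOn_codingMeasure_and_invOn_lift hρ hx hb
  · exact (hM.equilibriumStates_subset hρ hx' hx hb).antisymm
      (hM.equilibriumStates_subset hρ hx hx' hb')
  · exact hM.eqOn_codingMeasure hρ hx hx' hb'

theorem corollary1 {K : Type*} [MetricSpace K] [CompleteSpace K] [MeasurableSpace K] [BorelSpace K]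
    {N : Set ℕ} {E : Type*} [Countable E] (M : MarkovSystem K N E)
    (x : N → K) (hx : ∀ j, x j ∈ M.cell j)
    (hcontr : M.Contractive) (hunif : M.UnifContinuous) (hnd : M.NonDegenerate x)
    (hb : M.bConst x < ⊤) :
    (M.HasDominatingChain → ((M.equilibriumStates x).Nonempty ↔ M.TightCondition)) ∧
    ((∀ μ ∈ M.invariantMeasures, ∃! Λ, M.IsLift μ Λ) ∧
      Set.BijOn (M.codingMeasure x) (M.equilibriumStates x) M.invariantMeasures ∧
      Set.MapsTo M.lift M.invariantMeasures (M.equilibriumStates x) ∧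
      Set.InvOn M.lift (M.codingMeasure x) (M.equilibriumStates x) M.invariantMeasures) ∧
    (∀ x' : N → K, (∀ j, x' j ∈ M.cell j) → M.bConst x' < ⊤ →
      M.equilibriumStates x' = M.equilibriumStates x ∧
      ∀ Λ ∈ M.equilibriumStates x, M.codingMeasure x' Λ = M.codingMeasure x Λ) := by
  obtain ⟨htight, hne, hrest⟩ := corollary1_general M x hx hcontr hb
  exact ⟨fun hdom => ⟨htight, hne hdom (fun e => (hunif e).2) hnd⟩, hrest⟩
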